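/- **Setting.** Let $D\subset\mathbb R^3$ be a bounded open Lipschitz polyhedron, $\omega>0$, and let $\varepsilon,\nu$ be measurable fields of symmetric positive definite matrices on $D$ with eigenvalues uniformly bounded from above and from below away from zero. For such a field $A$ write $(u,v)_A=\int_D Au\cdot v$ and $\|u\|_A^2=(u,u)_A$. Let $H_0(\mathrm{curl})$ be the fields of $H(\mathrm{curl})$ on $D$ with zero tangential trace, $H_0(\mathrm{curl}=0)$ its curl-free fields, $\Pi_0$ the $(\cdot,\cdot)_\varepsilon$-orthogonal projection of $L^2(D)^3$ on $H_0(\mathrm{curl}=0)$; $\perp$ refers to $(\cdot,\cdot)_\varepsilon$. Put $b(v,w)=-\omega^2(v,w)_\varepsilon+(\mathrm{curl}\,v,\mathrm{curl}\,w)_\nu$ and $|||v|||^2=\omega^2\|v\|_\varepsilon^2+\|\mathrm{curl}\,v\|_\nu^2$. Assume that $\omega^2$ is not an eigenvalue of $\varepsilon^{-1}\mathrm{curl}(\nu\,\mathrm{curl}\,\cdot)$ on $H_0(\mathrm{curl})$. For $J\in L^2(D)^3$ let $E\in H_0(\mathrm{curl})$ be the solution of $b(E,w)=(J,w)$ for all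 $w\in H_0(\mathrm{curl})$; for $\theta\in H_0(\mathrm{curl}=0)^\perp$ let $\zeta_\theta\in H_0(\mathrm{curl})$ be the solution of $b(w,\zeta_\theta)=(w,\theta)_\varepsilon$ for all $w\in H_0(\mathrm{curl})$. **Discretization.** Let $\mathcal T_h$ be a matching affine simplicial mesh of $D$, $k\ge1$, $\ell\ge k-1$, and let $P_m(\mathcal T_h)$ be the space of vector fields that are polynomial of total degree at most $m$ in each cell. On an interface $F=\partial K_l\cap\partial K_r$ with unit normal $n_F$ from $K_l$ to $K_r$, put $[v]_F=v|_{K_l}\times n_F-v|_{K_r}\times n_F$ and $\{\phi\}_F=\frac12(\phi|_{K_l}+\phi|_{K_r})$; on a boundary face, with the outward normal $n_F$, put $[v]_F=v|_{K_l}\times n_F$ and $\{\phi\}_F=\phi|_{K_l}$. For $v_h\in P_k(\mathcal T_h)$ let $C_h(v_h)=\mathrm{curl}_h v_h+L_h(v_h)$, where $\mathrm{curl}_h$ is the cellwise curl and $L_h(v_h)\in P_\ell(\mathcal T_h)$ satisfies $(L_h(v_h),\phi_h)=\sum_F\int_F[v_h]_F\cdot\{\phi_h\}_F$ for all $\phi_h\in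 P_\ell(\mathcal T_h)$. On $V_\sharp=H_0(\mathrm{curl})+P_k(\mathcal T_h)$ put $C_h(\tilde v+v_h)=\mathrm{curl}\,\tilde v+C_h(v_h)$. Let $h_K$ be the diameter of the cell $K$, $\tilde\nu_K$ the (essential) minimum over $K$ of the smallest eigenvalue of $\nu$, $\tilde h,\tilde\nu$ the corresponding piecewise constant functions, and $$|||v_h|||_E^2=\|\tilde\nu^{1/2}\tilde h^{-1}v_h\|^2+\|C_h(v_h)\|_\nu^2,\qquad |||v|||_H^2=\|v\|_{\nu^{-1}}^2+\|\tilde\nu^{-1/2}\tilde h\,\mathrm{curl}\,v\|^2,$$ $$|v_h|_{nc}=\min_{v_h^c\in P_k(\mathcal T_h)\cap H_0(\mathrm{curl})}|||v_h-v_h^c|||_E\qquad(v_h\in P_k(\mathcal T_h)).$$ The approximation factors and the divergence conformity factor are $$\gamma_p=\sup_{\theta}\ \min_{v_h^c\in P_k(\mathcal T_h)\cap H_0(\mathrm{curl})}\omega|||\zeta_\theta-v_h^c|||,\qquad \gamma_d=\sup_{\theta}\ \min_{\Phi_h\in P_\ell(\mathcal T_h)\cap H(\mathrm{curl})}\omega|||\nu\,\mathrm{curl}\,\zeta_\theta-\Phi_h|||_H,$$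 with suprema over $\theta\in H_0(\mathrm{curl}=0)^\perp$, $\|\theta\|_\varepsilon=1$, and $$\gamma_{div}=\sup\{\omega\|\Pi_0 v_h\|_\varepsilon:\ v_h\in P_k(\mathcal T_h)\cap(P_k(\mathcal T_h)\cap H_0(\mathrm{curl}=0))^\perp,\ \|C_h(v_h)\|_\nu^2+|v_h|_{nc}^2=1\}.$$ **Method.** Let $s_\sharp$ be a symmetric positive semidefinite bilinear form on $V_\sharp$ that vanishes as soon as one argument is in $H_0(\mathrm{curl})$, and let $b_{\sharp\sharp}(v,w)=-\omega^2(v,w)_\varepsilon+(C_h(v),C_h(w))_\nu+s_\sharp(v,w)$ and $|||v|||_{\sharp\sharp}^2=\omega^2\|v\|_\varepsilon^2+\|C_h(v)\|_\nu^2+s_\sharp(v,v)$ on $V_\sharp$. The discrete problem is to find $E_h\in P_k(\mathcal T_h)$ with $b_{\sharp\sharp}(E_h,w_h)=(J,w_h)$ for all $w_h\in P_k(\mathcal T_h)$. Let $\eta=E-B_h(E)$, where $B_h(E)\in P_k(\mathcal T_h)$ is the best approximation of $E$ in $|||\cdot|||_{\sharp\sharp}$, that is, the orthogonal projection for the inner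 product associated with this norm. **Theorem.** Assume that $\rho>0$ satisfies $\rho\,|v_h|_{nc}\le s_\sharp(v_h,v_h)^{1/2}$ for all $v_h\in P_k(\mathcal T_h)$, and put $$c_\gamma=8\max(\gamma_p^2,\rho^{-2}\gamma_d^2)+\max(1,\rho^{-2})(\gamma_{div}+3\gamma_{div}^2).$$ If $E_h$ solves the discrete problem, the error $e=E-E_h$ satisfies $$(1-c_\gamma)|||e|||_{\sharp\sharp}^2\le(1+4\gamma_{div})|||\eta|||_{\sharp\sharp}^2+2\rho^{-1}|||e|||_{\sharp\sharp}\min_{\Phi_h\in P_\ell(\mathcal T_h)\cap H(\mathrm{curl})}|||\nu\,\mathrm{curl}\,E-\Phi_h|||_H .$$ Consequently, if $c_\gamma<1$, the discrete problem is well-posed: for every $J\in L^2(D)^3$ it has exactly one solution $E_h$, and $E_h$ depends continuously on $J$. -/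

import Mathlib

open MeasureTheory Set Filter Topology
open scoped ENNReal NNReal Matrix RealInnerProductSpace

noncomputable section

namespace Maxwell

/-- Three-dimensional Euclidean space. -/
abbrev E3 : Type := EuclideanSpace ℝ (Fin 3)

/-- Matrix-valued coefficient fields. -/
abbrev Coeff : Type := E3 → Matrix (Fin 3) (Fin 3) ℝ

/-- The cross product of two vectors of Euclidean space. -/
def cross (u v : E3) : E3 := WithLp.toLp 2 (crossProduct u.ofLp v.ofLp)

/-- The product of a matrix and a vector of Euclidean space. -/
def act (A : Matrix (Fin 3) (Fin 3) ℝ) (v : E3) : E3 := WithLp.toLp 2 (A *ᵥ v.ofLp)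

/-! ### The domain and the material coefficients -/

/-- Bounded open sets whose boundary is locally, in suitable orthonormal coordinates, the graph
of a Lipschitz function with the set on one side of the graph. No connectedness is asked for. -/
structure IsLipschitzDomain (D : Set E3) : Prop where
  isOpen : IsOpen D
  isBounded : Bornology.IsBounded D
  lipschitz : ∀ x ∈ frontier D, ∃ (T : E3 ≃ₗᵢ[ℝ] E3) (C : ℝ≥0) (g : ℝ × ℝ → ℝ),
    LipschitzWith C g ∧ ∃ U ∈ 𝓝 x, ∀ y ∈ U, (y ∈ D ↔ g (T y 0, T y 1) < T y 2)

/-- Measurable fields of symmetric positive definite matrices on `D` with eigenvalues uniformly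
bounded from above and from below away from zero. -/
structure IsMaterial (D : Set E3) (A : Coeff) : Prop where
  aemeasurable : ∀ i j, AEMeasurable (fun x => A x i j) (volume.restrict D)
  symm : ∀ᵐ x ∂(volume.restrict D), (A x).IsSymm
  bounds : ∃ a b : ℝ, 0 < a ∧ ∀ᵐ x ∂(volume.restrict D), ∀ ξ : E3,
    a * ‖ξ‖ ^ 2 ≤ ⟪act (A x) ξ, ξ⟫ ∧ ⟪act (A x) ξ, ξ⟫ ≤ b * ‖ξ‖ ^ 2

/-! ### Lebesgue and Sobolev spaces -/

/-- Square-integrable vector fields on `D`. -/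
abbrev L2 (D : Set E3) : Type := Lp E3 2 (volume.restrict D)

section Continuous

variable {D : Set E3}

/-- The weighted bilinear form `(u, v)_A = ∫_D (A u) · v`. -/
def wInner (A : Coeff) (u v : L2 D) : ℝ := ∫ x in D, ⟪act (A x) (u x), v x⟫

/-- The weighted norm associated with `wInner`. -/
def wNorm (A : Coeff) (u : L2 D) : ℝ := Real.sqrt (wInner A u u)

open Classical in
/-- The field `A u`. The condition holds for every `u` if `A` is a material coefficient. -/
def mul (A : Coeff) (u : L2 D) : L2 D :=
  if h : MemLp (fun x => act (A x) (u x)) 2 (volume.restrict D) then h.toLp _ else 0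

/-- The partial derivative `∂_j φ_i`. -/
def partialD (φ : E3 → E3) (j i : Fin 3) (x : E3) : ℝ :=
  (fderiv ℝ φ x (EuclideanSpace.single j 1)) i

/-- The classical curl of a smooth field. -/
def curlField (φ : E3 → E3) (x : E3) : E3 :=
  !₂[partialD φ 1 2 x - partialD φ 2 1 x,
     partialD φ 2 0 x - partialD φ 0 2 x,
     partialD φ 0 1 x - partialD φ 1 0 x]

/-- Smooth vector fields with compact support in `D`. -/
structure IsTestField (D : Set E3) (φ : E3 → E3) : Prop where
  smooth : ContDiff ℝ ((⊤ : ℕ∞) : WithTop ℕ∞) φ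
  compact : HasCompactSupport φ
  support : tsupport φ ⊆ D

/-- `c` is the curl of `v` in the sense of distributions in `D`. -/
def HasWeakCurl (v c : L2 D) : Prop :=
  ∀ φ : E3 → E3, IsTestField D φ →
    ∫ x in D, ⟪v x, curlField φ x⟫ = ∫ x in D, ⟪c x, φ x⟫

/-- The space `H(curl)`. -/
def Hcurl (D : Set E3) : Set (L2 D) := {v | ∃ c, HasWeakCurl v c}

open Classical in
/-- The weak curl of a field in `H(curl)` (which is unique). -/
def curl (v : L2 D) : L2 D := if h : ∃ c, HasWeakCurl v c then h.choose else 0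

/-- The pairs `(φ, curl φ)` with `φ` smooth and compactly supported in `D`. -/
def testGraph (D : Set E3) : Set (L2 D × L2 D) :=
  {p | ∃ φ, IsTestField D φ ∧ p.1 =ᵐ[volume.restrict D] φ ∧
    p.2 =ᵐ[volume.restrict D] curlField φ}

/-- The space `H₀(curl)`, the closure of the smooth compactly supported fields in the graph norm
of `H(curl)`: on a Lipschitz domain, the fields of `H(curl)` with zero tangential trace.
(The set `testGraph D` is already a linear space, so taking its span changes nothing.) -/
def H0curl (D : Set E3) : Submodule ℝ (L2 D) :=
  (Submodule.span ℝ (testGraph D)).topologicalClosure.map (LinearMap.fst ℝ (L2 D) (L2 D))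

/-- The curl-free fields in `H₀(curl)`. -/
def H0curl0 (D : Set E3) : Set (L2 D) := {v | v ∈ H0curl D ∧ HasWeakCurl v 0}

/-- `p` is the orthogonal projection of `v` on `H₀(curl = 0)` for `(·,·)_ε`. -/
def IsProj0 (ε : Coeff) (v p : L2 D) : Prop :=
  p ∈ H0curl0 D ∧ ∀ w ∈ H0curl0 D, wInner ε (v - p) w = 0

open Classical in
/-- The orthogonal projection on `H₀(curl = 0)` for `(·,·)_ε`. -/
def proj0 (ε : Coeff) (v : L2 D) : L2 D := if h : ∃ p, IsProj0 ε v p then h.choose else 0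

/-- The bilinear form of the continuous problem. -/
def bForm (ε ν : Coeff) (ω : ℝ) (v w : L2 D) : ℝ :=
  -ω ^ 2 * wInner ε v w + wInner ν (curl v) (curl w)

/-- `E` solves the weak form of the continuous problem with source `J`. -/
def SolvesWeak (ε ν : Coeff) (ω : ℝ) (J E : L2 D) : Prop :=
  E ∈ H0curl D ∧ ∀ w ∈ H0curl D, bForm ε ν ω E w = ⟪J, w⟫

/-- The number `ω²` is not an eigenvalue of `v ↦ ε⁻¹ curl (ν curl v)` acting on `H₀(curl)`. -/
def NonResonant (D : Set E3) (ε ν : Coeff) (ω : ℝ) : Prop :=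
  ∀ v : L2 D, v ∈ H0curl D → HasWeakCurl (mul ν (curl v)) (ω ^ 2 • mul ε v) → v = 0

/-- The energy norm on `H(curl)`. -/
def energyNorm (ε ν : Coeff) (ω : ℝ) (v : L2 D) : ℝ :=
  Real.sqrt (ω ^ 2 * wNorm ε v ^ 2 + wNorm ν (curl v) ^ 2)

/-- `θ` is orthogonal to `H₀(curl = 0)` for `(·,·)_ε`. -/
def IsPerp0 (ε : Coeff) (θ : L2 D) : Prop := ∀ w ∈ H0curl0 D, wInner ε θ w = 0

/-- `ζ` solves the adjoint problem with data `θ`. -/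
def SolvesAdjoint (ε ν : Coeff) (ω : ℝ) (θ ζ : L2 D) : Prop :=
  ζ ∈ H0curl D ∧ ∀ w ∈ H0curl D, bForm ε ν ω w ζ = wInner ε w θ

end Continuous

/-! ### Meshes and broken polynomials -/

/-- A (matching) affine simplicial mesh covering `D` exactly. A cell is given by the set of its
four vertices; the geometric cell is the closed tetrahedron spanned by them. Any two cells meet in
the convex hull of their common vertices (the empty set, a vertex, an edge or a face). -/
structure Mesh (D : Set E3) where
  cells : Finset (Finset E3)
  card_eq : ∀ K ∈ cells, K.card = 4
  indep : ∀ K ∈ cells, AffineIndependent ℝ ((↑) : K → E3)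
  matching : ∀ K ∈ cells, ∀ K' ∈ cells,
    convexHull ℝ (K : Set E3) ∩ convexHull ℝ (K' : Set E3)
      = convexHull ℝ ((K : Set E3) ∩ (K' : Set E3))
  covers : ⋃ K ∈ cells, convexHull ℝ (K : Set E3) = closure D

/-- Vector-valued polynomials in three variables. -/
abbrev PolyField : Type := Fin 3 → MvPolynomial (Fin 3) ℝ

/-- The value of a vector-valued polynomial at a point. -/
def evalField (q : PolyField) (x : E3) : E3 :=
  WithLp.toLp 2 fun i => MvPolynomial.eval x.ofLp (q i)

/-- The curl of a vector-valued polynomial. -/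
def curlPoly (q : PolyField) : PolyField :=
  ![MvPolynomial.pderiv 1 (q 2) - MvPolynomial.pderiv 2 (q 1),
    MvPolynomial.pderiv 2 (q 0) - MvPolynomial.pderiv 0 (q 2),
    MvPolynomial.pderiv 0 (q 1) - MvPolynomial.pderiv 1 (q 0)]

lemma continuous_evalField (q : PolyField) : Continuous (evalField q) := by
  unfold evalField
  refine (PiLp.continuous_toLp 2 (fun _ : Fin 3 => ℝ)).comp (continuous_pi fun i => ?_)
  exact (MvPolynomial.continuous_eval (q i)).comp (PiLp.continuous_ofLp 2 (fun _ : Fin 3 => ℝ))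

namespace Mesh

section

variable {D : Set E3} (M : Mesh D)

/-- Vector fields that are polynomial in each cell of the mesh. -/
abbrev Broken : Type := {K // K ∈ M.cells} → PolyField

/-- The broken polynomial space of degree at most `k`. -/
def P (k : ℕ) : Submodule ℝ M.Broken where
  carrier := {p | ∀ K i, (p K i).totalDegree ≤ k}
  zero_mem' := by intro K i; simp
  add_mem' := by
    intro p q hp hq K i
    exact (MvPolynomial.totalDegree_add _ _).trans (max_le (hp K i) (hq K i))
  smul_mem' := by
    intro c p hp K i
    exact (MvPolynomial.totalDegree_smul_le c (p K i)).trans (hp K i)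

/-- The function on `D` given by a broken polynomial (well-defined up to the null set of the
cell boundaries). -/
def toFun (p : M.Broken) (x : E3) : E3 :=
  ∑ K : {K // K ∈ M.cells}, (convexHull ℝ (K.1 : Set E3)).indicator (evalField (p K)) x

lemma memLp_toFun (p : M.Broken) : MemLp (M.toFun p) 2 (volume.restrict D) := by
  refine MemLp.mono_measure Measure.restrict_le_self ?_
  unfold toFun
  refine memLp_finsetSum _ fun K _ => ?_
  have hc : IsCompact (convexHull ℝ (K.1 : Set E3)) := K.1.finite_toSet.isCompact_convexHull ℝ
  rw [memLp_indicator_iff_restrict hc.isClosed.measurableSet]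
  have : IsFiniteMeasure (volume.restrict (convexHull ℝ (K.1 : Set E3))) :=
    ⟨by simpa using hc.measure_lt_top⟩
  obtain ⟨C, hC⟩ := hc.exists_bound_of_continuousOn (continuous_evalField (p K)).continuousOn
  refine MemLp.of_bound (continuous_evalField (p K)).aestronglyMeasurable C ?_
  exact (ae_restrict_iff' hc.isClosed.measurableSet).2 (Eventually.of_forall hC)

/-- The square-integrable field given by a broken polynomial. -/
def toL2 : M.Broken →ₗ[ℝ] L2 D where
  toFun p := (M.memLp_toFun p).toLp _
  map_add' p q := by
    rw [← MemLp.toLp_add]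
    congr 1
    funext x
    simp only [Mesh.toFun, Pi.add_apply, ← Finset.sum_add_distrib]
    refine Finset.sum_congr rfl fun K _ => ?_
    have h : evalField ((p + q) K) = evalField (p K) + evalField (q K) := by
      funext y
      ext i
      simp [evalField]
    by_cases hx : x ∈ convexHull ℝ (K.1 : Set E3)
    · simp only [Set.indicator_of_mem hx]
      exact congrFun h x
    · simp only [Set.indicator_of_notMem hx, add_zero]
  map_smul' c p := by
    rw [RingHom.id_apply, ← MemLp.toLp_const_smul]
    congr 1
    funext x
    simp only [Mesh.toFun, Pi.smul_apply, Finset.smul_sum, ← Set.indicator_const_smul_apply]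
    refine Finset.sum_congr rfl fun K _ => ?_
    congr 1
    funext y
    ext i
    simp [evalField]

/-- The broken (cellwise) curl. -/
def brokenCurl (p : M.Broken) : M.Broken := fun K => curlPoly (p K)

/-! ### Faces, jumps and averages -/

open Classical in
/-- The mesh faces, each given by the set of its three vertices. -/
def faces : Finset (Finset E3) := M.cells.biUnion fun K => K.powersetCard 3

open Classical in
/-- The mesh cells (two for an interface, one for a boundary face) that have `F` as a face. -/
def cellsOf (F : Finset E3) : Finset {K // K ∈ M.cells} := Finset.univ.filter fun K => F ⊆ K.1

end

end Mesh

/-- The vertices of a face in some order. -/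
def faceVertex (F : Finset E3) (i : ℕ) : E3 := F.toList.getD i 0

/-- A vector normal to a face, whose length is twice the area of the face. -/
def faceCross (F : Finset E3) : E3 :=
  cross (faceVertex F 1 - faceVertex F 0) (faceVertex F 2 - faceVertex F 0)

/-- The surface integral over a triangle with vertices `a₀, a₁, a₂`, computed with the affine
parametrization `(s, t) ↦ a₀ + s (a₁ - a₀) + t (a₂ - a₀)` over the unit triangle. -/
def faceIntegral (F : Finset E3) (f : E3 → ℝ) : ℝ :=
  ‖faceCross F‖ * ∫ q in {q : ℝ × ℝ | 0 ≤ q.1 ∧ 0 ≤ q.2 ∧ q.1 + q.2 ≤ 1},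
    f (faceVertex F 0 + q.1 • (faceVertex F 1 - faceVertex F 0)
      + q.2 • (faceVertex F 2 - faceVertex F 0))

open Classical in
/-- The unit normal to the face `F` of the cell `K` that points out of `K`, that is, away from
the vertex of `K` opposite to `F` (the only element of `K \ F`). -/
def outNormal (K F : Finset E3) : E3 :=
  -((SignType.sign ⟪faceCross F, (∑ o ∈ K \ F, o) - faceVertex F 0⟫ : SignType) : ℝ) •
    (‖faceCross F‖⁻¹ • faceCross F)

namespace Mesh

section

variable {D : Set E3} (M : Mesh D)

/-- The tangential jump across a face: `v|_{K_l} × n_F - v|_{K_r} × n_F` on an interface, where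
`n_F` points from `K_l` to `K_r` (so that `n_F` is outward for `K_l` and `-n_F` is outward for
`K_r`), and `v|_{K_l} × n_F` with the outward normal on a boundary face. -/
def jump (p : M.Broken) (F : Finset E3) (x : E3) : E3 :=
  ∑ K ∈ M.cellsOf F, cross (evalField (p K) x) (outNormal K.1 F)

/-- The average on a face: the half-sum of the two values on an interface and the only value on
a boundary face. -/
def avg (p : M.Broken) (F : Finset E3) (x : E3) : E3 :=
  ((M.cellsOf F).card : ℝ)⁻¹ • ∑ K ∈ M.cellsOf F, evalField (p K) x

/-- `r` is the jump lifting of `p` of degree `ℓ`. -/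
def IsLift (ℓ : ℕ) (p r : M.Broken) : Prop :=
  r ∈ M.P ℓ ∧ ∀ φ ∈ M.P ℓ,
    ⟪M.toL2 r, M.toL2 φ⟫ = ∑ F ∈ M.faces, faceIntegral F fun x => ⟪M.jump p F x, M.avg φ F x⟫

open Classical in
/-- The jump lifting operator (which exists and is unique by the Riesz theorem). -/
def lift (ℓ : ℕ) (p : M.Broken) : M.Broken := if h : ∃ r, M.IsLift ℓ p r then h.choose else 0

/-- The discrete curl of a broken polynomial: broken curl plus jump lifting. -/
def dCurl (ℓ : ℕ) (p : M.Broken) : M.Broken := M.brokenCurl p + M.lift ℓ p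

/-- The space `V_♯ = H₀(curl) + P_k`. -/
def V (k : ℕ) : Submodule ℝ (L2 D) := H0curl D ⊔ (M.P k).map M.toL2

/-- Discrete fields as elements of `V_♯`. -/
def incl (k : ℕ) (p : M.P k) : M.V k :=
  ⟨M.toL2 p, Submodule.mem_sup_right (Submodule.mem_map_of_mem p.2)⟩

/-- The decompositions of a field into a field of `H₀(curl)` and a broken polynomial. -/
def IsDecomp (k : ℕ) (v : L2 D) (d : L2 D × M.Broken) : Prop :=
  d.1 ∈ H0curl D ∧ d.2 ∈ M.P k ∧ v = d.1 + M.toL2 d.2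

open Classical in
/-- The discrete curl on `V_♯`, computed with a decomposition of the field (the value does not
depend on the decomposition). -/
def dCurlV (k ℓ : ℕ) (v : M.V k) : L2 D :=
  if h : ∃ d, M.IsDecomp k v d then curl h.choose.1 + M.toL2 (M.dCurl ℓ h.choose.2) else 0

/-! ### Mesh-dependent norms and the nonconformity measure -/

/-- The diameter of a cell. -/
def diam (K : Finset E3) : ℝ := Metric.diam (convexHull ℝ (K : Set E3))

/-- The (essential) minimum over a cell of the smallest eigenvalue of `ν`: the largest `c` such
that `ν u · u ≥ c |u|²` for all `u`, almost everywhere in the cell. -/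
def nuMin (D : Set E3) (ν : Coeff) (K : Finset E3) : ℝ :=
  sSup {c : ℝ | ∀ᵐ x ∂(volume.restrict (D ∩ convexHull ℝ (K : Set E3))), ∀ u : E3,
    c * ‖u‖ ^ 2 ≤ ⟪act (ν x) u, u⟫}

/-- The squared norm of a field over a cell. -/
def cellSq (K : Finset E3) (v : L2 D) : ℝ :=
  ∫ x in D ∩ convexHull ℝ (K : Set E3), ‖v x‖ ^ 2

/-- The norm `(‖ν̃^{1/2} h⁻¹ v‖² + ‖C_h v‖²_ν)^{1/2}` on broken polynomials. -/
def normE (ν : Coeff) (ℓ : ℕ) (p : M.Broken) : ℝ :=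
  Real.sqrt ((∑ K ∈ M.cells, nuMin D ν K * (diam K ^ 2)⁻¹ * cellSq K (M.toL2 p))
    + wNorm ν (M.toL2 (M.dCurl ℓ p)) ^ 2)

/-- The norm `(‖v‖²_{ν⁻¹} + ‖ν̃^{-1/2} h curl v‖²)^{1/2}` on `H(curl)`. -/
def normH (ν : Coeff) (v : L2 D) : ℝ :=
  Real.sqrt (wNorm (fun x => (ν x)⁻¹) v ^ 2
    + ∑ K ∈ M.cells, (nuMin D ν K)⁻¹ * diam K ^ 2 * cellSq K (curl v))

/-- Broken polynomials in `H(curl)`. -/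
def Pc (ℓ : ℕ) : Set M.Broken := {p | p ∈ M.P ℓ ∧ M.toL2 p ∈ Hcurl D}

/-- Broken polynomials in `H₀(curl)`. -/
def Pc0 (k : ℕ) : Set M.Broken := {p | p ∈ M.P k ∧ M.toL2 p ∈ H0curl D}

/-- The nonconformity measure of a discrete field, its distance to `Pc0` in the norm `normE`. -/
def nc (ν : Coeff) (k ℓ : ℕ) (p : M.Broken) : ℝ := ⨅ q : M.Pc0 k, M.normE ν ℓ (p - q.1)

/-- The distance of a field to `Pc` in the norm `normH`. -/
def distH (ν : Coeff) (ℓ : ℕ) (v : L2 D) : ℝ := ⨅ Φ : M.Pc ℓ, M.normH ν (v - M.toL2 Φ.1)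

/-! ### Approximation and divergence conformity factors

The adjoint problem has exactly one solution `ζ` if `ω` is not resonant, so that the infimum over
`ζ` is over one element. -/

/-- The primal approximation factor. -/
def gammaP (ε ν : Coeff) (ω : ℝ) (k : ℕ) : ℝ≥0∞ :=
  ⨆ (θ : L2 D) (_ : IsPerp0 ε θ) (_ : wNorm ε θ = 1),
    ⨅ (ζ : L2 D) (_ : SolvesAdjoint ε ν ω θ ζ), ⨅ v ∈ M.Pc0 k,
      ENNReal.ofReal (ω * energyNorm ε ν ω (ζ - M.toL2 v))

/-- The dual approximation factor. -/
def gammaD (ε ν : Coeff) (ω : ℝ) (ℓ : ℕ) : ℝ≥0∞ :=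
  ⨆ (θ : L2 D) (_ : IsPerp0 ε θ) (_ : wNorm ε θ = 1),
    ⨅ (ζ : L2 D) (_ : SolvesAdjoint ε ν ω θ ζ), ⨅ Φ ∈ M.Pc ℓ,
      ENNReal.ofReal (ω * M.normH ν (mul ν (curl ζ) - M.toL2 Φ))

/-- The discrete fields that are orthogonal, for `(·,·)_ε`, to the discrete fields in
`H₀(curl = 0)`. -/
def X (ε : Coeff) (k : ℕ) : Set M.Broken :=
  {p | p ∈ M.P k ∧ ∀ q ∈ M.P k, M.toL2 q ∈ H0curl0 D → wInner ε (M.toL2 p) (M.toL2 q) = 0}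

/-- The divergence conformity factor. -/
def gammaDiv (ε ν : Coeff) (ω : ℝ) (k ℓ : ℕ) : ℝ≥0∞ :=
  ⨆ (p : M.Broken) (_ : p ∈ M.X ε k)
    (_ : wNorm ν (M.toL2 (M.dCurl ℓ p)) ^ 2 + M.nc ν k ℓ p ^ 2 = 1),
      ENNReal.ofReal (ω * wNorm ε (proj0 ε (M.toL2 p)))

/-- The constant of the error estimate. -/
def cGamma (ε ν : Coeff) (ω : ℝ) (k ℓ : ℕ) (ρ : ℝ) : ℝ≥0∞ :=
  8 * max (M.gammaP ε ν ω k ^ 2) (ENNReal.ofReal (ρ⁻¹ ^ 2) * M.gammaD ε ν ω ℓ ^ 2)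
    + max 1 (ENNReal.ofReal (ρ⁻¹ ^ 2))
      * (M.gammaDiv ε ν ω k ℓ + 3 * M.gammaDiv ε ν ω k ℓ ^ 2)

/-! ### The discontinuous Galerkin method -/

/-- The bilinear form `b_♯♯` on `V_♯`, with stabilization `s`. -/
def bss (ε ν : Coeff) (ω : ℝ) (k ℓ : ℕ) (s : LinearMap.BilinForm ℝ (M.V k)) (v w : M.V k) : ℝ :=
  -ω ^ 2 * wInner ε v.1 w.1 + wInner ν (M.dCurlV k ℓ v) (M.dCurlV k ℓ w) + s v w

/-- The bilinear form `b_♯♯⁺` on `V_♯`, with the sign of the zero-order term changed. -/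
def bssPlus (ε ν : Coeff) (ω : ℝ) (k ℓ : ℕ) (s : LinearMap.BilinForm ℝ (M.V k))
    (v w : M.V k) : ℝ :=
  ω ^ 2 * wInner ε v.1 w.1 + wInner ν (M.dCurlV k ℓ v) (M.dCurlV k ℓ w) + s v w

/-- The augmented energy norm on `V_♯`. -/
def normSS (ε ν : Coeff) (ω : ℝ) (k ℓ : ℕ) (s : LinearMap.BilinForm ℝ (M.V k)) (v : M.V k) : ℝ :=
  Real.sqrt (ω ^ 2 * wNorm ε v.1 ^ 2 + wNorm ν (M.dCurlV k ℓ v) ^ 2 + s v v)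

/-- Fields of `H₀(curl)` as elements of `V_♯`. -/
def inclH (k : ℕ) (v : H0curl D) : M.V k := ⟨v.1, Submodule.mem_sup_left v.2⟩

/-- The assumptions on the stabilization: symmetric, positive semidefinite, and vanishing as soon
as one argument is in `H₀(curl)`. -/
structure IsStabilization (k : ℕ) (s : LinearMap.BilinForm ℝ (M.V k)) : Prop where
  symm : ∀ v w, s v w = s w v
  nonneg : ∀ v, 0 ≤ s v v
  ker_left : ∀ (v : H0curl D) (w : M.V k), s (M.inclH k v) w = 0
  ker_right : ∀ (v : H0curl D) (w : M.V k), s w (M.inclH k v) = 0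

/-- `Eh` solves the discrete problem with source `J`. -/
def SolvesDiscrete (ε ν : Coeff) (ω : ℝ) (k ℓ : ℕ) (s : LinearMap.BilinForm ℝ (M.V k))
    (J : L2 D) (Eh : M.P k) : Prop :=
  ∀ w : M.P k, M.bss ε ν ω k ℓ s (M.incl k Eh) (M.incl k w) = ⟪J, M.toL2 w⟫

/-- Well-posedness of the discrete problem: existence, uniqueness and continuous dependence on
the source. -/
def DiscreteWellPosed (ε ν : Coeff) (ω : ℝ) (k ℓ : ℕ) (s : LinearMap.BilinForm ℝ (M.V k)) :
    Prop :=
  (∀ J : L2 D, ∃! Eh : M.P k, M.SolvesDiscrete ε ν ω k ℓ s J Eh) ∧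
  ∃ C : ℝ, ∀ (J : L2 D) (Eh : M.P k), M.SolvesDiscrete ε ν ω k ℓ s J Eh →
    M.normSS ε ν ω k ℓ s (M.incl k Eh) ≤ C * ‖J‖

/-- `B` is the best approximation of `v` in the augmented energy norm: `v - B` is orthogonal to
the discrete space for the inner product `b_♯♯⁺`. -/
def IsBest (ε ν : Coeff) (ω : ℝ) (k ℓ : ℕ) (s : LinearMap.BilinForm ℝ (M.V k))
    (v : M.V k) (B : M.P k) : Prop :=
  ∀ w : M.P k, M.bssPlus ε ν ω k ℓ s (v - M.incl k B) (M.incl k w) = 0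

open Classical in
/-- The best-approximation operator from `V_♯` to the discrete space. -/
def best (ε ν : Coeff) (ω : ℝ) (k ℓ : ℕ) (s : LinearMap.BilinForm ℝ (M.V k)) (v : M.V k) :
    M.P k :=
  if h : ∃ B, M.IsBest ε ν ω k ℓ s v B then h.choose else 0

end

end Mesh

end Maxwell

end

/-!
The discontinuous Galerkin method is not consistent with `b_♯♯` on `V_♯`, and its discrete fields
are neither tangentially continuous nor divergence-conforming. The proof measures both defects.

*Conformity defect.* For `ψ ∈ H(curl)` and a broken polynomial `w`, the defect is
`(ψ, C_h w) - (curl ψ, w)`. It vanishes if `w ∈ H₀(curl)`, because then `C_h w = curl w`, and it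
vanishes if `ψ ∈ P_ℓ ∩ H(curl)`, by Green's formula on each cell: the jump lifting is built to
produce the face terms. Subtracting conforming fields on both sides bounds the defect by the
distance of `ψ` to `P_ℓ ∩ H(curl)` in the norm `|||·|||_H` times `|w|_nc`
(`Mesh.abs_defect_le`). The two vanishing statements are geometric: a conforming broken polynomial
has no tangential jump across faces (`Mesh.jump_eq_zero_of_conforming`) and its weak curl is the
broken curl (`Mesh.weakCurl_eq_brokenCurl`). They rest on the divergence theorem on a tetrahedron,
which is the fundamental theorem of calculus along the edges, and on localization near the interior
of a face; Lipschitz domains enter because they are the interior of their closure and have a null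
boundary.

*Error estimate.* Write the error as `e = η + w`, with `w` discrete and orthogonal to `η` for
`b_♯♯⁺`, so that `|||e|||² = |||η|||² + |||w|||²` and `|||w|||² = b_♯♯(e, w) + 2 ω² (e, w)_ε`.
The first term is the conformity defect of `w` with `ψ = ν curl E` (`Mesh.bss_error`). In the
second term `w` is split into a conforming curl-free discrete field, to which the error is
orthogonal, and a field of the space on which the divergence conformity factor is defined
(`Mesh.exists_splitting`). The projection of the latter on the curl-free fields is small by
definition of this factor (`Mesh.wNorm_proj0_le_of_gammaDiv`), while the part `(I - Π₀) e` of the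
error is handled by duality with the adjoint problem, where the defect with `ψ = ν curl ζ` brings
in the dual approximation factor (`Mesh.wNorm_error_perp_le`). The pieces are put together in
`Mesh.discrete_error_pairing_le` and `Mesh.error_estimate`.

*Well-posedness.* With zero source the estimate for `E = 0` forces a discrete solution to vanish,
and the discrete problem is finite-dimensional and symmetric.
-/

namespace Maxwell

/-! ### Vector algebra in three-dimensional space -/

lemma inner_coord (u v : E3) : ⟪u, v⟫ = u 0 * v 0 + u 1 * v 1 + u 2 * v 2 := by
  rw [PiLp.inner_apply, Fin.sum_univ_three]
  simp only [RCLike.inner_apply, conj_trivial]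
  ring

lemma cross_zero (u v : E3) : cross u v 0 = u 1 * v 2 - u 2 * v 1 := by
  simp [cross, crossProduct]

lemma cross_one (u v : E3) : cross u v 1 = u 2 * v 0 - u 0 * v 2 := by
  simp [cross, crossProduct]

lemma cross_two (u v : E3) : cross u v 2 = u 0 * v 1 - u 1 * v 0 := by
  simp [cross, crossProduct]

lemma ext3 {u v : E3} (h0 : u 0 = v 0) (h1 : u 1 = v 1) (h2 : u 2 = v 2) : u = v := by
  ext i
  fin_cases i <;> assumption

/-- The determinant of three vectors. -/
noncomputable def det3 (u v w : E3) : ℝ := ⟪cross u v, w⟫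

lemma det3_coord (u v w : E3) : det3 u v w =
    (u 1 * v 2 - u 2 * v 1) * w 0 + (u 2 * v 0 - u 0 * v 2) * w 1
      + (u 0 * v 1 - u 1 * v 0) * w 2 := by
  rw [det3, inner_coord, cross_zero, cross_one, cross_two]

/-- Cramer's rule. -/
lemma det3_cramer (u v w y : E3) :
    det3 u v w • y = det3 y v w • u + det3 u y w • v + det3 u v y • w := by
  apply ext3 <;> simp only [det3_coord, PiLp.add_apply, PiLp.smul_apply, smul_eq_mul] <;> ring

lemma det3_add_smul (u v w : E3) (a b c : ℝ) :
    det3 (a • u + b • v + c • w) v w = a * det3 u v w ∧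
    det3 u (a • u + b • v + c • w) w = b * det3 u v w ∧
    det3 u v (a • u + b • v + c • w) = c * det3 u v w := by
  refine ⟨?_, ?_, ?_⟩ <;>
    simp only [det3_coord, PiLp.add_apply, PiLp.smul_apply, smul_eq_mul] <;> ring

/-! ### Integrals over triangles -/

/-- The unit triangle of the plane. -/
def unitTri : Set (ℝ × ℝ) := {q : ℝ × ℝ | 0 ≤ q.1 ∧ 0 ≤ q.2 ∧ q.1 + q.2 ≤ 1}

/-- The affine parametrization of the triangle with vertices `a`, `b`, `c`. -/
noncomputable def triPt (a b c : E3) (q : ℝ × ℝ) : E3 := a + q.1 • (b - a) + q.2 • (c - a)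

/-- The integral over the triangle with vertices `a`, `b`, `c`, normalized by twice the area. -/
noncomputable def triInt (a b c : E3) (f : E3 → ℝ) : ℝ := ∫ q in unitTri, f (triPt a b c q)

lemma continuous_triPt (a b c : E3) : Continuous (triPt a b c) := by
  unfold triPt; fun_prop

lemma isCompact_unitTri : IsCompact unitTri := by
  have hc : IsClosed unitTri :=
    (isClosed_le continuous_const continuous_fst).inter
      ((isClosed_le continuous_const continuous_snd).inter
        (isClosed_le (continuous_fst.add continuous_snd) continuous_const))
  refine (isCompact_Icc (a := ((0 : ℝ), (0 : ℝ))) (b := (1, 1))).of_isClosed_subset hc ?_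
  rintro ⟨s, t⟩ ⟨h1, h2, h3⟩
  simp only at h1 h2 h3
  exact ⟨⟨h1, h2⟩, ⟨by simp; linarith, by simp; linarith⟩⟩

lemma integrableOn_unitTri {f : ℝ × ℝ → ℝ} (hf : Continuous f) : IntegrableOn f unitTri :=
  hf.continuousOn.integrableOn_compact isCompact_unitTri

lemma triInt_swap (a b c : E3) (f : E3 → ℝ) : triInt a c b f = triInt a b c f := by
  unfold triInt
  have h : MeasurePreserving (Prod.swap : ℝ × ℝ → ℝ × ℝ) volume volume :=
    Measure.measurePreserving_swap
  rw [← h.setIntegral_preimage_emb MeasurableEquiv.prodComm.measurableEmbedding]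
  have : Prod.swap ⁻¹' unitTri = unitTri := by
    ext ⟨s, t⟩
    simp only [unitTri, mem_preimage, mem_ofPred_eq, Prod.fst_swap, Prod.snd_swap]
    constructor <;> rintro ⟨h1, h2, h3⟩ <;> exact ⟨h2, h1, by linarith⟩
  rw [this]
  refine integral_congr_ae (Eventually.of_forall fun q => ?_)
  simp only [triPt, Prod.fst_swap, Prod.snd_swap]
  congr 1
  abel

lemma triInt_reflect (a b c : E3) (f : E3 → ℝ) : triInt b a c f = triInt a b c f := by
  unfold triInt
  -- the shear `(s, t) ↦ (1 - s - t, t)` preserves the measure and the unit triangle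
  have hp : MeasurePreserving (fun q : ℝ × ℝ => (q.1, 1 - q.2 - q.1)) volume volume := by
    refine MeasurePreserving.skew_product (g := fun x y => 1 - y - x)
      (MeasurePreserving.id volume) (by fun_prop) ?_
    refine Eventually.of_forall fun s => ?_
    have h1 := ((measurePreserving_add_left (volume : Measure ℝ) (1 - s)).comp
      (Measure.measurePreserving_neg (volume : Measure ℝ))).map_eq
    convert h1 using 2
    ext t; simp only [Function.comp_apply]; ring
  have hsw : MeasurePreserving (Prod.swap : ℝ × ℝ → ℝ × ℝ) volume volume :=
    Measure.measurePreserving_swap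
  have h : MeasurePreserving (fun q : ℝ × ℝ => (1 - q.1 - q.2, q.2)) volume volume :=
    hsw.comp (hp.comp hsw)
  have he : MeasurableEmbedding (fun q : ℝ × ℝ => (1 - q.1 - q.2, q.2)) := by
    refine Measurable.measurableEmbedding (by fun_prop) ?_
    rintro ⟨s, t⟩ ⟨s', t'⟩ h
    simp only [Prod.mk.injEq] at h ⊢
    constructor <;> linarith [h.1, h.2]
  rw [← h.setIntegral_preimage_emb he]
  have : (fun q : ℝ × ℝ => (1 - q.1 - q.2, q.2)) ⁻¹' unitTri = unitTri := by
    ext ⟨s, t⟩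
    simp only [unitTri, mem_preimage, mem_ofPred_eq]
    constructor <;> rintro ⟨h1, h2, h3⟩ <;> exact ⟨by linarith, h2, by linarith⟩
  rw [this]
  refine integral_congr_ae (Eventually.of_forall fun q => ?_)
  simp only [triPt]
  congr 1
  module

/-! ### The divergence theorem on a tetrahedron -/

/-- The affine map sending the standard tetrahedron to the one with the given vertices. -/
noncomputable def tetPt (a b c d : E3) (x : E3) : E3 :=
  a + (x 0 • (b - a) + x 1 • (c - a) + x 2 • (d - a))

/-- The standard tetrahedron. -/
def unitTet : Set E3 := {x | 0 ≤ x 0 ∧ 0 ≤ x 1 ∧ 0 ≤ x 2 ∧ x 0 + x 1 + x 2 ≤ 1}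

/-- The linear part of `tetPt`. -/
noncomputable def tetLin (u v w : E3) : E3 →L[ℝ] E3 :=
  LinearMap.toContinuousLinearMap
    { toFun := fun x => x 0 • u + x 1 • v + x 2 • w
      map_add' := fun x y => by simp only [PiLp.add_apply]; module
      map_smul' := fun r x => by simp only [PiLp.smul_apply, smul_eq_mul, RingHom.id_apply]; module }

lemma tetLin_apply (u v w x : E3) : tetLin u v w x = x 0 • u + x 1 • v + x 2 • w := rfl

lemma det_tetLin (u v w : E3) : (tetLin u v w).det = det3 u v w := by
  have : (tetLin u v w).det = LinearMap.det (tetLin u v w : E3 →ₗ[ℝ] E3) := rfl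
  rw [this, ← LinearMap.det_toMatrix (EuclideanSpace.basisFun (Fin 3) ℝ).toBasis,
    Matrix.det_fin_three, det3_coord]
  simp [LinearMap.toMatrix_apply, tetLin_apply]
  ring

lemma hasFDerivAt_tetPt (a b c d x : E3) :
    HasFDerivAt (tetPt a b c d) (tetLin (b - a) (c - a) (d - a)) x := by
  have : tetPt a b c d = fun x => a + tetLin (b - a) (c - a) (d - a) x := rfl
  rw [this]
  exact (ContinuousLinearMap.hasFDerivAt _).const_add a

lemma convex_comb_mem_tet (a b c d : E3) {s t r : ℝ} (hs : 0 ≤ s) (ht : 0 ≤ t) (hr : 0 ≤ r)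
    (h : s + t + r ≤ 1) :
    a + (s • (b - a) + t • (c - a) + r • (d - a)) ∈ convexHull ℝ ({a, b, c, d} : Set E3) := by
  have key := (convex_convexHull ℝ ({a, b, c, d} : Set E3)).sum_mem (t := Finset.univ)
    (w := ![1 - s - t - r, s, t, r]) (z := ![a, b, c, d])
    (by intro i _; fin_cases i <;> simp <;> linarith)
    (by simp [Fin.sum_univ_four]; ring)
    (by intro i _; apply subset_convexHull; fin_cases i <;> simp)
  convert key using 1
  simp [Fin.sum_univ_four]
  module

lemma image_tetPt_unitTet (a b c d : E3) :
    tetPt a b c d '' unitTet = convexHull ℝ ({a, b, c, d} : Set E3) := by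
  apply Subset.antisymm
  · rintro _ ⟨x, ⟨h0, h1, h2, h3⟩, rfl⟩
    exact convex_comb_mem_tet a b c d h0 h1 h2 h3
  · refine convexHull_min ?_ ?_
    · rintro y (rfl | rfl | rfl | rfl)
      · exact ⟨0, by simp [unitTet], by simp [tetPt]⟩
      · exact ⟨!₂[1, 0, 0], by simp [unitTet], by simp [tetPt]⟩
      · exact ⟨!₂[0, 1, 0], by simp [unitTet], by simp [tetPt]⟩
      · exact ⟨!₂[0, 0, 1], by simp [unitTet], by simp [tetPt]⟩
    · have hU : Convex ℝ unitTet := by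
        rintro x ⟨h0, h1, h2, h3⟩ y ⟨k0, k1, k2, k3⟩ α β hα hβ hαβ
        simp only [unitTet, mem_ofPred_eq, PiLp.add_apply, PiLp.smul_apply, smul_eq_mul]
        refine ⟨by positivity, by positivity, by positivity, ?_⟩
        calc _ = α * (x 0 + x 1 + x 2) + β * (y 0 + y 1 + y 2) := by ring
          _ ≤ α * 1 + β * 1 := by gcongr
          _ = 1 := by linarith
      have : tetPt a b c d '' unitTet
          = (fun y => a + y) '' (tetLin (b - a) (c - a) (d - a) '' unitTet) := by
        rw [image_image]; rfl
      rw [this]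
      exact (hU.linear_image (tetLin (b - a) (c - a) (d - a)).toLinearMap).translate a

lemma isClosed_unitTet : IsClosed unitTet := by
  have h (i : Fin 3) : Continuous fun x : E3 => x i := by fun_prop
  exact (isClosed_le continuous_const (h 0)).inter ((isClosed_le continuous_const (h 1)).inter
    ((isClosed_le continuous_const (h 2)).inter
      (isClosed_le (((h 0).add (h 1)).add (h 2)) continuous_const)))

lemma tetPt_injective {a b c d : E3} (h : det3 (b - a) (c - a) (d - a) ≠ 0) :
    Function.Injective (tetPt a b c d) := by
  intro x y hxy
  have h1 : x 0 • (b - a) + x 1 • (c - a) + x 2 • (d - a)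
      = y 0 • (b - a) + y 1 • (c - a) + y 2 • (d - a) := add_left_cancel hxy
  have hx := det3_add_smul (b - a) (c - a) (d - a) (x 0) (x 1) (x 2)
  have hy := det3_add_smul (b - a) (c - a) (d - a) (y 0) (y 1) (y 2)
  rw [h1] at hx
  refine ext3 (mul_right_cancel₀ h ?_) (mul_right_cancel₀ h ?_) (mul_right_cancel₀ h ?_)
  · rw [← hx.1, ← hy.1]
  · rw [← hx.2.1, ← hy.2.1]
  · rw [← hx.2.2, ← hy.2.2]

/-- Coordinates on `E3` as a measure-preserving map from a product. -/
lemma measurePreserving_coords :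
    ∃ e : (ℝ × ℝ) × ℝ ≃ᵐ E3, MeasurePreserving e volume volume ∧
      ∀ p, e p 0 = p.1.1 ∧ e p 1 = p.1.2 ∧ e p 2 = p.2 := by
  let e1 := (MeasurableEquiv.piFinSuccAbove (fun _ : Fin 3 => ℝ) 2)
  let e2 := (MeasurableEquiv.finTwoArrow (α := ℝ))
  let f : (ℝ × ℝ) × ℝ ≃ᵐ E3 :=
    ((MeasurableEquiv.prodComm.trans ((MeasurableEquiv.refl ℝ).prodCongr e2.symm)).trans
      e1.symm).trans (MeasurableEquiv.toLp 2 (Fin 3 → ℝ))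
  refine ⟨f, ?_, ?_⟩
  · have h1 : MeasurePreserving e1.symm volume volume :=
      (volume_preserving_piFinSuccAbove (fun _ : Fin 3 => ℝ) 2).symm
    have h2 : MeasurePreserving e2.symm volume volume := (volume_preserving_finTwoArrow ℝ).symm
    have h3 : MeasurePreserving (Prod.map (id : ℝ → ℝ) e2.symm) volume volume :=
      (MeasurePreserving.id volume).prod h2
    have h4 : MeasurePreserving (Prod.swap : (ℝ × ℝ) × ℝ → ℝ × (ℝ × ℝ)) volume volume :=
      Measure.measurePreserving_swap
    exact (PiLp.volume_preserving_toLp (Fin 3)).comp (h1.comp (h3.comp h4))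
  · rintro ⟨⟨s, t⟩, r⟩
    refine ⟨?_, ?_, ?_⟩ <;> simp [f, e1, e2, MeasurableEquiv.piFinSuccAbove, MeasurableEquiv.toLp,
      MeasurableEquiv.prodCongr, MeasurableEquiv.finTwoArrow, MeasurableEquiv.piFinTwo] <;> rfl

/-- The fundamental theorem of calculus along the edges of the standard tetrahedron that point in
the direction of the last coordinate. -/
lemma setIntegral_unitTet {g h : E3 → ℝ} (hg : Continuous g)
    (hh : ∀ x, HasDerivAt (fun r : ℝ => h (x + r • !₂[0, 0, 1])) (g x) 0) :
    ∫ x in unitTet, g x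
      = ∫ q in unitTri, (h !₂[q.1, q.2, 1 - q.1 - q.2] - h !₂[q.1, q.2, 0]) := by
  obtain ⟨e, he, hc⟩ := measurePreserving_coords
  have hec (q : ℝ × ℝ) (r : ℝ) : e (q, r) = !₂[q.1, q.2, r] :=
    ext3 (by simp [hc]) (by simp [hc]) (by simp [hc])
  have hcpt : IsCompact unitTet := by
    refine Metric.isCompact_of_isClosed_isBounded isClosed_unitTet ?_
    refine (Metric.isBounded_closedBall (x := (0 : E3)) (r := 2)).subset ?_
    rintro x ⟨h0, h1, h2, h3⟩
    rw [mem_closedBall_zero_iff, EuclideanSpace.norm_eq, Fin.sum_univ_three]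
    apply Real.sqrt_le_iff.2 ⟨by norm_num, ?_⟩
    simp only [Real.norm_eq_abs, sq_abs]
    nlinarith
  have hint : Integrable (unitTet.indicator g) :=
    (hg.continuousOn.integrableOn_compact hcpt).integrable_indicator isClosed_unitTet.measurableSet
  rw [← integral_indicator isClosed_unitTet.measurableSet,
    ← he.integral_comp e.measurableEmbedding]
  have hint' : Integrable (fun p => unitTet.indicator g (e p)) (volume.prod volume) :=
    (he.integrable_comp_emb e.measurableEmbedding).2 hint
  rw [← integral_indicator isCompact_unitTri.isClosed.measurableSet]
  refine (integral_prod _ hint').trans (integral_congr_ae (Eventually.of_forall fun q => ?_))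
  have hd (r : ℝ) : HasDerivAt (fun r : ℝ => h !₂[q.1, q.2, r]) (g !₂[q.1, q.2, r]) r := by
    have h1 : HasDerivAt (fun t : ℝ => h (!₂[q.1, q.2, r] + t • !₂[0, 0, 1]))
        (g !₂[q.1, q.2, r]) (r - r) := by
      rw [sub_self]; exact hh _
    refine (h1.comp_sub_const r r).congr_of_eventuallyEq (Eventually.of_forall fun r' => ?_)
    simp only
    congr 1
    apply ext3 <;> simp
  have hgc : Continuous fun r : ℝ => g !₂[q.1, q.2, r] := by
    refine hg.comp ((PiLp.continuous_toLp 2 (fun _ : Fin 3 => ℝ)).comp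
      (continuous_pi fun i => ?_))
    fin_cases i <;> simp <;> fun_prop
  by_cases hq : q ∈ unitTri
  · obtain ⟨h0, h1, h2⟩ := id hq
    have h3 : (0 : ℝ) ≤ 1 - q.1 - q.2 := by linarith
    simp only [indicator_of_mem hq]
    have : (fun r => unitTet.indicator g (e (q, r)))
        = (Icc 0 (1 - q.1 - q.2)).indicator fun r => g !₂[q.1, q.2, r] := by
      funext r
      have : e (q, r) ∈ unitTet ↔ r ∈ Icc 0 (1 - q.1 - q.2) := by
        simp only [unitTet, mem_ofPred_eq, hc, mem_Icc]
        constructor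
        · rintro ⟨_, _, k1, k2⟩; exact ⟨k1, by linarith⟩
        · rintro ⟨k1, k2⟩; exact ⟨h0, h1, k1, by linarith⟩
      by_cases hr : r ∈ Icc 0 (1 - q.1 - q.2)
      · rw [indicator_of_mem hr, indicator_of_mem (this.2 hr), hec]
      · rw [indicator_of_notMem hr, indicator_of_notMem (fun k => hr (this.1 k))]
    rw [this, integral_indicator measurableSet_Icc, integral_Icc_eq_integral_Ioc,
      ← intervalIntegral.integral_of_le h3,
      intervalIntegral.integral_eq_sub_of_hasDerivAt (fun r _ => hd r)
        (hgc.intervalIntegrable _ _)]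
  · simp only [indicator_of_notMem hq]
    rw [← integral_zero ℝ ℝ]
    congr 1
    funext r
    refine indicator_of_notMem (fun k => hq ?_) _
    obtain ⟨k0, k1, k2, k3⟩ := k
    rw [(hc _).1] at k0 k3
    rw [(hc _).2.1] at k1 k3
    exact ⟨k0, k1, by simp only at k0 k1 k3 ⊢; linarith⟩

lemma setIntegral_fderiv_edge {a b c d : E3} (hdet : det3 (b - a) (c - a) (d - a) ≠ 0)
    {f : E3 → ℝ} (hf : ContDiff ℝ 1 f) :
    ∫ x in convexHull ℝ ({a, b, c, d} : Set E3), fderiv ℝ f x (d - a)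
      = |det3 (b - a) (c - a) (d - a)| * (triInt d b c f - triInt a b c f) := by
  rw [← image_tetPt_unitTet, integral_image_eq_integral_abs_det_fderiv_smul volume
    isClosed_unitTet.measurableSet (fun x _ => (hasFDerivAt_tetPt a b c d x).hasFDerivWithinAt)
    (tetPt_injective hdet).injOn]
  simp only [det_tetLin, smul_eq_mul]
  rw [integral_const_mul]
  congr 1
  have hcont : Continuous (tetPt a b c d) := by unfold tetPt; fun_prop
  have hcd : Continuous fun x => fderiv ℝ f (tetPt a b c d x) (d - a) :=
    ((hf.continuous_fderiv (by norm_num)).comp hcont).clm_apply continuous_const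
  rw [setIntegral_unitTet (h := fun x => f (tetPt a b c d x)) hcd]
  · rw [triInt, triInt, ← integral_sub]
    · refine integral_congr_ae (Eventually.of_forall fun q => ?_)
      simp only
      congr 2
      · simp [tetPt, triPt]; module
      · simp [tetPt, triPt]; abel
    · exact integrableOn_unitTri (hf.continuous.comp (continuous_triPt _ _ _))
    · exact integrableOn_unitTri (hf.continuous.comp (continuous_triPt _ _ _))
  · intro x
    have h1 : HasDerivAt (fun r : ℝ => tetPt a b c d (x + r • !₂[0, 0, 1])) (d - a) 0 := by
      have : (fun r : ℝ => tetPt a b c d (x + r • !₂[0, 0, 1]))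
          = fun r : ℝ => r • (d - a) + tetPt a b c d x := by
        funext r
        simp [tetPt]
        module
      rw [this]
      simpa using ((hasDerivAt_id (0 : ℝ)).smul_const (d - a)).add_const (tetPt a b c d x)
    have h2 := (hf.differentiable (by norm_num) (tetPt a b c d x)).hasFDerivAt
    have h3 : tetPt a b c d x = tetPt a b c d (x + (0 : ℝ) • !₂[0, 0, 1]) := by simp
    rw [h3] at h2 ⊢
    exact h2.comp_hasDerivAt (0 : ℝ) h1

/-- The divergence theorem on a tetrahedron with labelled vertices, with the outward normals
expressed by determinants. -/
lemma setIntegral_fderiv_tet {a b c d : E3} (hdet : det3 (b - a) (c - a) (d - a) ≠ 0)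
    {f : E3 → ℝ} (hf : ContDiff ℝ 1 f) (v : E3) :
    det3 (b - a) (c - a) (d - a)
        * ∫ x in convexHull ℝ ({a, b, c, d} : Set E3), fderiv ℝ f x v
      = |det3 (b - a) (c - a) (d - a)| *
        ((det3 v (c - a) (d - a) + det3 (b - a) v (d - a) + det3 (b - a) (c - a) v)
            * triInt b c d f
          - det3 v (c - a) (d - a) * triInt a c d f
          - det3 (b - a) v (d - a) * triInt a b d f
          - det3 (b - a) (c - a) v * triInt a b c f) := by
  set K := convexHull ℝ ({a, b, c, d} : Set E3) with hK
  have hint (w : E3) : IntegrableOn (fun x => fderiv ℝ f x w) K := by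
    refine ContinuousOn.integrableOn_compact ?_ ?_
    · exact (Set.toFinite ({a, b, c, d} : Set E3)).isCompact_convexHull ℝ
    · exact ((hf.continuous_fderiv (by norm_num)).clm_apply continuous_const).continuousOn
  have e3 := setIntegral_fderiv_edge hdet hf
  have h2 : det3 (b - a) (d - a) (c - a) = -det3 (b - a) (c - a) (d - a) := by
    simp only [det3_coord]; ring
  have h1 : det3 (c - a) (d - a) (b - a) = det3 (b - a) (c - a) (d - a) := by
    simp only [det3_coord]; ring
  have e2 := setIntegral_fderiv_edge (a := a) (b := b) (c := d) (d := c)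
    (by rw [h2]; exact neg_ne_zero.2 hdet) hf
  have e1 := setIntegral_fderiv_edge (a := a) (b := c) (c := d) (d := b)
    (by rw [h1]; exact hdet) hf
  rw [show ({a, b, d, c} : Set E3) = {a, b, c, d} by grind, ← hK, h2, abs_neg] at e2
  rw [show ({a, c, d, b} : Set E3) = {a, b, c, d} by grind, ← hK, h1] at e1
  rw [← hK] at e3
  rw [triInt_reflect b d c, triInt_swap b c d] at e3
  rw [triInt_reflect b c d] at e2
  have hlin : det3 (b - a) (c - a) (d - a) * ∫ x in K, fderiv ℝ f x v
      = det3 v (c - a) (d - a) * (∫ x in K, fderiv ℝ f x (b - a))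
        + det3 (b - a) v (d - a) * (∫ x in K, fderiv ℝ f x (c - a))
        + det3 (b - a) (c - a) v * (∫ x in K, fderiv ℝ f x (d - a)) := by
    have h12 : IntegrableOn (fun x => det3 v (c - a) (d - a) * fderiv ℝ f x (b - a)
        + det3 (b - a) v (d - a) * fderiv ℝ f x (c - a)) K :=
      ((hint _).const_mul _).add ((hint _).const_mul _)
    rw [← integral_const_mul, ← integral_const_mul, ← integral_const_mul, ← integral_const_mul,
      ← integral_add ((hint _).const_mul _) ((hint _).const_mul _),
      ← integral_add h12 ((hint _).const_mul _)]
    refine integral_congr_ae (Eventually.of_forall fun x => ?_)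
    have := congrArg (fderiv ℝ f x) (det3_cramer (b - a) (c - a) (d - a) v)
    simpa using this
  rw [hlin, e1, e2, e3]
  ring

/-! ### Faces of a tetrahedron -/

lemma faceVertex_spec {F : Finset E3} (hF : F.card = 3) :
    F = {faceVertex F 0, faceVertex F 1, faceVertex F 2} ∧
      faceVertex F 0 ≠ faceVertex F 1 ∧ faceVertex F 0 ≠ faceVertex F 2 ∧
      faceVertex F 1 ≠ faceVertex F 2 := by
  have hl : F.toList.length = 3 := by simpa using hF
  have hn := F.nodup_toList
  unfold faceVertex
  obtain ⟨a, b, c, h⟩ := List.length_eq_three.1 hl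
  rw [h] at hn ⊢
  simp only [List.nodup_cons, List.mem_cons, List.not_mem_nil, or_false, not_or] at hn
  refine ⟨?_, hn.1.1, hn.1.2, hn.2.1⟩
  ext x
  rw [← Finset.mem_toList, h]
  simp

lemma faceVertex_mem {F : Finset E3} (hF : F.card = 3) :
    faceVertex F 0 ∈ F ∧ faceVertex F 1 ∈ F ∧ faceVertex F 2 ∈ F := by
  have h := (faceVertex_spec hF).1
  refine ⟨?_, ?_, ?_⟩ <;> (rw [Finset.ext_iff] at h; rw [h]; simp)

lemma faceIntegral_eq (F : Finset E3) (f : E3 → ℝ) :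
    faceIntegral F f
      = ‖faceCross F‖ * triInt (faceVertex F 0) (faceVertex F 1) (faceVertex F 2) f := rfl

/-- The flux through a face does not depend on the order of the vertices. -/
lemma face_flux {K F : Finset E3} {p q r o : E3} [DecidableEq E3] (hF : F = {p, q, r})
    (hcard : F.card = 3) (hKF : K \ F = {o}) (hdet : det3 (q - p) (r - p) (o - p) ≠ 0)
    (f : E3 → ℝ) (v : E3) :
    ⟪outNormal K F, v⟫ * faceIntegral F f
      = -((SignType.sign (det3 (q - p) (r - p) (o - p)) : SignType) : ℝ)
        * det3 (q - p) (r - p) v * triInt p q r f := by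
  have hout : outNormal K F
      = -((SignType.sign ⟪faceCross F, o - faceVertex F 0⟫ : SignType) : ℝ) •
        (‖faceCross F‖⁻¹ • faceCross F) := by
    have hS : ∀ i : DecidableEq E3, @SDiff.sdiff (Finset E3) (@Finset.instSDiff E3 i) K F = {o} := by
      intro i
      convert hKF
    unfold outNormal
    rw [hS, Finset.sum_singleton]
  rw [hout, faceIntegral_eq]
  obtain ⟨hs, n1, n2, n3⟩ := faceVertex_spec hcard
  set w0 := faceVertex F 0
  set w1 := faceVertex F 1
  set w2 := faceVertex F 2
  have hc : faceCross F = cross (w1 - w0) (w2 - w0) := rfl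
  -- every ordering of the vertices gives the same value
  have main : ((SignType.sign (det3 (w1 - w0) (w2 - w0) (o - w0)) : SignType) : ℝ)
        * det3 (w1 - w0) (w2 - w0) v * triInt w0 w1 w2 f
      = ((SignType.sign (det3 (q - p) (r - p) (o - p)) : SignType) : ℝ)
        * det3 (q - p) (r - p) v * triInt p q r f ∧ det3 (w1 - w0) (w2 - w0) (o - w0) ≠ 0 := by
    have swap (a b c : E3) : ∀ x, det3 (c - a) (b - a) x = -det3 (b - a) (c - a) x := by
      intro x; simp only [det3_coord]; ring
    have refl1 (a b c : E3) : ∀ x, det3 (a - b) (c - b) x = -det3 (b - a) (c - a) x := by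
      intro x; simp only [det3_coord, PiLp.sub_apply]; ring
    have refl2 (a b c : E3) : det3 (a - b) (c - b) (o - b) = -det3 (b - a) (c - a) (o - a) := by
      simp only [det3_coord, PiLp.sub_apply]; ring
    let Q : E3 → E3 → E3 → Prop := fun a b c =>
      ((SignType.sign (det3 (b - a) (c - a) (o - a)) : SignType) : ℝ)
        * det3 (b - a) (c - a) v * triInt a b c f
      = ((SignType.sign (det3 (q - p) (r - p) (o - p)) : SignType) : ℝ)
        * det3 (q - p) (r - p) v * triInt p q r f ∧ det3 (b - a) (c - a) (o - a) ≠ 0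
    have Qs (a b c : E3) (h : Q a b c) : Q a c b := by
      refine ⟨?_, by rw [swap a b c]; exact neg_ne_zero.2 h.2⟩
      rw [swap a b c (o - a), swap a b c v, triInt_swap, ← h.1, Left.sign_neg]
      simp
    have Qr (a b c : E3) (h : Q a b c) : Q b a c := by
      refine ⟨?_, by rw [refl2 a b c]; exact neg_ne_zero.2 h.2⟩
      rw [refl2 a b c, refl1 a b c v, triInt_reflect, ← h.1, Left.sign_neg]
      simp
    have Q0 : Q p q r := ⟨rfl, hdet⟩
    have m0 : w0 ∈ ({p, q, r} : Finset E3) := by rw [← hF]; exact (faceVertex_mem hcard).1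
    have m1 : w1 ∈ ({p, q, r} : Finset E3) := by rw [← hF]; exact (faceVertex_mem hcard).2.1
    have m2 : w2 ∈ ({p, q, r} : Finset E3) := by rw [← hF]; exact (faceVertex_mem hcard).2.2
    simp only [Finset.mem_insert, Finset.mem_singleton] at m0 m1 m2
    show Q w0 w1 w2
    clear_value w0 w1 w2
    rcases m0 with rfl | rfl | rfl <;> rcases m1 with rfl | rfl | rfl <;>
      rcases m2 with rfl | rfl | rfl <;>
      first
        | exact absurd rfl n1
        | exact absurd rfl n2
        | exact absurd rfl n3
        | exact Q0
        | exact Qs _ _ _ Q0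
        | exact Qr _ _ _ Q0
        | exact Qs _ _ _ (Qr _ _ _ Q0)
        | exact Qr _ _ _ (Qs _ _ _ Q0)
        | exact Qr _ _ _ (Qs _ _ _ (Qr _ _ _ Q0))
  have hN : ‖faceCross F‖ ≠ 0 := by
    rw [norm_ne_zero_iff]
    intro h0
    apply main.2
    rw [det3, ← hc, h0, inner_zero_left]
  rw [neg_mul, neg_mul, ← main.1]
  simp only [inner_smul_left, det3, ← hc]
  simp only [conj_trivial]
  field_simp

lemma sum_powersetCard_pred {K : Finset E3} [DecidableEq E3] {n : ℕ} (hK : K.card = n + 1)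
    (g : Finset E3 → ℝ) : ∑ F ∈ K.powersetCard n, g F = ∑ o ∈ K, g (K.erase o) := by
  symm
  refine Finset.sum_bij (fun o _ => K.erase o) ?_ ?_ ?_ (fun _ _ => rfl)
  · intro o ho
    rw [Finset.mem_powersetCard]
    exact ⟨Finset.erase_subset _ _, by rw [Finset.card_erase_of_mem ho, hK]; simp⟩
  · intro o ho o' ho' h
    by_contra hne
    have : o' ∈ K.erase o := Finset.mem_erase.2 ⟨fun k => hne k.symm, ho'⟩
    rw [h] at this
    exact Finset.notMem_erase _ _ this
  · intro F hF
    rw [Finset.mem_powersetCard] at hF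
    have h1 : (K \ F).card = 1 := by
      rw [Finset.card_sdiff_of_subset hF.1, hK, hF.2]; simp
    obtain ⟨o, ho⟩ := Finset.card_eq_one.1 h1
    have hoK : o ∈ K \ F := by rw [ho]; simp
    refine ⟨o, (Finset.mem_sdiff.1 hoK).1, ?_⟩
    rw [← Finset.sdiff_singleton_eq_erase, ← ho, Finset.sdiff_sdiff_eq_self hF.1]

/-- The edge vectors at a vertex of a nondegenerate tetrahedron have a nonzero determinant. -/
lemma det3_ne_zero [DecidableEq E3] {a b c d : E3} (h1 : a ≠ b) (h2 : a ≠ c) (h3 : a ≠ d)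
    (h4 : b ≠ c) (h5 : b ≠ d) (h6 : c ≠ d)
    (hind : AffineIndependent ℝ ((↑) : ({a, b, c, d} : Finset E3) → E3)) :
    det3 (b - a) (c - a) (d - a) ≠ 0 := by
  let f : Fin 4 → ({a, b, c, d} : Finset E3) :=
    ![⟨a, by simp⟩, ⟨b, by simp⟩, ⟨c, by simp⟩, ⟨d, by simp⟩]
  have hf : Function.Injective f := by
    intro i j hij
    fin_cases i <;> fin_cases j <;> simp_all [f]
  have hAI := hind.comp_embedding ⟨f, hf⟩
  have hLI := (affineIndependent_iff_linearIndependent_vsub ℝ _ (0 : Fin 4)).1 hAI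
  have hinj : Function.Injective (fun i : Fin 3 => (⟨i.succ, Fin.succ_ne_zero i⟩ : {x : Fin 4 // x ≠ 0})) := by
    intro i j hij
    simpa using hij
  have hLI3 := hLI.comp _ hinj
  have hdet0 : (Matrix.of fun i j : Fin 3 => (![b - a, c - a, d - a] i).ofLp j).det ≠ 0 := by
    intro h0
    obtain ⟨w, hw, hw0⟩ := Matrix.exists_vecMul_eq_zero_iff.2 h0
    apply hw
    rw [Fintype.linearIndependent_iff] at hLI3
    funext i
    refine hLI3 w ?_ i
    ext j
    have := congrFun hw0 j
    simp only [Matrix.vecMul, dotProduct, Fin.sum_univ_three] at this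
    simpa [Fin.sum_univ_three, f] using this
  intro h0
  apply hdet0
  rw [Matrix.det_fin_three]
  rw [det3_coord] at h0
  simp
  simp at h0
  linarith

lemma exists_vertices {K : Finset E3} [DecidableEq E3] (hK : K.card = 4)
    (hind : AffineIndependent ℝ ((↑) : K → E3)) :
    ∃ a b c d : E3, K = {a, b, c, d} ∧ det3 (b - a) (c - a) (d - a) ≠ 0 ∧
      a ≠ b ∧ a ≠ c ∧ a ≠ d ∧ b ≠ c ∧ b ≠ d ∧ c ≠ d := by
  obtain ⟨a, b, c, d, h1, h2, h3, h4, h5, h6, rfl⟩ := Finset.card_eq_four.1 hK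
  exact ⟨a, b, c, d, rfl, det3_ne_zero h1 h2 h3 h4 h5 h6 hind, h1, h2, h3, h4, h5, h6⟩

/-- The divergence theorem on a cell. -/
theorem setIntegral_fderiv_cell {K : Finset E3} (hK : K.card = 4)
    (hind : AffineIndependent ℝ ((↑) : K → E3)) {f : E3 → ℝ} (hf : ContDiff ℝ 1 f) (v : E3) :
    ∫ x in convexHull ℝ (K : Set E3), fderiv ℝ f x v
      = ∑ F ∈ K.powersetCard 3, ⟪outNormal K F, v⟫ * faceIntegral F f := by
  classical
  obtain ⟨a, b, c, d, rfl, hdet, hab, hac, had, hbc, hbd, hcd⟩ := exists_vertices hK hind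
  rw [sum_powersetCard_pred hK]
  have ha : ({a, b, c, d} : Finset E3).erase a = {b, c, d} := by grind
  have hb : ({a, b, c, d} : Finset E3).erase b = {a, c, d} := by grind
  have hc : ({a, b, c, d} : Finset E3).erase c = {a, b, d} := by grind
  have hd : ({a, b, c, d} : Finset E3).erase d = {a, b, c} := by grind
  have dd : ∀ o ∈ ({a, b, c, d} : Finset E3),
      ({a, b, c, d} : Finset E3) \ ({a, b, c, d} : Finset E3).erase o = {o} := by
    intro o ho; exact Finset.sdiff_erase_self ho
  rw [Finset.sum_insert (by simp [*]), Finset.sum_insert (by simp [*]),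
    Finset.sum_insert (by simp [*]), Finset.sum_singleton]
  have da : det3 (c - b) (d - b) (a - b) = -det3 (b - a) (c - a) (d - a) := by
    simp only [det3_coord, PiLp.sub_apply]; ring
  have db : det3 (c - a) (d - a) (b - a) = det3 (b - a) (c - a) (d - a) := by
    simp only [det3_coord, PiLp.sub_apply]; ring
  have dc : det3 (b - a) (d - a) (c - a) = -det3 (b - a) (c - a) (d - a) := by
    simp only [det3_coord, PiLp.sub_apply]; ring
  rw [face_flux (p := b) (q := c) (r := d) (o := a) ha (by rw [ha]; simp [*]) (dd a (by simp))
      (by rw [da]; exact neg_ne_zero.2 hdet),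
    face_flux (p := a) (q := c) (r := d) (o := b) hb (by rw [hb]; simp [*]) (dd b (by simp))
      (by rw [db]; exact hdet),
    face_flux (p := a) (q := b) (r := d) (o := c) hc (by rw [hc]; simp [*]) (dd c (by simp))
      (by rw [dc]; exact neg_ne_zero.2 hdet),
    face_flux (p := a) (q := b) (r := c) (o := d) hd (by rw [hd]; simp [*]) (dd d (by simp)) hdet,
    da, db, dc]
  refine mul_left_cancel₀ hdet ?_
  have hcoe : (({a, b, c, d} : Finset E3) : Set E3) = {a, b, c, d} := by simp
  rw [hcoe, setIntegral_fderiv_tet hdet hf v]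
  have v1 : det3 (c - b) (d - b) v = det3 v (c - a) (d - a) + det3 (b - a) v (d - a)
      + det3 (b - a) (c - a) v := by
    simp only [det3_coord, PiLp.sub_apply]; ring
  have v2 : det3 (c - a) (d - a) v = det3 v (c - a) (d - a) := by
    simp only [det3_coord, PiLp.sub_apply]; ring
  have v3 : det3 (b - a) (d - a) v = -det3 (b - a) v (d - a) := by
    simp only [det3_coord, PiLp.sub_apply]; ring
  rw [v1, v2, v3, Left.sign_neg]
  have hs : |det3 (b - a) (c - a) (d - a)| = ((SignType.sign (det3 (b - a) (c - a) (d - a))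
      : SignType) : ℝ) * det3 (b - a) (c - a) (d - a) := (sign_mul_self _).symm
  rw [hs]
  simp only [SignType.coe_neg]
  ring

/-! ### Curl calculus and Green's formula -/

lemma inner_cross_left (u n w : E3) : ⟪cross u n, w⟫ = -⟪n, cross u w⟫ := by
  simp only [inner_coord, cross_zero, cross_one, cross_two]; ring

lemma inner_cross_swap (u n w : E3) : ⟪cross u n, w⟫ = -⟪u, cross w n⟫ := by
  simp only [inner_coord, cross_zero, cross_one, cross_two]; ring

/-- The `j`-th vector of the standard basis. -/
noncomputable abbrev stdVec (j : Fin 3) : E3 := EuclideanSpace.single j 1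

/-- The `i`-th coordinate. -/
noncomputable abbrev coordL (i : Fin 3) : E3 →L[ℝ] ℝ := EuclideanSpace.proj i

lemma hasFDerivAt_comp_apply {φ : E3 → E3} {x : E3} (h : DifferentiableAt ℝ φ x) (i : Fin 3)
    (v : E3) : fderiv ℝ (fun y => φ y i) x v = (fderiv ℝ φ x v) i := by
  have h1 := (coordL i).hasFDerivAt
    (x := φ x) |>.comp x h.hasFDerivAt
  have h2 : (fun y => φ y i)
      = (coordL i) ∘ φ := rfl
  rw [h2, h1.fderiv]
  rfl

lemma partialD_eq {φ : E3 → E3} {x : E3} (h : DifferentiableAt ℝ φ x) (j i : Fin 3) :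
    partialD φ j i x = fderiv ℝ (fun y => φ y i) x (stdVec j) :=
  (hasFDerivAt_comp_apply h i _).symm

lemma contDiff_coord {n : WithTop ℕ∞} {φ : E3 → E3} (h : ContDiff ℝ n φ) (i : Fin 3) :
    ContDiff ℝ n fun y => φ y i :=
  (coordL i).contDiff.comp h

lemma contDiff_cross {n : WithTop ℕ∞} {p φ : E3 → E3} (hp : ContDiff ℝ n p)
    (hφ : ContDiff ℝ n φ) (i : Fin 3) : ContDiff ℝ n fun y => cross (p y) (φ y) i := by
  have h1 (i j : Fin 3) : ContDiff ℝ n fun y => p y i * φ y j :=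
    (contDiff_coord hp i).mul (contDiff_coord hφ j)
  fin_cases i
  · simpa [cross_zero] using (h1 1 2).sub (h1 2 1)
  · simpa [cross_one] using (h1 2 0).sub (h1 0 2)
  · simpa [cross_two] using (h1 0 1).sub (h1 1 0)

lemma continuous_partialD {φ : E3 → E3} (h : ContDiff ℝ 1 φ) (j i : Fin 3) :
    Continuous (partialD φ j i) := by
  unfold partialD
  have h1 : Continuous fun x => fderiv ℝ φ x (EuclideanSpace.single j 1) :=
    (h.continuous_fderiv (by norm_num)).clm_apply continuous_const
  fun_prop

lemma continuous_curlField {φ : E3 → E3} (h : ContDiff ℝ 1 φ) : Continuous (curlField φ) := by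
  unfold curlField
  refine (PiLp.continuous_toLp 2 (fun _ : Fin 3 => ℝ)).comp (continuous_pi fun i => ?_)
  have hc := continuous_partialD h
  fin_cases i <;> exact (hc _ _).sub (hc _ _)

/-- The divergence of a cross product. -/
lemma div_cross {p φ : E3 → E3} (hp : ContDiff ℝ 1 p) (hφ : ContDiff ℝ 1 φ) (x : E3) :
    ∑ j : Fin 3, fderiv ℝ (fun y => cross (p y) (φ y) j) x (stdVec j)
      = ⟪curlField p x, φ x⟫ - ⟪p x, curlField φ x⟫ := by
  have hd {f : E3 → E3} (hf : ContDiff ℝ 1 f) (i : Fin 3) :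
      DifferentiableAt ℝ (fun y => f y i) x :=
    (contDiff_coord hf i).differentiable (by norm_num) x
  have hm (i j : Fin 3) (v : E3) : fderiv ℝ (fun y => p y i * φ y j) x v
      = p x i * fderiv ℝ (fun y => φ y j) x v + φ x j * fderiv ℝ (fun y => p y i) x v := by
    rw [fderiv_fun_mul (hd hp i) (hd hφ j)]
    simp
  have hs (i j k l : Fin 3) (v : E3) :
      fderiv ℝ (fun y => p y i * φ y j - p y k * φ y l) x v
        = fderiv ℝ (fun y => p y i * φ y j) x v - fderiv ℝ (fun y => p y k * φ y l) x v := by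
    rw [fderiv_fun_sub ((hd hp i).fun_mul (hd hφ j)) ((hd hp k).fun_mul (hd hφ l))]
    rfl
  rw [Fin.sum_univ_three]
  simp only [cross_zero, cross_one, cross_two, hs, hm, inner_coord, curlField,
    partialD_eq (hp.differentiable (by norm_num) x), partialD_eq (hφ.differentiable (by norm_num) x)]
  simp
  ring

lemma integrableOn_unitTri_face {f : E3 → ℝ} (hf : Continuous f) (a b c : E3) :
    IntegrableOn (fun q => f (triPt a b c q)) unitTri :=
  integrableOn_unitTri (hf.comp (continuous_triPt a b c))

lemma faceIntegral_add (F : Finset E3) {f g : E3 → ℝ} (hf : Continuous f) (hg : Continuous g) :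
    faceIntegral F (fun x => f x + g x) = faceIntegral F f + faceIntegral F g := by
  simp only [faceIntegral_eq, triInt]
  rw [integral_add (integrableOn_unitTri_face hf _ _ _) (integrableOn_unitTri_face hg _ _ _)]
  ring

lemma faceIntegral_const_mul (F : Finset E3) (c : ℝ) (f : E3 → ℝ) :
    faceIntegral F (fun x => c * f x) = c * faceIntegral F f := by
  simp only [faceIntegral_eq, triInt]
  rw [integral_const_mul]
  ring

lemma faceIntegral_sum {ι : Type*} (F : Finset E3) (s : Finset ι) {f : ι → E3 → ℝ}
    (hf : ∀ i, Continuous (f i)) :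
    faceIntegral F (fun x => ∑ i ∈ s, f i x) = ∑ i ∈ s, faceIntegral F (f i) := by
  simp only [faceIntegral_eq, triInt]
  rw [integral_finsetSum _ (fun i _ => integrableOn_unitTri_face (hf i) _ _ _), Finset.mul_sum]

/-- Green's formula for the curl on a cell. -/
theorem green_cell {K : Finset E3} (hK : K.card = 4)
    (hind : AffineIndependent ℝ ((↑) : K → E3)) {p φ : E3 → E3} (hp : ContDiff ℝ 1 p)
    (hφ : ContDiff ℝ 1 φ) :
    ∫ x in convexHull ℝ (K : Set E3), (⟪curlField p x, φ x⟫ - ⟪p x, curlField φ x⟫)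
      = -∑ F ∈ K.powersetCard 3, faceIntegral F fun x => ⟪cross (p x) (outNormal K F), φ x⟫ := by
  have hc (j : Fin 3) := contDiff_cross hp hφ j
  simp_rw [← div_cross hp hφ]
  rw [integral_finsetSum]
  · simp_rw [setIntegral_fderiv_cell hK hind (hc _)]
    rw [Finset.sum_comm, ← Finset.sum_neg_distrib]
    refine Finset.sum_congr rfl fun F _ => ?_
    simp_rw [← faceIntegral_const_mul]
    have hcc (j : Fin 3) : Continuous fun x =>
        ⟪outNormal K F, stdVec j⟫ * cross (p x) (φ x) j := continuous_const.mul (hc j).continuous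
    rw [← faceIntegral_sum F Finset.univ hcc,
      ← neg_one_mul, ← faceIntegral_const_mul]
    congr 1
    funext x
    rw [inner_cross_left, Fin.sum_univ_three]
    simp [inner_coord]
  · intro j _
    refine ContinuousOn.integrableOn_compact (K.finite_toSet.isCompact_convexHull ℝ) ?_
    exact (((hc j).continuous_fderiv (by norm_num)).clm_apply continuous_const).continuousOn

lemma curlField_eq_zero_of_notMem {ψ : E3 → E3} {x : E3} (hx : x ∉ tsupport ψ) :
    curlField ψ x = 0 := by
  have h1 : fderiv ℝ ψ x = 0 := by
    by_contra hne
    exact hx (tsupport_fderiv_subset ℝ (subset_closure hne))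
  apply ext3 <;> simp [curlField, partialD, h1]

/-- Green's formula for the curl in the whole space. -/
lemma integral_inner_curlField {φ ψ : E3 → E3} (hφ : ContDiff ℝ 1 φ) (hψ : ContDiff ℝ 1 ψ)
    (hc : HasCompactSupport ψ) :
    ∫ x, ⟪φ x, curlField ψ x⟫ = ∫ x, ⟪curlField φ x, ψ x⟫ := by
  have hcs (j : Fin 3) : HasCompactSupport fun y => cross (φ y) (ψ y) j := by
    refine hc.mono' (Function.support_subset_iff'.2 ?_ |>.trans subset_closure)
    intro x hx
    have : ψ x = 0 := by simpa using hx
    simp [this, cross]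
  have h0 (j : Fin 3) : ∫ x, fderiv ℝ (fun y => cross (φ y) (ψ y) j) x (stdVec j) = 0 := by
    have hcd := contDiff_cross hφ hψ j
    have hi : Integrable fun x => fderiv ℝ (fun y => cross (φ y) (ψ y) j) x (stdVec j) :=
      ((hcd.continuous_fderiv (by norm_num)).clm_apply
        continuous_const).integrable_of_hasCompactSupport ((hcs j).fderiv_apply ℝ (stdVec j))
    have := integral_mul_fderiv_eq_neg_fderiv_mul_of_integrable (μ := (volume : Measure E3))
      (f := fun _ : E3 => (1 : ℝ))
      (g := fun y => cross (φ y) (ψ y) j) (v := stdVec j) (by simp)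
      (by simpa using hi)
      (by simpa using hcd.continuous.integrable_of_hasCompactSupport (hcs j))
      (fun x _ => by fun_prop) (fun x _ => hcd.differentiable (by norm_num) x)
    simpa using this
  have i1 : Integrable fun x => ⟪φ x, curlField ψ x⟫ := by
    refine (hφ.continuous.inner (continuous_curlField hψ)).integrable_of_hasCompactSupport ?_
    refine HasCompactSupport.intro hc fun x hx => ?_
    rw [curlField_eq_zero_of_notMem hx, inner_zero_right]
  have i2 : Integrable fun x => ⟪curlField φ x, ψ x⟫ := by
    refine ((continuous_curlField hφ).inner hψ.continuous).integrable_of_hasCompactSupport ?_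
    refine HasCompactSupport.intro hc fun x hx => ?_
    rw [image_eq_zero_of_notMem_tsupport hx, inner_zero_right]
  have hsum : ∫ x, (⟪curlField φ x, ψ x⟫ - ⟪φ x, curlField ψ x⟫) = 0 := by
    simp_rw [← div_cross hφ hψ]
    rw [integral_finsetSum]
    · exact Finset.sum_eq_zero fun j _ => h0 j
    · intro j _
      exact (((contDiff_cross hφ hψ j).continuous_fderiv (by norm_num)).clm_apply
        continuous_const).integrable_of_hasCompactSupport ((hcs j).fderiv_apply ℝ (stdVec j))
  rw [integral_sub i2 i1] at hsum
  linarith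

/-! ### Polynomial fields -/

lemma hasFDerivAt_eval (P : MvPolynomial (Fin 3) ℝ) (x : E3) :
    HasFDerivAt (fun y : E3 => MvPolynomial.eval y.ofLp P)
      (∑ j, MvPolynomial.eval x.ofLp (MvPolynomial.pderiv j P) •
        coordL j) x := by
  induction P using MvPolynomial.induction_on with
  | C a => simpa using hasFDerivAt_const a x
  | add p q hp hq =>
    simp only [map_add]
    refine (hp.fun_add hq).congr_fderiv ?_
    simp [Finset.sum_add_distrib, add_smul]
  | mul_X p n hp =>
    have hX : HasFDerivAt (fun y : E3 => y.ofLp n) (coordL n) x := (coordL n).hasFDerivAt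
    simp only [map_mul, MvPolynomial.eval_X]
    refine (hp.fun_mul hX).congr_fderiv ?_
    simp only [Derivation.leibniz, MvPolynomial.pderiv_X, smul_eq_mul, map_add, map_mul,
      MvPolynomial.eval_X, add_smul, Finset.sum_add_distrib, Finset.smul_sum, smul_smul]
    congr 1
    rw [Finset.sum_eq_single n]
    · simp
    · intro j _ hj
      simp [hj.symm]
    · simp

lemma contDiff_eval (P : MvPolynomial (Fin 3) ℝ) {n : WithTop ℕ∞} :
    ContDiff ℝ n fun y : E3 => MvPolynomial.eval y.ofLp P := by
  induction P using MvPolynomial.induction_on with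
  | C a => simpa using contDiff_const
  | add p q hp hq => simpa using hp.add hq
  | mul_X p n hp =>
    simp only [map_mul, MvPolynomial.eval_X]
    exact hp.mul (contDiff_coord contDiff_id n)

lemma contDiff_evalField (q : PolyField) {n : WithTop ℕ∞} : ContDiff ℝ n (evalField q) :=
  contDiff_euclidean.2 fun i => contDiff_eval (q i)

lemma partialD_evalField (q : PolyField) (j i : Fin 3) (x : E3) :
    partialD (evalField q) j i x = MvPolynomial.eval x.ofLp (MvPolynomial.pderiv j (q i)) := by
  rw [partialD_eq ((contDiff_evalField q (n := 1)).differentiable (by norm_num) x)]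
  have : (fun y => evalField q y i) = fun y : E3 => MvPolynomial.eval y.ofLp (q i) := rfl
  rw [this, (hasFDerivAt_eval (q i) x).fderiv]
  simp

lemma curlField_evalField (q : PolyField) (x : E3) :
    curlField (evalField q) x = evalField (curlPoly q) x := by
  apply ext3 <;> simp [curlField, partialD_evalField, evalField, curlPoly]

lemma evalField_add (p q : PolyField) (x : E3) :
    evalField (p + q) x = evalField p x + evalField q x := by
  ext i; simp [evalField]

lemma evalField_smul (c : ℝ) (p : PolyField) (x : E3) :
    evalField (c • p) x = c • evalField p x := by
  ext i; simp [evalField]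

/-- A polynomial field that vanishes on a nonempty open set is zero. -/
lemma eq_zero_of_evalField_eq_zero {q : PolyField} {U : Set E3} (hU : IsOpen U)
    (hne : U.Nonempty) (h : ∀ x ∈ U, evalField q x = 0) : q = 0 := by
  obtain ⟨x, hx⟩ := hne
  have hU' : IsOpen ((WithLp.toLp 2 : (Fin 3 → ℝ) → E3) ⁻¹' U) :=
    hU.preimage (PiLp.continuous_toLp 2 (fun _ : Fin 3 => ℝ))
  obtain ⟨δ, hδ, hball⟩ := Metric.isOpen_iff.1 hU' x.ofLp (by simpa using hx)
  funext i
  refine MvPolynomial.funext_set (fun i => Metric.ball (x.ofLp i) δ) (fun i => ?_) ?_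
  · rw [Real.ball_eq_Ioo]
    exact Ioo_infinite (by linarith)
  · intro y hy
    have hyb : y ∈ Metric.ball x.ofLp δ := by
      rw [ball_pi _ hδ]; exact hy
    have := h _ (hball hyb)
    have h2 := congrArg (fun v : E3 => v i) this
    simpa [evalField] using h2

/-! ### Topology of Lipschitz domains -/

lemma IsLipschitzDomain.interior_closure {D : Set E3} (hD : IsLipschitzDomain D) :
    interior (closure D) = D := by
  refine Subset.antisymm (fun x hx => ?_) (interior_maximal subset_closure hD.isOpen)
  by_contra hxD
  have hfr : x ∈ frontier D := by
    rw [hD.isOpen.frontier_eq]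
    exact ⟨interior_subset hx, hxD⟩
  obtain ⟨T, C, g, hg, U, hU, hUD⟩ := hD.lipschitz x hfr
  -- a point slightly below `x` is below the graph, hence has a neighbourhood outside of `D`
  let y : ℝ → E3 := fun t => x - t • T.symm (stdVec 2)
  have hy : Continuous y := by fun_prop
  have hTy (t : ℝ) : T (y t) = T x - t • stdVec 2 := by simp [y]
  have hnhds : interior U ∩ interior (closure D) ∈ 𝓝 (y 0) := by
    have : y 0 = x := by simp [y]
    rw [this]
    exact inter_mem (interior_mem_nhds.2 hU) (isOpen_interior.mem_nhds hx)
  have hev : ∀ᶠ t in 𝓝[>] (0 : ℝ), y t ∈ interior U ∩ interior (closure D) ∧ 0 < t :=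
    ((hy.continuousAt.eventually hnhds).filter_mono nhdsWithin_le_nhds).and
      self_mem_nhdsWithin
  obtain ⟨t, ⟨htU, htD⟩, ht⟩ := hev.exists
  have hgx : T x 2 ≤ g (T x 0, T x 1) := by
    by_contra hlt
    exact hxD ((hUD x (mem_of_mem_nhds hU)).2 (not_le.1 hlt))
  have hlt : T (y t) 2 < g (T (y t) 0, T (y t) 1) := by
    rw [hTy]
    simp only [PiLp.sub_apply, PiLp.smul_apply]
    simp
    linarith
  have hT (i : Fin 3) : Continuous fun z : E3 => T z i := by
    have := T.continuous
    fun_prop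
  have hopen : IsOpen {z : E3 | T z 2 < g (T z 0, T z 1)} :=
    isOpen_lt (hT 2) (hg.continuous.comp ((hT 0).prodMk (hT 1)))
  have hmem : {z : E3 | T z 2 < g (T z 0, T z 1)} ∩ interior U ∈ 𝓝 (y t) :=
    (hopen.inter isOpen_interior).mem_nhds ⟨hlt, htU⟩
  obtain ⟨z, ⟨hz1, hz2⟩, hzD⟩ := mem_closure_iff_nhds.1 (interior_subset htD) _ hmem
  exact absurd ((hUD z (interior_subset hz2)).1 hzD) (not_lt.2 (le_of_lt hz1))

lemma volume_graph_eq_zero {g : ℝ × ℝ → ℝ} (hg : Continuous g) :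
    volume {x : E3 | x 2 = g (x 0, x 1)} = 0 := by
  obtain ⟨e, he, hc⟩ := measurePreserving_coords
  have hm : MeasurableSet {x : E3 | x 2 = g (x 0, x 1)} := by
    refine (isClosed_eq (by fun_prop) ?_).measurableSet
    exact hg.comp (by fun_prop)
  rw [← he.measure_preimage hm.nullMeasurableSet]
  have : e ⁻¹' {x : E3 | x 2 = g (x 0, x 1)} = {p : (ℝ × ℝ) × ℝ | p.2 = g p.1} := by
    ext p
    simp only [mem_preimage, mem_ofPred_eq, (hc p).1, (hc p).2.1, (hc p).2.2]
  rw [this]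
  refine (Measure.measure_prod_null ?_).2 (Eventually.of_forall fun q => ?_)
  · exact (isClosed_eq continuous_snd (hg.comp continuous_fst)).measurableSet
  · have : Prod.mk q ⁻¹' {p : (ℝ × ℝ) × ℝ | p.2 = g p.1} = {g q} := by
      ext r; simp
    simp [this]

lemma IsLipschitzDomain.volume_frontier {D : Set E3} (hD : IsLipschitzDomain D) :
    volume (frontier D) = 0 := by
  refine measure_null_of_locally_null _ fun x hx => ?_
  obtain ⟨T, C, g, hg, U, hU, hUD⟩ := hD.lipschitz x hx
  refine ⟨frontier D ∩ interior U,
    inter_mem_nhdsWithin _ (interior_mem_nhds.2 hU),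
    measure_mono_null (t := T ⁻¹' {z : E3 | z 2 = g (z 0, z 1)}) ?_ ?_⟩
  · rintro y ⟨hy, hyU⟩
    rw [hD.isOpen.frontier_eq] at hy
    have h1 : T y 2 ≤ g (T y 0, T y 1) := by
      by_contra hlt
      exact hy.2 ((hUD y (interior_subset hyU)).2 (not_le.1 hlt))
    refine le_antisymm h1 ?_
    by_contra hlt
    rw [not_le] at hlt
    have hT (i : Fin 3) : Continuous fun z : E3 => T z i := by
      have := T.continuous
      fun_prop
    have hopen : IsOpen {z : E3 | T z 2 < g (T z 0, T z 1)} :=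
      isOpen_lt (hT 2) (hg.continuous.comp ((hT 0).prodMk (hT 1)))
    obtain ⟨z, ⟨hz1, hz2⟩, hzD⟩ := mem_closure_iff_nhds.1 hy.1 _
      ((hopen.inter isOpen_interior).mem_nhds ⟨hlt, hyU⟩)
    exact absurd ((hUD z (interior_subset hz2)).1 hzD) (not_lt.2 (le_of_lt hz1))
  · rw [T.measurePreserving.measure_preimage]
    · exact volume_graph_eq_zero hg.continuous
    · refine (isClosed_eq (by fun_prop) ?_).measurableSet.nullMeasurableSet
      exact hg.continuous.comp (by fun_prop)

/-! ### Barycentric coordinates and the position of the cells -/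

/-- Points in general position spanning at most a plane have a negligible convex hull. -/
lemma volume_convexHull_eq_zero {s : Finset E3} (hs : s.card ≤ 3) :
    volume (convexHull ℝ (s : Set E3)) = 0 := by
  classical
  rcases Nat.eq_zero_or_pos s.card with h0 | hpos
  · rw [Finset.card_eq_zero.1 h0]; simp
  refine measure_mono_null (convexHull_subset_affineSpan _)
    (Measure.addHaar_affineSubspace volume _ fun htop => ?_)
  have h1 := finrank_vectorSpan_image_finset_le ℝ (id : E3 → E3) s (n := s.card - 1) (by omega)
  rw [Finset.image_id] at h1
  rw [← direction_affineSpan, htop, AffineSubspace.direction_top, finrank_top] at h1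
  simp at h1
  omega

/-- Barycentric coordinates on a cell. -/
lemma exists_coords {K : Finset E3} (hK : K.card = 4)
    (hind : AffineIndependent ℝ ((↑) : K → E3)) :
    ∃ c : E3 → (E3 →ᵃ[ℝ] ℝ), (∀ w ∈ K, c w w = 1) ∧ (∀ w ∈ K, ∀ w' ∈ K, w ≠ w' → c w w' = 0) ∧
      (∀ x, x ∈ convexHull ℝ (K : Set E3) ↔ ∀ w ∈ K, 0 ≤ c w x) ∧
      (∀ x, x ∈ interior (convexHull ℝ (K : Set E3)) ↔ ∀ w ∈ K, 0 < c w x) ∧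
      (∀ x, ∑ w ∈ K, c w x = 1) ∧ (∀ x, ∑ w ∈ K, c w x • w = x) := by
  classical
  have htop : affineSpan ℝ (Set.range ((↑) : K → E3)) = ⊤ := by
    rw [hind.affineSpan_eq_top_iff_card_eq_finrank_add_one]
    simp [hK]
  let b : AffineBasis K ℝ E3 := ⟨(↑), hind, htop⟩
  have hb (w : K) : b w = w := rfl
  have hr : Set.range b = (K : Set E3) := by
    have : (b : K → E3) = (↑) := rfl
    rw [this]; simp
  let c : E3 → (E3 →ᵃ[ℝ] ℝ) := fun w => if h : w ∈ K then b.coord ⟨w, h⟩ else 0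
  have hc (w : E3) (h : w ∈ K) : c w = b.coord ⟨w, h⟩ := by simp [c, h]
  refine ⟨c, ?_, ?_, ?_, ?_, ?_, ?_⟩
  · intro w h
    rw [hc w h]
    exact b.coord_apply_eq ⟨w, h⟩
  · intro w h w' h' hne
    rw [hc w h]
    exact b.coord_apply_ne (i := ⟨w, h⟩) (j := ⟨w', h'⟩) (fun k => hne (congrArg Subtype.val k))
  · intro x
    rw [← hr, b.convexHull_eq_nonneg_coord]
    exact ⟨fun h w hw => by rw [hc w hw]; exact h _, fun h w => by
      have := h w.1 w.2; rwa [hc w.1 w.2] at this⟩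
  · intro x
    rw [← hr, b.interior_convexHull]
    exact ⟨fun h w hw => by rw [hc w hw]; exact h _, fun h w => by
      have := h w.1 w.2; rwa [hc w.1 w.2] at this⟩
  · intro x
    rw [← b.sum_coord_apply_eq_one x, ← Finset.sum_coe_sort K]
    exact Finset.sum_congr rfl fun w _ => by rw [hc w.1 w.2]
  · intro x
    conv_rhs => rw [← b.linear_combination_coord_eq_self x]
    rw [← Finset.sum_coe_sort K]
    exact Finset.sum_congr rfl fun w _ => by rw [hc w.1 w.2, hb]

lemma interior_cell_nonempty {K : Finset E3} (hK : K.card = 4)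
    (hind : AffineIndependent ℝ ((↑) : K → E3)) :
    (interior (convexHull ℝ (K : Set E3))).Nonempty := by
  rw [interior_convexHull_nonempty_iff_affineSpan_eq_top]
  have h := hind.affineSpan_eq_top_iff_card_eq_finrank_add_one
  rw [Subtype.range_coe_subtype] at h
  exact h.2 (by simp [hK])

/-- The open unit triangle. -/
def openTri : Set (ℝ × ℝ) := {q : ℝ × ℝ | 0 < q.1 ∧ 0 < q.2 ∧ q.1 + q.2 < 1}

/-- The affine parametrization of a face. -/
noncomputable def facePt (F : Finset E3) (q : ℝ × ℝ) : E3 :=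
  triPt (faceVertex F 0) (faceVertex F 1) (faceVertex F 2) q

lemma affine_triPt (c : E3 →ᵃ[ℝ] ℝ) (a b d : E3) (q : ℝ × ℝ) :
    c (triPt a b d q) = (1 - q.1 - q.2) * c a + q.1 * c b + q.2 * c d := by
  have h (v w : E3) : c.linear (v - w) = c v - c w := c.linearMap_vsub v w
  have : triPt a b d q = (q.1 • (b - a) + q.2 • (d - a)) +ᵥ a := by
    simp [triPt]; abel
  rw [this, c.map_vadd, map_add, map_smul, map_smul, h, h]
  simp
  ring

lemma facePt_mem_convexHull {F : Finset E3} (hF : F.card = 3) {q : ℝ × ℝ} (hq : q ∈ unitTri) :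
    facePt F q ∈ convexHull ℝ (F : Set E3) := by
  obtain ⟨h0, h1, h2⟩ := hq
  obtain ⟨m0, m1, m2⟩ := faceVertex_mem hF
  have key := (convex_convexHull ℝ (F : Set E3)).sum_mem (t := Finset.univ)
    (w := ![1 - q.1 - q.2, q.1, q.2]) (z := ![faceVertex F 0, faceVertex F 1, faceVertex F 2])
    (by intro i _; fin_cases i <;> simp <;> linarith)
    (by simp [Fin.sum_univ_three]; ring)
    (by intro i _; apply subset_convexHull; fin_cases i <;> simpa)
  convert key using 1
  simp [Fin.sum_univ_three, facePt, triPt]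
  module

lemma openTri_subset : openTri ⊆ unitTri := fun _ h => ⟨h.1.le, h.2.1.le, h.2.2.le⟩

lemma coord_facePt_pos {K F : Finset E3} {c : E3 → (E3 →ᵃ[ℝ] ℝ)}
    (c1 : ∀ w ∈ K, c w w = 1) (c0 : ∀ w ∈ K, ∀ w' ∈ K, w ≠ w' → c w w' = 0) (hFK : F ⊆ K)
    (hF : F.card = 3) {q : ℝ × ℝ} (hq : q ∈ openTri) {w : E3} (hw : w ∈ F) :
    0 < c w (facePt F q) := by
  obtain ⟨h0, h1, h2⟩ := hq
  obtain ⟨hs, n1, n2, n3⟩ := faceVertex_spec hF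
  obtain ⟨m0, m1, m2⟩ := faceVertex_mem hF
  rw [facePt, affine_triPt]
  have hmem : w = faceVertex F 0 ∨ w = faceVertex F 1 ∨ w = faceVertex F 2 := by
    rw [hs] at hw; simpa using hw
  rcases hmem with h | h | h <;> rw [h]
  · rw [c1 _ (hFK m0), c0 _ (hFK m0) _ (hFK m1) n1, c0 _ (hFK m0) _ (hFK m2) n2]; linarith
  · rw [c1 _ (hFK m1), c0 _ (hFK m1) _ (hFK m0) n1.symm, c0 _ (hFK m1) _ (hFK m2) n3]; linarith
  · rw [c1 _ (hFK m2), c0 _ (hFK m2) _ (hFK m0) n2.symm, c0 _ (hFK m2) _ (hFK m1) n3.symm]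
    linarith

lemma coord_eq_zero_of_mem_convexHull {K A : Finset E3} {c : E3 → (E3 →ᵃ[ℝ] ℝ)}
    (c0 : ∀ w ∈ K, ∀ w' ∈ K, w ≠ w' → c w w' = 0) (hA : A ⊆ K) {w : E3} (hwK : w ∈ K)
    (hw : w ∉ A) {x : E3} (hx : x ∈ convexHull ℝ (A : Set E3)) : c w x = 0 := by
  have hconv : Convex ℝ {x | c w x = 0} := (convex_singleton (0 : ℝ)).affine_preimage (c w)
  refine convexHull_min (t := {x | c w x = 0}) ?_ hconv hx
  intro y hy
  exact c0 w hwK y (hA hy) (fun h => hw (h ▸ hy))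

lemma inner_faceCross {F : Finset E3} (hF : F.card = 3) {w : E3} (hw : w ∈ F) :
    ⟪faceCross F, w - faceVertex F 0⟫ = 0 := by
  have hs := (faceVertex_spec hF).1
  have hmem : w = faceVertex F 0 ∨ w = faceVertex F 1 ∨ w = faceVertex F 2 := by
    rw [hs] at hw; simpa using hw
  rcases hmem with h | h | h <;> rw [h, faceCross] <;>
    simp only [inner_coord, cross_zero, cross_one, cross_two, PiLp.sub_apply] <;> ring

/-- Near an interior point of a face, a cell agrees with a half-space. -/
lemma cell_near_face {K F : Finset E3} (hK : K.card = 4)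
    (hind : AffineIndependent ℝ ((↑) : K → E3)) (hFK : F ⊆ K) (hF : F.card = 3) :
    ∃ o ∈ K, ⟪faceCross F, o - faceVertex F 0⟫ ≠ 0 ∧
      outNormal K F = -((SignType.sign ⟪faceCross F, o - faceVertex F 0⟫ : SignType) : ℝ) •
        (‖faceCross F‖⁻¹ • faceCross F) ∧
      ∀ q ∈ openTri, ∀ᶠ y in 𝓝 (facePt F q),
        0 ≤ ⟪faceCross F, y - faceVertex F 0⟫ * ⟪faceCross F, o - faceVertex F 0⟫ →
        y ∈ convexHull ℝ (K : Set E3) := by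
  classical
  have h1 : (K \ F).card = 1 := by
    rw [Finset.card_sdiff_of_subset hFK, hK, hF]
  obtain ⟨o, ho⟩ := Finset.card_eq_one.1 h1
  have hoKF : o ∈ K \ F := by rw [ho]; simp
  obtain ⟨hoK, hoF⟩ := Finset.mem_sdiff.1 hoKF
  obtain ⟨c, c1, c0, cm, -, csum, cv⟩ := exists_coords hK hind
  have hside (y : E3) : ⟪faceCross F, y - faceVertex F 0⟫
      = c o y * ⟪faceCross F, o - faceVertex F 0⟫ := by
    have hy : y - faceVertex F 0 = ∑ w ∈ K, c w y • (w - faceVertex F 0) := by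
      simp_rw [smul_sub]
      rw [Finset.sum_sub_distrib, cv, ← Finset.sum_smul, csum, one_smul]
    rw [hy, inner_sum, Finset.sum_eq_single o]
    · rw [inner_smul_right]
    · intro w hw hwo
      have : w ∈ F := by
        by_contra hwF
        have : w ∈ K \ F := Finset.mem_sdiff.2 ⟨hw, hwF⟩
        rw [ho] at this
        exact hwo (by simpa using this)
      rw [inner_smul_right, inner_faceCross hF this, mul_zero]
    · intro h; exact absurd hoK h
  have hne : ⟪faceCross F, o - faceVertex F 0⟫ ≠ 0 := by
    obtain ⟨hs, n1, n2, n3⟩ := faceVertex_spec hF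
    obtain ⟨m0, m1, m2⟩ := faceVertex_mem hF
    have hKeq : K = {faceVertex F 0, faceVertex F 1, faceVertex F 2, o} := by
      have : K = F ∪ {o} := by rw [← ho]; exact (Finset.union_sdiff_of_subset hFK).symm
      rw [this]; conv_lhs => rw [hs]
      ext; simp
    have no (w : E3) (hw : w ∈ F) : w ≠ o := fun h => hoF (h ▸ hw)
    rw [hKeq] at hind
    exact det3_ne_zero n1 n2 (no _ m0) n3 (no _ m1) (no _ m2) hind
  refine ⟨o, hoK, hne, ?_, ?_⟩
  · have hS : ∀ i : DecidableEq E3, @SDiff.sdiff (Finset E3) (@Finset.instSDiff E3 i) K F = {o} := by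
      intro i
      convert ho
    unfold outNormal
    rw [hS, Finset.sum_singleton]
  · intro q hq
    have hpos : ∀ᶠ y in 𝓝 (facePt F q), ∀ w ∈ F, 0 < c w y := by
      rw [Filter.eventually_all_finset]
      intro w hw
      have hcont : Continuous (c w) := (c w).continuous_of_finiteDimensional
      exact (hcont.tendsto _).eventually_const_lt (coord_facePt_pos c1 c0 hFK hF hq hw)
    filter_upwards [hpos] with y hy hsgn
    rw [cm]
    intro w hw
    by_cases hwF : w ∈ F
    · exact (hy w hwF).le
    · have : w ∈ K \ F := Finset.mem_sdiff.2 ⟨hw, hwF⟩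
      rw [ho, Finset.mem_singleton] at this
      rw [this]
      rw [hside y, mul_assoc] at hsgn
      have := mul_self_pos.2 hne
      exact nonneg_of_mul_nonneg_left hsgn this

namespace Mesh

variable {D : Set E3} (M : Mesh D)

lemma mem_faces {F : Finset E3} : F ∈ M.faces ↔ ∃ K ∈ M.cells, F ⊆ K ∧ F.card = 3 := by
  simp [faces, Finset.mem_powersetCard]

lemma card_of_mem_faces {F : Finset E3} (hF : F ∈ M.faces) : F.card = 3 := by
  obtain ⟨K, -, -, h⟩ := M.mem_faces.1 hF
  exact h

lemma mem_cellsOf {F : Finset E3} {K : {K // K ∈ M.cells}} : K ∈ M.cellsOf F ↔ F ⊆ K.1 := by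
  simp [cellsOf]

lemma convexHull_subset_closure {K : Finset E3} (hK : K ∈ M.cells) :
    convexHull ℝ (K : Set E3) ⊆ closure D := by
  rw [← M.covers]
  exact subset_biUnion_of_mem (u := fun K : Finset E3 => convexHull ℝ (K : Set E3)) hK

lemma interior_cell_subset (hD : IsLipschitzDomain D) {K : Finset E3} (hK : K ∈ M.cells) :
    interior (convexHull ℝ (K : Set E3)) ⊆ D := by
  conv_rhs => rw [← hD.interior_closure]
  exact interior_mono (M.convexHull_subset_closure hK)

lemma volume_cell_diff (hD : IsLipschitzDomain D) {K : Finset E3} (hK : K ∈ M.cells) :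
    volume (convexHull ℝ (K : Set E3) \ D) = 0 := by
  refine measure_mono_null ?_ hD.volume_frontier
  rw [hD.isOpen.frontier_eq]
  exact sdiff_subset_sdiff_left (M.convexHull_subset_closure hK)

lemma inter_cells {K K' : Finset E3} [DecidableEq E3] (hK : K ∈ M.cells) (hK' : K' ∈ M.cells) :
    convexHull ℝ (K : Set E3) ∩ convexHull ℝ (K' : Set E3)
      = convexHull ℝ ((K ∩ K' : Finset E3) : Set E3) := by
  rw [M.matching K hK K' hK', Finset.coe_inter]

lemma card_inter_le [DecidableEq E3] {K K' : Finset E3} (hK : K ∈ M.cells) (hK' : K' ∈ M.cells)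
    (hne : K ≠ K') : (K ∩ K').card ≤ 3 := by
  by_contra h
  have h4 := M.card_eq K hK
  have h4' := M.card_eq K' hK'
  have h1 : K ∩ K' = K := Finset.eq_of_subset_of_card_le Finset.inter_subset_left (by omega)
  have h2 : K ∩ K' = K' := Finset.eq_of_subset_of_card_le Finset.inter_subset_right (by omega)
  exact hne (h1.symm.trans h2)

lemma volume_inter_cells {K K' : Finset E3} (hK : K ∈ M.cells) (hK' : K' ∈ M.cells)
    (hne : K ≠ K') :
    volume (convexHull ℝ (K : Set E3) ∩ convexHull ℝ (K' : Set E3)) = 0 := by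
  classical
  rw [M.inter_cells hK hK']
  exact volume_convexHull_eq_zero (M.card_inter_le hK hK' hne)

/-- An interior point of a face belongs to no other face. -/
lemma face_eq_of_facePt_mem {F F' : Finset E3} (hF : F ∈ M.faces) (hF' : F' ∈ M.faces)
    {q : ℝ × ℝ} (hq : q ∈ openTri) (h : facePt F q ∈ convexHull ℝ (F' : Set E3)) : F' = F := by
  classical
  obtain ⟨K, hK, hFK, hc⟩ := M.mem_faces.1 hF
  obtain ⟨K', hK', hFK', hc'⟩ := M.mem_faces.1 hF'
  obtain ⟨c, c1, c0, -⟩ := exists_coords (M.card_eq K hK) (M.indep K hK)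
  obtain ⟨c', c1', c0', -⟩ := exists_coords (M.card_eq K' hK') (M.indep K' hK')
  have hx : facePt F q ∈ convexHull ℝ ((K ∩ K' : Finset E3) : Set E3) := by
    rw [← M.inter_cells hK hK']
    exact ⟨convexHull_mono (by exact_mod_cast hFK) (facePt_mem_convexHull hc (openTri_subset hq)),
      convexHull_mono (by exact_mod_cast hFK') h⟩
  have hFK2 : F ⊆ K' := by
    intro w hw
    by_contra hwK'
    have h1 := coord_facePt_pos c1 c0 hFK hc hq hw
    rw [coord_eq_zero_of_mem_convexHull c0 Finset.inter_subset_left (hFK hw)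
      (fun k => hwK' (Finset.mem_inter.1 k).2) hx] at h1
    exact lt_irrefl _ h1
  have hFF : F ⊆ F' := by
    intro w hw
    by_contra hwF'
    have h1 := coord_facePt_pos c1' c0' hFK2 hc hq hw
    rw [coord_eq_zero_of_mem_convexHull c0' hFK' (hFK2 hw) hwF' h] at h1
    exact lt_irrefl _ h1
  exact (Finset.eq_of_subset_of_card_le hFF (by rw [hc, hc'])).symm

/-- Two cells that share a face lie on opposite sides of it. In particular the two outward normals
are opposite and the interior points of the face are in the domain. -/
lemma opposite_cells (hD : IsLipschitzDomain D) {F : Finset E3} {K K' : Finset E3}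
    (hF : F.card = 3) (hK : K ∈ M.cells) (hK' : K' ∈ M.cells) (hne : K ≠ K') (hFK : F ⊆ K)
    (hFK' : F ⊆ K') :
    outNormal K' F = -outNormal K F ∧ ∀ q ∈ openTri, facePt F q ∈ D := by
  classical
  obtain ⟨o, ho, hs, hn, hnear⟩ := cell_near_face (M.card_eq K hK) (M.indep K hK) hFK hF
  obtain ⟨o', ho', hs', hn', hnear'⟩ := cell_near_face (M.card_eq K' hK') (M.indep K' hK') hFK' hF
  set N := faceCross F with hN
  set w0 := faceVertex F 0 with hw0
  set σ := ⟪N, o - w0⟫ with hσ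
  set σ' := ⟪N, o' - w0⟫ with hσ'
  have hface (y : E3) (hy : y ∈ convexHull ℝ (F : Set E3)) : ⟪N, y - w0⟫ = 0 := by
    have hconv : Convex ℝ {y : E3 | ⟪N, y - w0⟫ = 0} := by
      have : {y : E3 | ⟪N, y - w0⟫ = 0} = {y : E3 | innerSL ℝ N y = ⟪N, w0⟫} := by
        ext y
        simp only [mem_ofPred_eq, inner_sub_right, innerSL_apply_apply, sub_eq_zero]
      rw [this]
      exact convex_hyperplane (innerSL ℝ N).toLinearMap.isLinear _
    exact convexHull_min (t := {y : E3 | ⟪N, y - w0⟫ = 0})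
      (fun w hw => inner_faceCross hF hw) hconv hy
  have hinter : K ∩ K' = F := by
    refine (Finset.eq_of_subset_of_card_le (Finset.subset_inter hFK hFK') ?_).symm
    rw [hF]
    exact M.card_inter_le hK hK' hne
  -- if the apexes were on the same side, the cells would overlap near the face
  have hopp : σ * σ' < 0 := by
    by_contra hge
    have hpos : 0 < σ * σ' := lt_of_le_of_ne (not_lt.1 hge) (mul_ne_zero hs hs').symm
    have hq : ((1 / 3 : ℝ), (1 / 3 : ℝ)) ∈ openTri := by
      refine ⟨?_, ?_, ?_⟩ <;> norm_num
    set x := facePt F ((1 / 3 : ℝ), (1 / 3 : ℝ)) with hx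
    have hx0 : ⟪N, x - w0⟫ = 0 := hface x (facePt_mem_convexHull hF (openTri_subset hq))
    have hcont : Continuous fun t : ℝ => x + (t * σ) • N := by fun_prop
    have ht0 : Tendsto (fun t : ℝ => x + (t * σ) • N) (𝓝[>] 0) (𝓝 x) := by
      have := hcont.tendsto 0
      simp only [zero_mul, zero_smul, add_zero] at this
      exact this.mono_left nhdsWithin_le_nhds
    obtain ⟨t, ⟨h1, h2⟩, ht⟩ := (((ht0.eventually (hnear _ hq)).and
      (ht0.eventually (hnear' _ hq))).and self_mem_nhdsWithin).exists
    have ht : 0 < t := ht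
    have hval : ⟪N, x + (t * σ) • N - w0⟫ = t * σ * ⟪N, N⟫ := by
      rw [show x + (t * σ) • N - w0 = (x - w0) + (t * σ) • N by abel, inner_add_right, hx0,
        inner_smul_right, zero_add]
    have hNN : 0 < ⟪N, N⟫ := by
      refine lt_of_le_of_ne real_inner_self_nonneg (fun h0 => hs ?_)
      rw [hσ, inner_self_eq_zero.1 h0.symm, inner_zero_left]
    have m1 := h1 (by
      rw [hval]
      have : t * σ * ⟪N, N⟫ * σ = t * ⟪N, N⟫ * (σ * σ) := by ring
      rw [this]; exact mul_nonneg (mul_pos ht hNN).le (mul_self_nonneg _))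
    have m2 := h2 (by
      rw [hval]
      have : t * σ * ⟪N, N⟫ * σ' = t * ⟪N, N⟫ * (σ * σ') := by ring
      rw [this]; exact mul_nonneg (mul_pos ht hNN).le hpos.le)
    have m3 : x + (t * σ) • N ∈ convexHull ℝ (F : Set E3) := by
      rw [← hinter, ← M.inter_cells hK hK']; exact ⟨m1, m2⟩
    have h4 := hface _ m3
    rw [hval] at h4
    exact (mul_ne_zero (mul_ne_zero ht.ne' hs) hNN.ne') h4
  constructor
  · rw [hn, hn']
    have : (SignType.sign σ' : SignType) = -SignType.sign σ := by
      rcases lt_or_gt_of_ne hs with h | h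
      · have : 0 < σ' := by nlinarith
        rw [sign_neg h, sign_pos this]; rfl
      · have : σ' < 0 := by nlinarith
        rw [sign_pos h, sign_neg this]
    rw [this]
    simp
  · intro q hq
    rw [← hD.interior_closure, mem_interior_iff_mem_nhds]
    filter_upwards [hnear q hq, hnear' q hq] with y h1 h2
    rcases le_total 0 (⟪N, y - w0⟫ * σ) with h | h
    · exact M.convexHull_subset_closure hK (h1 h)
    · refine M.convexHull_subset_closure hK' (h2 ?_)
      by_contra hlt
      rw [not_le] at hlt
      have h3 : 0 ≤ (⟪N, y - w0⟫ * σ) * (⟪N, y - w0⟫ * σ') :=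
        mul_nonneg_of_nonpos_of_nonpos h hlt.le
      have h4 : (⟪N, y - w0⟫ * σ) * (⟪N, y - w0⟫ * σ')
        = ⟪N, y - w0⟫ * ⟪N, y - w0⟫ * (σ * σ') := by ring
      have h5 : ⟪N, y - w0⟫ ≠ 0 := by
        intro h0; rw [h0, zero_mul] at hlt; exact lt_irrefl _ hlt
      rw [h4] at h3
      exact absurd h3 (not_le.2 (mul_neg_of_pos_of_neg (mul_self_pos.2 h5) hopp))

end Mesh

/-! ### Green's formula on a mesh -/

lemma inner_toLp {D : Set E3} (u : L2 D) {φ : E3 → E3} (h : MemLp φ 2 (volume.restrict D)) :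
    ⟪u, h.toLp φ⟫ = ∫ x in D, ⟪u x, φ x⟫ := by
  rw [L2.inner_def]
  refine integral_congr_ae ?_
  filter_upwards [h.coeFn_toLp] with x hx
  rw [hx]

lemma integrable_inner_memLp {D : Set E3} (u : L2 D) {φ : E3 → E3}
    (h : MemLp φ 2 (volume.restrict D)) : IntegrableOn (fun x => ⟪u x, φ x⟫) D := by
  refine (L2.integrable_inner (𝕜 := ℝ) u (h.toLp φ)).congr ?_
  filter_upwards [h.coeFn_toLp] with x hx
  rw [hx]

/-- A square-integrable field that is orthogonal to the test fields of an open set vanishes there. -/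
lemma ae_eq_zero_of_forall_test {D O : Set E3} (hO : IsOpen O) (c : L2 D)
    (h : ∀ φ, IsTestField O φ → ∫ x in D, ⟪c x, φ x⟫ = 0) :
    ∀ᵐ x ∂(volume.restrict D), x ∈ O → c x = 0 := by
  have hloc : LocallyIntegrable c (volume.restrict D) :=
    (Lp.memLp c).locallyIntegrable (by norm_num)
  have hci (i : Fin 3) : ∀ᵐ x ∂(volume.restrict D), x ∈ O → c x i = 0 := by
    refine hO.ae_eq_zero_of_integral_contDiff_smul_eq_zero (f := fun x => c x i) ?_ ?_
    · have : LocallyIntegrable (fun x => coordL i (c x)) (volume.restrict D) := by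
        intro x
        obtain ⟨s, hs, hi⟩ := hloc x
        exact ⟨s, hs, (coordL i).integrable_comp hi⟩
      exact this.locallyIntegrableOn O
    · intro g hg hgc hgO
      have ht : IsTestField O (fun x => g x • stdVec i) := by
        refine ⟨hg.smul contDiff_const, hgc.smul_right, ?_⟩
        exact (tsupport_smul_subset_left g _).trans hgO
      have := h _ ht
      rw [← this]
      refine integral_congr_ae (Eventually.of_forall fun x => ?_)
      have hin : ⟪c x, stdVec i⟫ = c x i := by
        rw [inner_coord]; fin_cases i <;> simp
      simp only [inner_smul_right, hin, smul_eq_mul]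
  filter_upwards [hci 0, hci 1, hci 2] with x h0 h1 h2 hx
  exact ext3 (by simpa using h0 hx) (by simpa using h1 hx) (by simpa using h2 hx)

lemma IsTestField.mono {O D : Set E3} (h : O ⊆ D) {φ : E3 → E3} (hφ : IsTestField O φ) :
    IsTestField D φ := ⟨hφ.smooth, hφ.compact, hφ.support.trans h⟩

lemma IsTestField.contDiff_one {O : Set E3} {φ : E3 → E3} (hφ : IsTestField O φ) :
    ContDiff ℝ 1 φ := hφ.smooth.of_le (by exact_mod_cast le_top)

lemma faceIntegral_congr {F : Finset E3} {f g : E3 → ℝ}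
    (h : ∀ q ∈ unitTri, f (facePt F q) = g (facePt F q)) : faceIntegral F f = faceIntegral F g := by
  simp only [faceIntegral_eq, triInt]
  congr 1
  exact setIntegral_congr_fun isCompact_unitTri.isClosed.measurableSet h

lemma faceIntegral_zero (F : Finset E3) : faceIntegral F (fun _ => 0) = 0 := by
  simp [faceIntegral_eq, triInt]

namespace Mesh

variable {D : Set E3} (M : Mesh D)

/-- The closed tetrahedron of a cell. -/
abbrev cellSet (K : {K // K ∈ M.cells}) : Set E3 := convexHull ℝ (K.1 : Set E3)

lemma isCompact_cellSet (K : {K // K ∈ M.cells}) : IsCompact (M.cellSet K) :=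
  K.1.finite_toSet.isCompact_convexHull ℝ

lemma measurableSet_cellSet (K : {K // K ∈ M.cells}) : MeasurableSet (M.cellSet K) :=
  (M.isCompact_cellSet K).isClosed.measurableSet

lemma toL2_ae_eq (p : M.Broken) : M.toL2 p =ᵐ[volume.restrict D] M.toFun p :=
  (M.memLp_toFun p).coeFn_toLp

lemma toFun_ae_eq (p : M.Broken) (K : {K // K ∈ M.cells}) :
    M.toFun p =ᵐ[volume.restrict (M.cellSet K)] evalField (p K) := by
  have h : ∀ K' : {K // K ∈ M.cells}, K' ≠ K →
      ∀ᵐ x ∂(volume.restrict (M.cellSet K)), x ∉ M.cellSet K' := by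
    intro K' hne
    rw [ae_restrict_iff' (M.measurableSet_cellSet K)]
    have h0 : volume (M.cellSet K' ∩ M.cellSet K) = 0 :=
      M.volume_inter_cells K'.2 K.2 (fun h => hne (Subtype.ext h))
    filter_upwards [measure_eq_zero_iff_ae_notMem.1 h0] with x hx hxK hxK'
    exact hx ⟨hxK', hxK⟩
  have h2 : ∀ᵐ x ∂(volume.restrict (M.cellSet K)), ∀ K' : {K // K ∈ M.cells}, K' ≠ K →
      x ∉ M.cellSet K' := by
    rw [ae_all_iff]; intro K'
    by_cases hK' : K' = K
    · exact Eventually.of_forall fun _ k => absurd hK' k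
    · filter_upwards [h K' hK'] with x hx _ using hx
  filter_upwards [h2, ae_restrict_mem (M.measurableSet_cellSet K)] with x hx hxK
  rw [toFun, Finset.sum_eq_single K]
  · exact indicator_of_mem hxK _
  · intro K' _ hne
    exact indicator_of_notMem (hx K' hne) _
  · simp

lemma restrict_inter_eq (hD : IsLipschitzDomain D) (K : {K // K ∈ M.cells}) :
    volume.restrict (D ∩ M.cellSet K) = volume.restrict (M.cellSet K) := by
  refine Measure.restrict_congr_set ?_
  have h0 := M.volume_cell_diff hD K.2
  filter_upwards [measure_eq_zero_iff_ae_notMem.1 h0] with x hx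
  refine propext ⟨fun h => h.2, fun h => ⟨?_, h⟩⟩
  by_contra hxD
  exact hx ⟨h, hxD⟩

lemma subset_iUnion_cellSet : D ⊆ ⋃ K, M.cellSet K := by
  intro x hx
  have := M.covers.symm.subset (subset_closure hx)
  simp only [mem_iUnion] at this ⊢
  obtain ⟨K, hK, hx⟩ := this
  exact ⟨⟨K, hK⟩, hx⟩

lemma toL2_ae_eq_cell (p : M.Broken) (K : {K // K ∈ M.cells}) :
    M.toL2 p =ᵐ[volume.restrict (D ∩ M.cellSet K)] evalField (p K) := by
  have h1 : M.toL2 p =ᵐ[volume.restrict (D ∩ M.cellSet K)] M.toFun p :=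
    (M.toL2_ae_eq p).filter_mono (ae_mono (Measure.restrict_mono inter_subset_left le_rfl))
  exact h1.trans
    ((M.toFun_ae_eq p K).filter_mono (ae_mono (Measure.restrict_mono inter_subset_right le_rfl)))

lemma iUnion_inter_cellSet : (⋃ K, D ∩ M.cellSet K) = D := by
  rw [← inter_iUnion]
  exact inter_eq_left.2 M.subset_iUnion_cellSet

lemma integral_eq_sum_inter (hD : IsLipschitzDomain D) {G : E3 → ℝ} (hG : IntegrableOn G D) :
    ∫ x in D, G x = ∑ K, ∫ x in D ∩ M.cellSet K, G x := by
  have hdisj : Pairwise (Function.onFun (AEDisjoint volume) fun K => D ∩ M.cellSet K) := by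
    intro K K' hne
    refine measure_mono_null ?_
      (M.volume_inter_cells K.2 K'.2 (fun h => hne (Subtype.ext h)))
    exact fun x hx => ⟨hx.1.2, hx.2.2⟩
  have := integral_iUnion_ae
    (fun K => (hD.isOpen.measurableSet.inter (M.measurableSet_cellSet K)).nullMeasurableSet)
    hdisj (f := G) (μ := volume) (by rw [M.iUnion_inter_cellSet]; exact hG)
  rwa [M.iUnion_inter_cellSet, tsum_fintype] at this

/-- The integral of a function that is continuous in each cell. -/
lemma integral_eq_sum_cells (hD : IsLipschitzDomain D) {G : E3 → ℝ}
    {H : {K // K ∈ M.cells} → E3 → ℝ} (hH : ∀ K, Continuous (H K))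
    (hG : ∀ K, G =ᵐ[volume.restrict (D ∩ M.cellSet K)] H K) :
    ∫ x in D, G x = ∑ K, ∫ x in M.cellSet K, H K x := by
  have hint (K : {K // K ∈ M.cells}) : IntegrableOn (H K) (M.cellSet K) :=
    (hH K).continuousOn.integrableOn_compact (M.isCompact_cellSet K)
  have hGi (K : {K // K ∈ M.cells}) : IntegrableOn G (D ∩ M.cellSet K) :=
    ((hint K).mono_set inter_subset_right).congr (hG K).symm
  have hGD : IntegrableOn G D := by
    rw [← M.iUnion_inter_cellSet]; exact integrableOn_finite_iUnion.2 hGi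
  rw [M.integral_eq_sum_inter hD hGD]
  refine Finset.sum_congr rfl fun K _ => ?_
  rw [integral_congr_ae (hG K), M.restrict_inter_eq hD K]

lemma sum_cells_faces (T : {K // K ∈ M.cells} → Finset E3 → ℝ) :
    ∑ K, ∑ F ∈ K.1.powersetCard 3, T K F = ∑ F ∈ M.faces, ∑ K ∈ M.cellsOf F, T K F := by
  refine Finset.sum_comm' fun K F => ?_
  rw [mem_cellsOf, Finset.mem_powersetCard, mem_faces]
  constructor
  · rintro ⟨-, h1, h2⟩
    exact ⟨h1, K.1, K.2, h1, h2⟩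
  · rintro ⟨h1, K', -, -, h2⟩
    exact ⟨Finset.mem_univ _, h1, h2⟩

lemma continuous_cross {f g : E3 → E3} (hf : Continuous f) (hg : Continuous g) :
    Continuous fun x => cross (f x) (g x) := by
  have h : ∀ i j : Fin 3, Continuous fun x => f x i * g x j := fun i j => by fun_prop
  unfold cross
  refine (PiLp.continuous_toLp 2 (fun _ : Fin 3 => ℝ)).comp (continuous_pi fun i => ?_)
  fin_cases i <;> simp [crossProduct] <;> exact (h _ _).sub (h _ _)

lemma continuous_jump (p : M.Broken) (F : Finset E3) : Continuous (M.jump p F) := by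
  unfold jump
  exact continuous_finsetSum _ fun K _ => continuous_cross (continuous_evalField _) continuous_const

lemma continuous_avg (p : M.Broken) (F : Finset E3) : Continuous (M.avg p F) := by
  unfold avg
  have h : Continuous fun x => ∑ K ∈ M.cellsOf F, evalField (p K) x :=
    continuous_finsetSum _ fun K _ => continuous_evalField _
  exact Continuous.const_smul h ((M.cellsOf F).card : ℝ)⁻¹

/-- Green's formula for a broken polynomial and a field that is polynomial or smooth in each
cell. -/
lemma green_cells (p : M.Broken) {f : {K // K ∈ M.cells} → E3 → E3}
    (hf : ∀ K, ContDiff ℝ 1 (f K)) :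
    ∑ K, ∫ x in M.cellSet K, (⟪evalField (M.brokenCurl p K) x, f K x⟫
        - ⟪evalField (p K) x, curlField (f K) x⟫)
      = -∑ F ∈ M.faces, faceIntegral F fun x =>
          ∑ K ∈ M.cellsOf F, ⟪cross (evalField (p K) x) (outNormal K.1 F), f K x⟫ := by
  have h (K : {K // K ∈ M.cells}) := green_cell (M.card_eq K.1 K.2) (M.indep K.1 K.2)
    (contDiff_evalField (p K)) (hf K)
  simp only [curlField_evalField] at h
  simp only [brokenCurl]
  rw [Finset.sum_congr rfl fun K _ => h K, Finset.sum_neg_distrib,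
    M.sum_cells_faces (fun K F => faceIntegral F fun x =>
      ⟪cross (evalField (p K) x) (outNormal K.1 F), f K x⟫)]
  congr 1
  refine Finset.sum_congr rfl fun F _ => ?_
  rw [faceIntegral_sum]
  intro K
  exact (continuous_cross (continuous_evalField _) continuous_const).inner (hf K).continuous

lemma green_smooth (hD : IsLipschitzDomain D) (p : M.Broken) {φ : E3 → E3}
    (hφ : ContDiff ℝ 1 φ) :
    (∫ x in D, ⟪M.toL2 (M.brokenCurl p) x, φ x⟫) - ∫ x in D, ⟪M.toL2 p x, curlField φ x⟫
      = -∑ F ∈ M.faces, faceIntegral F fun x => ⟪M.jump p F x, φ x⟫ := by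
  have hc := continuous_curlField hφ
  have h1 := M.integral_eq_sum_cells hD (G := fun x => ⟪M.toL2 (M.brokenCurl p) x, φ x⟫)
    (H := fun K x => ⟪evalField (M.brokenCurl p K) x, φ x⟫)
    (fun K => (continuous_evalField _).inner hφ.continuous)
    (fun K => by filter_upwards [M.toL2_ae_eq_cell (M.brokenCurl p) K] with x hx; rw [hx])
  have h2 := M.integral_eq_sum_cells hD (G := fun x => ⟪M.toL2 p x, curlField φ x⟫)
    (H := fun K x => ⟪evalField (p K) x, curlField φ x⟫)
    (fun K => (continuous_evalField _).inner hc)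
    (fun K => by filter_upwards [M.toL2_ae_eq_cell p K] with x hx; rw [hx])
  rw [h1, h2, ← Finset.sum_sub_distrib]
  have := M.green_cells p (f := fun _ => φ) (fun _ => hφ)
  simp_rw [← sum_inner] at this
  rw [show (∑ F ∈ M.faces, faceIntegral F fun x => ⟪M.jump p F x, φ x⟫)
    = ∑ F ∈ M.faces, faceIntegral F fun x =>
      ⟪∑ K ∈ M.cellsOf F, cross (evalField (p K) x) (outNormal K.1 F), φ x⟫ from rfl, ← this]
  refine Finset.sum_congr rfl fun K _ => (integral_sub ?_ ?_).symm
  · exact ((continuous_evalField _).inner hφ.continuous).continuousOn.integrableOn_compact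
      (M.isCompact_cellSet K)
  · exact ((continuous_evalField _).inner hc).continuousOn.integrableOn_compact
      (M.isCompact_cellSet K)

lemma green_broken (hD : IsLipschitzDomain D) (p Φ : M.Broken) :
    ⟪M.toL2 (M.brokenCurl p), M.toL2 Φ⟫ - ⟪M.toL2 p, M.toL2 (M.brokenCurl Φ)⟫
      = -∑ F ∈ M.faces, faceIntegral F fun x => ∑ K ∈ M.cellsOf F,
          ⟪cross (evalField (p K) x) (outNormal K.1 F), evalField (Φ K) x⟫ := by
  have h (p Φ : M.Broken) := M.integral_eq_sum_cells hD (G := fun x => ⟪M.toL2 p x, M.toL2 Φ x⟫)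
    (H := fun K x => ⟪evalField (p K) x, evalField (Φ K) x⟫)
    (fun K => (continuous_evalField _).inner (continuous_evalField _))
    (fun K => by
      filter_upwards [M.toL2_ae_eq_cell p K, M.toL2_ae_eq_cell Φ K] with x hx hx'
      rw [hx, hx'])
  rw [L2.inner_def, L2.inner_def, h, h, ← Finset.sum_sub_distrib,
    ← M.green_cells p (f := fun K => evalField (Φ K)) (fun K => contDiff_evalField _)]
  refine Finset.sum_congr rfl fun K _ => ?_
  simp only [curlField_evalField]
  refine (integral_sub ?_ ?_).symm
  · exact ((continuous_evalField _).inner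
      (continuous_evalField _)).continuousOn.integrableOn_compact (M.isCompact_cellSet K)
  · exact ((continuous_evalField _).inner
      (continuous_evalField _)).continuousOn.integrableOn_compact (M.isCompact_cellSet K)

lemma toL2_injective (hD : IsLipschitzDomain D) : Function.Injective M.toL2 := by
  rw [← LinearMap.ker_eq_bot, LinearMap.ker_eq_bot']
  intro p hp
  funext K
  refine eq_zero_of_evalField_eq_zero (isOpen_interior)
    (interior_cell_nonempty (M.card_eq K.1 K.2) (M.indep K.1 K.2)) ?_
  have h1 : evalField (p K) =ᵐ[volume.restrict (M.cellSet K)] 0 := by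
    rw [← M.restrict_inter_eq hD K]
    refine (M.toL2_ae_eq_cell p K).symm.trans ?_
    rw [hp]
    exact (Lp.coeFn_zero E3 2 (volume.restrict D)).filter_mono
      (ae_mono (Measure.restrict_mono inter_subset_left le_rfl))
  have h2 : evalField (p K) =ᵐ[volume.restrict (interior (M.cellSet K))] fun _ => 0 :=
    h1.filter_mono (ae_mono (Measure.restrict_mono interior_subset le_rfl))
  exact Measure.eqOn_open_of_ae_eq h2 isOpen_interior (continuous_evalField _).continuousOn
    continuousOn_const

/-! ### Tangential continuity of conforming broken polynomials -/

lemma isClosed_faces (s : Finset (Finset E3)) :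
    IsClosed (⋃ F ∈ s, convexHull ℝ ((F : Finset E3) : Set E3)) :=
  s.finite_toSet.isClosed_biUnion fun F _ => (F.finite_toSet.isCompact_convexHull ℝ).isClosed

lemma faceCross_ne_zero {F : Finset E3} (hF : F ∈ M.faces) : faceCross F ≠ 0 := by
  obtain ⟨K, hK, hFK, hc⟩ := M.mem_faces.1 hF
  obtain ⟨o, -, hne, -⟩ := cell_near_face (M.card_eq K hK) (M.indep K hK) hFK hc
  intro h0
  rw [h0, inner_zero_left] at hne
  exact hne rfl

lemma isOpen_openTri : IsOpen openTri :=
  (isOpen_lt continuous_const continuous_fst).inter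
    ((isOpen_lt continuous_const continuous_snd).inter
      (isOpen_lt (continuous_fst.add continuous_snd) continuous_const))

/-- If the jumps of a broken polynomial vanish against all test fields of an open set, they vanish
pointwise there: near an interior point of a face there is no other face, so that a test field
concentrated there sees only one jump. -/
lemma jump_eq_zero_of_forall_test (p : M.Broken) {O : Set E3} (hO : IsOpen O)
    (h : ∀ φ, IsTestField O φ →
      ∑ F ∈ M.faces, faceIntegral F (fun x => ⟪M.jump p F x, φ x⟫) = 0)
    {F : Finset E3} (hF : F ∈ M.faces) {q : ℝ × ℝ} (hq : q ∈ openTri) (hqO : facePt F q ∈ O) :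
    M.jump p F (facePt F q) = 0 := by
  classical
  by_contra hne
  set j := M.jump p F (facePt F q) with hj
  have hcont : Continuous fun x => ⟪M.jump p F x, j⟫ := (M.continuous_jump p F).inner continuous_const
  have hs : {x | 0 < ⟪M.jump p F x, j⟫} ∩ O
      ∩ (⋃ F' ∈ M.faces.erase F, convexHull ℝ ((F' : Finset E3) : Set E3))ᶜ ∈ 𝓝 (facePt F q) := by
    refine IsOpen.mem_nhds (((isOpen_lt continuous_const hcont).inter hO).inter
      (isClosed_faces _).isOpen_compl) ⟨⟨?_, hqO⟩, ?_⟩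
    · exact real_inner_self_pos.2 hne
    · simp only [mem_compl_iff, mem_iUnion, not_exists]
      intro F' hF' hmem
      rw [Finset.mem_erase] at hF'
      exact hF'.1 (M.face_eq_of_facePt_mem hF hF'.2 hq hmem)
  obtain ⟨f, hfs, hfc, hfd, hfr, hf1⟩ := exists_contDiff_tsupport_subset (n := ⊤) hs
  have htest : IsTestField O (fun x => f x • j) :=
    ⟨hfd.smul contDiff_const, hfc.smul_right,
      (tsupport_smul_subset_left f _).trans (hfs.trans fun x hx => hx.1.2)⟩
  have hf0 (x : E3) : 0 ≤ f x := (hfr ⟨x, rfl⟩).1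
  have hsum := h _ htest
  rw [← Finset.add_sum_erase _ _ hF, Finset.sum_eq_zero, add_zero] at hsum
  · rw [faceIntegral_eq] at hsum
    have hN := norm_ne_zero_iff.2 (M.faceCross_ne_zero hF)
    have hint : triInt (faceVertex F 0) (faceVertex F 1) (faceVertex F 2)
      (fun x => ⟪M.jump p F x, f x • j⟫) = 0 := by simpa [hN] using hsum
    have hgc : Continuous fun q' : ℝ × ℝ =>
        ⟪M.jump p F (facePt F q'), f (facePt F q') • j⟫ := by
      have h1 : Continuous (facePt F) := continuous_triPt _ _ _
      exact ((M.continuous_jump p F).comp h1).inner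
        ((hfd.continuous.comp h1).smul continuous_const)
    have hpos : 0 < ∫ q' in unitTri, ⟪M.jump p F (facePt F q'), f (facePt F q') • j⟫ := by
      rw [setIntegral_pos_iff_support_of_nonneg_ae]
      · refine lt_of_lt_of_le (IsOpen.measure_pos volume
          (hgc.isOpen_support.inter isOpen_openTri) ⟨q, ?_, hq⟩)
          (measure_mono (inter_subset_inter_right _ openTri_subset))
        rw [Function.mem_support, hf1, one_smul]
        exact (real_inner_self_pos.2 hne).ne'
      · refine Eventually.of_forall fun q' => ?_
        simp only [Pi.zero_apply, inner_smul_right]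
        by_cases hx : facePt F q' ∈ tsupport f
        · exact mul_nonneg (hf0 _) (hfs hx).1.1.le
        · rw [image_eq_zero_of_notMem_tsupport hx, zero_mul]
      · exact integrableOn_unitTri hgc
    exact hpos.ne' hint
  · intro F' hF'
    rw [← faceIntegral_zero F']
    refine faceIntegral_congr fun q' hq' => ?_
    have : facePt F' q' ∉ tsupport f := by
      intro hx
      refine (hfs hx).2 (mem_iUnion₂.2 ⟨F', hF', ?_⟩)
      exact facePt_mem_convexHull (M.card_of_mem_faces (Finset.mem_of_mem_erase hF')) hq'
    rw [image_eq_zero_of_notMem_tsupport this, zero_smul, inner_zero_right]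

lemma unitTri_subset_closure : unitTri ⊆ closure openTri := by
  rintro ⟨s, t⟩ ⟨h0, h1, h2⟩
  simp only at h0 h1 h2
  have hc : Continuous fun r : ℝ => (((1 - r) * s + r / 3, (1 - r) * t + r / 3) : ℝ × ℝ) := by
    fun_prop
  have ht : Tendsto (fun r : ℝ => (((1 - r) * s + r / 3, (1 - r) * t + r / 3) : ℝ × ℝ))
      (𝓝[>] 0) (𝓝 (s, t)) := by
    have := hc.tendsto 0
    simp only [sub_zero, one_mul, zero_div, add_zero] at this
    exact this.mono_left nhdsWithin_le_nhds
  refine mem_closure_of_tendsto ht ?_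
  have h3 : Ioo (0 : ℝ) 1 ∈ 𝓝[>] (0 : ℝ) := Ioo_mem_nhdsGT (by norm_num)
  filter_upwards [h3] with r hr
  have hr1 : 0 < 1 - r := by linarith [hr.2]
  refine ⟨?_, ?_, ?_⟩
  · have := mul_nonneg hr1.le h0
    simp only; linarith [hr.1]
  · have := mul_nonneg hr1.le h1
    simp only; linarith [hr.1]
  · have : (1 - r) * (s + t) ≤ (1 - r) * 1 := by gcongr
    simp only; nlinarith [hr.1]

lemma eq_zero_on_unitTri {g : ℝ × ℝ → E3} (hg : Continuous g) (h : ∀ q ∈ openTri, g q = 0)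
    {q : ℝ × ℝ} (hq : q ∈ unitTri) : g q = 0 := by
  have hcl : IsClosed {q | g q = 0} := isClosed_eq hg continuous_const
  exact closure_minimal (t := {q | g q = 0}) h hcl (unitTri_subset_closure hq)

/-- The weak curl of a broken polynomial in `H(curl)` is its broken curl. -/
lemma weakCurl_eq_brokenCurl (hD : IsLipschitzDomain D) (p : M.Broken) {c : L2 D}
    (hc : HasWeakCurl (M.toL2 p) c) : c = M.toL2 (M.brokenCurl p) := by
  set O := D ∩ (⋃ F ∈ M.faces, convexHull ℝ ((F : Finset E3) : Set E3))ᶜ with hOdef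
  have hO : IsOpen O := hD.isOpen.inter (isClosed_faces _).isOpen_compl
  have hnull : ∀ᵐ x ∂(volume.restrict D), x ∈ O := by
    have h0 : volume (⋃ F ∈ M.faces, convexHull ℝ ((F : Finset E3) : Set E3)) = 0 := by
      refine (measure_biUnion_null_iff M.faces.countable_toSet).2 fun F hF => ?_
      exact volume_convexHull_eq_zero (M.card_of_mem_faces hF).le
    have h1 := measure_eq_zero_iff_ae_notMem.1 (Measure.absolutelyContinuous_of_le
      (Measure.restrict_le_self (μ := volume) (s := D)) h0)
    filter_upwards [h1, ae_restrict_mem hD.isOpen.measurableSet] with x hx hxD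
    exact ⟨hxD, hx⟩
  have hz := ae_eq_zero_of_forall_test hO (c - M.toL2 (M.brokenCurl p)) ?_
  · rw [← sub_eq_zero]
    refine Lp.ext ?_
    filter_upwards [hz, hnull, Lp.coeFn_zero E3 2 (volume.restrict D)] with x hx hxO h0
    rw [h0, hx hxO]; rfl
  · intro φ hφ
    have hφD := hφ.mono (inter_subset_left : O ⊆ D)
    have hg := M.green_smooth hD p hφ.contDiff_one
    rw [Finset.sum_eq_zero, neg_zero, hc φ hφD] at hg
    · have hi (u : L2 D) : IntegrableOn (fun x => ⟪u x, φ x⟫) D := by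
        have hmem : MemLp φ 2 (volume.restrict D) :=
          (hφ.contDiff_one.continuous.memLp_of_hasCompactSupport hφ.compact).restrict D
        exact integrable_inner_memLp u hmem
      rw [← neg_eq_zero, ← hg, ← integral_sub (hi _) (hi _), ← integral_neg]
      refine integral_congr_ae ?_
      filter_upwards [Lp.coeFn_sub c (M.toL2 (M.brokenCurl p))] with x hx
      rw [hx, Pi.sub_apply, inner_sub_left]
      ring
    · intro F hF
      rw [← faceIntegral_zero F]
      refine faceIntegral_congr fun q hq => ?_
      have : facePt F q ∉ tsupport φ := by
        intro hx
        refine (hφ.support hx).2 (mem_iUnion₂.2 ⟨F, hF, ?_⟩)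
        exact facePt_mem_convexHull (M.card_of_mem_faces hF) hq
      rw [image_eq_zero_of_notMem_tsupport this, inner_zero_right]

/-- The jumps of a broken polynomial in `H(curl)` vanish at the interior points of the faces that
are in the domain. -/
lemma jump_eq_zero_of_hasWeakCurl (hD : IsLipschitzDomain D) (p : M.Broken) {c : L2 D}
    (hc : HasWeakCurl (M.toL2 p) c) {F : Finset E3} (hF : F ∈ M.faces) {q : ℝ × ℝ}
    (hq : q ∈ openTri) (hqD : facePt F q ∈ D) : M.jump p F (facePt F q) = 0 := by
  refine M.jump_eq_zero_of_forall_test p hD.isOpen (fun φ hφ => ?_) hF hq hqD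
  have hg := M.green_smooth hD p hφ.contDiff_one
  rw [hc φ hφ, M.weakCurl_eq_brokenCurl hD p hc, sub_self] at hg
  linarith

/-- The jumps of a broken polynomial vanish on all faces, including the boundary faces, if Green's
formula for its weak curl holds without boundary term for all smooth fields. -/
lemma jump_eq_zero_of_conforming (hD : IsLipschitzDomain D) (p : M.Broken) {c : L2 D}
    (hc : ∀ φ, IsTestField univ φ →
      ∫ x in D, ⟪M.toL2 p x, curlField φ x⟫ = ∫ x in D, ⟪c x, φ x⟫)
    {F : Finset E3} (hF : F ∈ M.faces) {q : ℝ × ℝ} (hq : q ∈ unitTri) :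
    M.jump p F (facePt F q) = 0 := by
  have hw : HasWeakCurl (M.toL2 p) c := fun φ hφ => hc φ (hφ.mono (subset_univ _))
  refine eq_zero_on_unitTri (g := fun q => M.jump p F (facePt F q))
    ((M.continuous_jump p F).comp (continuous_triPt _ _ _)) (fun q hq => ?_) hq
  refine M.jump_eq_zero_of_forall_test p isOpen_univ (fun φ hφ => ?_) hF hq (mem_univ _)
  have hg := M.green_smooth hD p hφ.contDiff_one
  rw [hc φ hφ, M.weakCurl_eq_brokenCurl hD p hw, sub_self] at hg
  linarith

/-- Two cells sharing a face are the only ones, and the normals are opposite. -/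
lemma cellsOf_cases (hD : IsLipschitzDomain D) {F : Finset E3} (hF : F ∈ M.faces) :
    (∃ K, M.cellsOf F = {K}) ∨ ∃ K K', K ≠ K' ∧ M.cellsOf F = {K, K'} ∧
      outNormal K'.1 F = -outNormal K.1 F ∧ ∀ q ∈ openTri, facePt F q ∈ D := by
  classical
  have hcard := M.card_of_mem_faces hF
  obtain ⟨K, hK, hFK, -⟩ := M.mem_faces.1 hF
  have hKm : (⟨K, hK⟩ : {K // K ∈ M.cells}) ∈ M.cellsOf F := M.mem_cellsOf.2 hFK
  by_cases hex : ∃ K' ∈ M.cellsOf F, K' ≠ ⟨K, hK⟩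
  · right
    obtain ⟨K', hK', hne⟩ := hex
    have hne' : K ≠ K'.1 := fun h => hne (Subtype.ext h.symm)
    obtain ⟨hn, hfD⟩ := M.opposite_cells hD hcard hK K'.2 hne' hFK (M.mem_cellsOf.1 hK')
    refine ⟨⟨K, hK⟩, K', hne.symm, ?_, hn, hfD⟩
    ext K''
    rw [Finset.mem_insert, Finset.mem_singleton]
    constructor
    · intro hK''
      by_contra hcon
      rw [not_or] at hcon
      -- a third cell would have its normal opposite to two opposite unit normals
      obtain ⟨hn1, -⟩ := M.opposite_cells hD hcard hK K''.2
        (fun h => hcon.1 (Subtype.ext h.symm)) hFK (M.mem_cellsOf.1 hK'')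
      obtain ⟨hn2, -⟩ := M.opposite_cells hD hcard K'.2 K''.2
        (fun h => hcon.2 (Subtype.ext h.symm)) (M.mem_cellsOf.1 hK') (M.mem_cellsOf.1 hK'')
      rw [hn1, hn, neg_neg] at hn2
      have h0 : outNormal K F = 0 := by
        have h2 : (2 : ℝ) • outNormal K F = 0 := by
          rw [two_smul]; nth_rw 1 [← hn2]; exact neg_add_cancel _
        simpa using h2
      obtain ⟨o, -, hs, hno, -⟩ := cell_near_face (M.card_eq K hK) (M.indep K hK) hFK hcard
      rw [h0] at hno
      have hN := M.faceCross_ne_zero hF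
      have h1 : ((SignType.sign ⟪faceCross F, o - faceVertex F 0⟫ : SignType) : ℝ) ≠ 0 := by
        rcases lt_or_gt_of_ne hs with h | h
        · rw [sign_neg h]; simp
        · rw [sign_pos h]; simp
      exact smul_ne_zero (neg_ne_zero.2 h1)
        (smul_ne_zero (inv_ne_zero (norm_ne_zero_iff.2 hN)) hN) hno.symm
    · rintro (rfl | rfl)
      · exact hKm
      · exact hK'
  · left
    refine ⟨⟨K, hK⟩, ?_⟩
    push Not at hex
    exact Finset.eq_singleton_iff_unique_mem.2 ⟨hKm, hex⟩

/-- The discrete integration by parts formula: for a broken polynomial `Φ` in `H(curl)` the face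
terms of Green's formula are the products of jumps and averages. -/
theorem green_conforming (hD : IsLipschitzDomain D) (p Φ : M.Broken) {c : L2 D}
    (hc : HasWeakCurl (M.toL2 Φ) c) :
    ⟪M.toL2 (M.brokenCurl p), M.toL2 Φ⟫
        + ∑ F ∈ M.faces, faceIntegral F (fun x => ⟪M.jump p F x, M.avg Φ F x⟫)
      = ⟪M.toL2 p, c⟫ := by
  classical
  have hg := M.green_broken hD p Φ
  rw [M.weakCurl_eq_brokenCurl hD Φ hc]
  suffices h : ∑ F ∈ M.faces, faceIntegral F (fun x => ⟪M.jump p F x, M.avg Φ F x⟫)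
      = ∑ F ∈ M.faces, faceIntegral F fun x => ∑ K ∈ M.cellsOf F,
          ⟪cross (evalField (p K) x) (outNormal K.1 F), evalField (Φ K) x⟫ by
    rw [h]; linarith
  refine Finset.sum_congr rfl fun F hF => faceIntegral_congr fun q hq => ?_
  rcases M.cellsOf_cases hD hF with ⟨K, hK⟩ | ⟨K, K', hne, hKK, hn, hfD⟩
  · simp [jump, avg, hK]
  · have hj : M.jump Φ F (facePt F q) = 0 :=
      eq_zero_on_unitTri (g := fun q => M.jump Φ F (facePt F q))
        ((M.continuous_jump Φ F).comp (continuous_triPt _ _ _))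
        (fun q hq => M.jump_eq_zero_of_hasWeakCurl hD Φ hc hF hq (hfD q hq)) hq
    simp only [jump, avg, hKK, Finset.sum_pair hne, hn, Finset.card_pair hne] at hj ⊢
    set a := evalField (p K) (facePt F q)
    set a' := evalField (p K') (facePt F q)
    set b := evalField (Φ K) (facePt F q)
    set b' := evalField (Φ K') (facePt F q)
    set n := outNormal K.1 F
    -- the tangential parts of `b` and `b'` agree
    have key (u : E3) : ⟪cross u n, b⟫ + ⟪cross u (-n), b'⟫ = 0 := by
      rw [inner_cross_swap, inner_cross_swap, ← neg_add, ← inner_add_right, hj]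
      simp
    have hneg (u w : E3) : ⟪cross u (-n), w⟫ = -⟪cross u n, w⟫ := by
      simp only [inner_coord, cross_zero, cross_one, cross_two, PiLp.neg_apply]; ring
    have k1 := key a
    have k2 := key a'
    rw [hneg] at k1 k2
    rw [inner_smul_right, inner_add_left, inner_add_right, inner_add_right, hneg, hneg]
    push_cast
    linarith

end Mesh

/-! ### Coercive problems on closed subspaces -/

/-- The Lax-Milgram theorem on a closed subspace. -/
lemma exists_solution_of_coercive {H : Type*} [NormedAddCommGroup H] [InnerProductSpace ℝ H]
    [CompleteSpace H] (T : H →L[ℝ] H) {a : ℝ} (ha : 0 < a) (hT : ∀ u, a * ‖u‖ ^ 2 ≤ ⟪T u, u⟫)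
    (W : Submodule ℝ H) (hW : IsClosed (W : Set H)) (f : H) :
    ∃ p ∈ W, ∀ w ∈ W, ⟪T p, w⟫ = ⟪f, w⟫ := by
  have : CompleteSpace W := hW.completeSpace_coe
  let B : W →L[ℝ] W →L[ℝ] ℝ := ((innerSL ℝ (E := H)).comp T).bilinearComp W.subtypeL W.subtypeL
  have hB (p w : W) : B p w = ⟪T p, (w : H)⟫ := rfl
  have hco : IsCoercive B := ⟨a, ha, fun u => by
    rw [hB, mul_assoc, ← sq]; exact hT u⟩
  let g : W := W.orthogonalProjectionOnto f
  refine ⟨hco.continuousLinearEquivOfBilin.symm g, Subtype.mem _, fun w hw => ?_⟩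
  have h1 := hco.continuousLinearEquivOfBilin_apply
    (hco.continuousLinearEquivOfBilin.symm g) ⟨w, hw⟩
  rw [ContinuousLinearEquiv.apply_symm_apply, hB] at h1
  rw [← h1]
  exact W.inner_orthogonalProjectionOnto_eq_of_mem_right ⟨w, hw⟩ f

/-! ### Material coefficients as operators -/

lemma act_add (A : Matrix (Fin 3) (Fin 3) ℝ) (u v : E3) : act A (u + v) = act A u + act A v := by
  ext i; simp [act, Matrix.mulVec_add]

lemma act_smul (A : Matrix (Fin 3) (Fin 3) ℝ) (c : ℝ) (u : E3) : act A (c • u) = c • act A u := by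
  ext i; simp [act, Matrix.mulVec_smul]

lemma act_sub (A : Matrix (Fin 3) (Fin 3) ℝ) (u v : E3) : act A (u - v) = act A u - act A v := by
  ext i; simp [act, Matrix.mulVec_sub]

lemma inner_act_comm {A : Matrix (Fin 3) (Fin 3) ℝ} (hA : A.IsSymm) (u v : E3) :
    ⟪act A u, v⟫ = ⟪u, act A v⟫ := by
  have h (i j : Fin 3) : A i j = A j i := hA.apply j i
  simp only [inner_coord, act, Matrix.mulVec, dotProduct, Fin.sum_univ_three]
  rw [h 1 0, h 2 0, h 2 1]
  ring

/-- A symmetric positive matrix is bounded by its largest eigenvalue. -/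
lemma norm_act_le {A : Matrix (Fin 3) (Fin 3) ℝ} (hA : A.IsSymm) {b : ℝ} (hb : 0 < b)
    (h0 : ∀ ξ, 0 ≤ ⟪act A ξ, ξ⟫) (h1 : ∀ ξ, ⟪act A ξ, ξ⟫ ≤ b * ‖ξ‖ ^ 2) (ξ : E3) :
    ‖act A ξ‖ ≤ b * ‖ξ‖ := by
  -- evaluate the quadratic form at `b ξ - A ξ`
  have h := h0 (b • ξ - act A ξ)
  have e : ⟪act A (b • ξ - act A ξ), b • ξ - act A ξ⟫
      = b ^ 2 * ⟪act A ξ, ξ⟫ - 2 * b * ‖act A ξ‖ ^ 2 + ⟪act A (act A ξ), act A ξ⟫ := by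
    rw [act_sub, act_smul, inner_sub_left, inner_sub_right, inner_sub_right,
      inner_act_comm hA (act A ξ) (b • ξ), act_smul]
    simp only [inner_smul_left, inner_smul_right, real_inner_self_eq_norm_sq, conj_trivial]
    ring
  rw [e] at h
  have h2 := h1 ξ
  have h3 := h1 (act A ξ)
  have h4 : b * ‖act A ξ‖ ^ 2 ≤ b * (b * ‖ξ‖) ^ 2 := by
    nlinarith [mul_le_mul_of_nonneg_left h2 (sq_nonneg b)]
  exact (sq_le_sq₀ (norm_nonneg _) (by positivity)).1 (le_of_mul_le_mul_left h4 hb)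

section Material

variable {D : Set E3} {A : Coeff}

/-- The constants of a material coefficient, with the bound on the matrix norm. -/
lemma IsMaterial.exists_bounds (hA : IsMaterial D A) :
    ∃ a b : ℝ, 0 < a ∧ 0 < b ∧ ∀ᵐ x ∂(volume.restrict D), (A x).IsSymm ∧ ∀ ξ : E3,
      a * ‖ξ‖ ^ 2 ≤ ⟪act (A x) ξ, ξ⟫ ∧ ‖act (A x) ξ‖ ≤ b * ‖ξ‖ := by
  obtain ⟨a, b, ha, hab⟩ := hA.bounds
  refine ⟨a, max b 1, ha, by positivity, ?_⟩
  filter_upwards [hab, hA.symm] with x hx hs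
  refine ⟨hs, fun ξ => ⟨(hx ξ).1, norm_act_le hs (by positivity) (fun ζ => ?_) (fun ζ => ?_) ξ⟩⟩
  · exact le_trans (by positivity) (hx ζ).1
  · refine (hx ζ).2.trans ?_
    gcongr
    exact le_max_left _ _

lemma IsMaterial.memLp (hA : IsMaterial D A) (u : L2 D) :
    MemLp (fun x => act (A x) (u x)) 2 (volume.restrict D) := by
  obtain ⟨a, b, -, hb, h⟩ := hA.exists_bounds
  have hu : AEMeasurable u (volume.restrict D) := (Lp.aestronglyMeasurable u).aemeasurable
  have hui (i : Fin 3) : AEMeasurable (fun x => u x i) (volume.restrict D) :=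
    (coordL i).continuous.measurable.comp_aemeasurable hu
  have hm : AEStronglyMeasurable (fun x => act (A x) (u x)) (volume.restrict D) := by
    unfold act
    have hpi : AEMeasurable (fun x => (A x) *ᵥ (u x).ofLp) (volume.restrict D) := by
      refine aemeasurable_pi_lambda _ fun i => ?_
      simp only [Matrix.mulVec, dotProduct, Fin.sum_univ_three]
      have := hA.aemeasurable
      exact (((this i 0).mul (hui 0)).add ((this i 1).mul (hui 1))).add ((this i 2).mul (hui 2))
    exact ((PiLp.continuous_toLp 2 (fun _ : Fin 3 => ℝ)).measurable.comp_aemeasurable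
      hpi).aestronglyMeasurable
  refine (Lp.memLp u).of_le_mul (c := b) hm ?_
  filter_upwards [h] with x hx using (hx.2 _).2

lemma IsMaterial.mul_eq (hA : IsMaterial D A) (u : L2 D) : mul A u = (hA.memLp u).toLp _ := by
  rw [mul, dif_pos (hA.memLp u)]

lemma IsMaterial.coeFn_mul (hA : IsMaterial D A) (u : L2 D) :
    mul A u =ᵐ[volume.restrict D] fun x => act (A x) (u x) := by
  rw [hA.mul_eq]; exact MemLp.coeFn_toLp _

lemma IsMaterial.mul_add (hA : IsMaterial D A) (u v : L2 D) :
    mul A (u + v) = mul A u + mul A v := by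
  refine Lp.ext ?_
  filter_upwards [hA.coeFn_mul u, hA.coeFn_mul v, hA.coeFn_mul (u + v), Lp.coeFn_add u v,
    Lp.coeFn_add (mul A u) (mul A v)] with x h1 h2 h3 h4 h5
  rw [h3, h5, Pi.add_apply, h1, h2, h4, Pi.add_apply, act_add]

lemma IsMaterial.mul_smul (hA : IsMaterial D A) (c : ℝ) (u : L2 D) :
    mul A (c • u) = c • mul A u := by
  refine Lp.ext ?_
  filter_upwards [hA.coeFn_mul u, hA.coeFn_mul (c • u), Lp.coeFn_smul c u,
    Lp.coeFn_smul c (mul A u)] with x h1 h3 h4 h5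
  rw [h3, h5, Pi.smul_apply, h1, h4, Pi.smul_apply, act_smul]

/-- Multiplication by a material coefficient as a bounded operator. -/
noncomputable def IsMaterial.op (hA : IsMaterial D A) : L2 D →L[ℝ] L2 D :=
  LinearMap.mkContinuousOfExistsBound
    { toFun := mul A, map_add' := hA.mul_add, map_smul' := hA.mul_smul } (by
    obtain ⟨a, b, -, hb, h⟩ := hA.exists_bounds
    refine ⟨b, fun u => Lp.norm_le_mul_norm_of_ae_le_mul ?_⟩
    filter_upwards [h, hA.coeFn_mul u] with x hx hu
    simp only [LinearMap.coe_mk, AddHom.coe_mk]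
    rw [hu]
    exact (hx.2 _).2)

lemma IsMaterial.op_apply (hA : IsMaterial D A) (u : L2 D) : hA.op u = mul A u := rfl

lemma IsMaterial.wInner_eq (hA : IsMaterial D A) (u v : L2 D) : wInner A u v = ⟪hA.op u, v⟫ := by
  rw [hA.op_apply, L2.inner_def, wInner]
  refine integral_congr_ae ?_
  filter_upwards [hA.coeFn_mul u] with x hx
  rw [hx]

lemma IsMaterial.wInner_comm (hA : IsMaterial D A) (u v : L2 D) :
    wInner A u v = wInner A v u := by
  obtain ⟨a, b, -, -, h⟩ := hA.exists_bounds
  unfold wInner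
  refine integral_congr_ae ?_
  filter_upwards [h] with x hx
  rw [inner_act_comm hx.1, real_inner_comm]

lemma IsMaterial.exists_coercive (hA : IsMaterial D A) :
    ∃ a : ℝ, 0 < a ∧ ∀ u : L2 D, a * ‖u‖ ^ 2 ≤ wInner A u u := by
  obtain ⟨a, b, ha, hb, h⟩ := hA.exists_bounds
  refine ⟨a, ha, fun u => ?_⟩
  have h1 : ‖u‖ ^ 2 = ∫ x in D, ‖u x‖ ^ 2 := by
    rw [← real_inner_self_eq_norm_sq, L2.inner_def]
    simp_rw [real_inner_self_eq_norm_sq]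
  rw [h1, ← integral_const_mul, wInner]
  refine integral_mono_ae ?_ ?_ ?_
  · exact ((Lp.memLp u).integrable_norm_pow (by norm_num)).const_mul a
  · refine (L2.integrable_inner (𝕜 := ℝ) (hA.op u) u).congr ?_
    filter_upwards [hA.coeFn_mul u] with x hx
    rw [hA.op_apply, hx]
  · filter_upwards [h] with x hx using (hx.2 _).1

/-- The weighted product as a bilinear form. -/
noncomputable def IsMaterial.form (hA : IsMaterial D A) : LinearMap.BilinForm ℝ (L2 D) :=
  LinearMap.mk₂ ℝ (wInner A)
    (fun u v w => by simp only [hA.wInner_eq, map_add, inner_add_left])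
    (fun c u w => by simp only [hA.wInner_eq, map_smul, inner_smul_left, conj_trivial, smul_eq_mul])
    (fun u v w => by simp only [hA.wInner_eq, inner_add_right])
    (fun c u w => by simp only [hA.wInner_eq, inner_smul_right, smul_eq_mul])

lemma IsMaterial.form_apply (hA : IsMaterial D A) (u v : L2 D) : hA.form u v = wInner A u v := rfl

lemma IsMaterial.wInner_self_nonneg (hA : IsMaterial D A) (u : L2 D) : 0 ≤ wInner A u u := by
  obtain ⟨a, ha, h⟩ := hA.exists_coercive
  exact le_trans (by positivity) (h u)

lemma IsMaterial.wNorm_sq (hA : IsMaterial D A) (u : L2 D) : wNorm A u ^ 2 = wInner A u u :=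
  Real.sq_sqrt (hA.wInner_self_nonneg u)

lemma IsMaterial.eq_zero_of_wInner_self (hA : IsMaterial D A) {u : L2 D} (h : wInner A u u = 0) :
    u = 0 := by
  obtain ⟨a, ha, hc⟩ := hA.exists_coercive
  have h1 := hc u
  rw [h] at h1
  have h2 : ‖u‖ ^ 2 ≤ 0 := nonpos_of_mul_nonpos_right h1 ha
  simpa using h2

lemma wNorm_nonneg (u : L2 D) : 0 ≤ wNorm A u := Real.sqrt_nonneg _

/-- The Cauchy-Schwarz inequality for a weighted product. -/
lemma IsMaterial.abs_wInner_le (hA : IsMaterial D A) (u v : L2 D) :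
    |wInner A u v| ≤ wNorm A u * wNorm A v := by
  have h := LinearMap.BilinForm.apply_sq_le_of_symm hA.form hA.wInner_self_nonneg
    ⟨hA.wInner_comm⟩ u v
  rw [hA.form_apply, hA.form_apply, hA.form_apply, ← hA.wNorm_sq, ← hA.wNorm_sq, ← mul_pow] at h
  exact abs_le_of_sq_le_sq h (mul_nonneg (wNorm_nonneg _) (wNorm_nonneg _))

lemma IsMaterial.op_surjective (hA : IsMaterial D A) (f : L2 D) : ∃ u, hA.op u = f := by
  obtain ⟨a, ha, h⟩ := hA.exists_coercive
  obtain ⟨p, -, hp⟩ := exists_solution_of_coercive hA.op ha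
    (fun u => by rw [← hA.wInner_eq]; exact h u) ⊤ isClosed_univ f
  exact ⟨p, ext_inner_right ℝ fun w => hp w trivial⟩

/-- The duality between the norms weighted by `A` and by its inverse. -/
lemma IsMaterial.abs_inner_le (hA : IsMaterial D A) (f u : L2 D) :
    |⟪f, u⟫| ≤ wNorm (fun x => (A x)⁻¹) f * wNorm A u := by
  obtain ⟨g, rfl⟩ := hA.op_surjective f
  have h : wNorm (fun x => (A x)⁻¹) (hA.op g) = wNorm A g := by
    obtain ⟨a, b, ha, -, hab⟩ := hA.exists_bounds
    unfold wNorm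
    congr 1
    unfold wInner
    refine integral_congr_ae ?_
    filter_upwards [hA.coeFn_mul g, hab] with x hx hx2
    rw [hA.op_apply, hx]
    have hdet : IsUnit (A x).det := by
      rw [isUnit_iff_ne_zero]
      intro h0
      obtain ⟨v, hv, hv0⟩ := Matrix.exists_mulVec_eq_zero_iff.2 h0
      have h1 := (hx2.2 (WithLp.toLp 2 v)).1
      have h2 : act (A x) (WithLp.toLp 2 v) = 0 := by
        ext i; simp [act, hv0]
      rw [h2, inner_zero_left] at h1
      have h3 : ‖(WithLp.toLp 2 v : E3)‖ ^ 2 ≤ 0 := nonpos_of_mul_nonpos_right h1 ha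
      have h4 : (WithLp.toLp 2 v : E3) = 0 := by simpa using h3
      exact hv (by simpa using h4)
    have hinv : act (A x)⁻¹ (act (A x) (g x)) = g x := by
      ext i; simp [act, Matrix.mulVec_mulVec, Matrix.nonsing_inv_mul _ hdet]
    rw [hinv, real_inner_comm]
  rw [h, ← hA.wInner_eq]
  exact hA.abs_wInner_le g u

end Material

/-! ### The weak curl -/

section WeakCurl

variable {D : Set E3}

lemma IsTestField.memLp {O : Set E3} {φ : E3 → E3} (h : IsTestField O φ) :
    MemLp φ 2 (volume.restrict D) :=
  (h.contDiff_one.continuous.memLp_of_hasCompactSupport h.compact).restrict D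

lemma IsTestField.memLp_curl {O : Set E3} {φ : E3 → E3} (h : IsTestField O φ) :
    MemLp (curlField φ) 2 (volume.restrict D) := by
  refine ((continuous_curlField h.contDiff_one).memLp_of_hasCompactSupport ?_).restrict D
  exact HasCompactSupport.intro h.compact fun x hx => curlField_eq_zero_of_notMem hx

/-- The restriction of a smooth compactly supported field to the domain. -/
noncomputable def IsTestField.toL2 {O : Set E3} {φ : E3 → E3} (h : IsTestField O φ) (D : Set E3) :
    L2 D := (h.memLp (D := D)).toLp φ

/-- The restriction of the curl of a smooth compactly supported field to the domain. -/
noncomputable def IsTestField.curlL2 {O : Set E3} {φ : E3 → E3} (h : IsTestField O φ)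
    (D : Set E3) : L2 D := (h.memLp_curl (D := D)).toLp _

lemma hasWeakCurl_iff {v c : L2 D} : HasWeakCurl v c ↔
    ∀ φ, ∀ h : IsTestField D φ, ⟪v, h.curlL2 D⟫ = ⟪c, h.toL2 D⟫ := by
  refine forall_congr' fun φ => forall_congr' fun h => ?_
  rw [IsTestField.curlL2, IsTestField.toL2, inner_toLp, inner_toLp]

lemma HasWeakCurl.add {v c v' c' : L2 D} (h : HasWeakCurl v c) (h' : HasWeakCurl v' c') :
    HasWeakCurl (v + v') (c + c') := by
  rw [hasWeakCurl_iff] at *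
  intro φ hφ
  rw [inner_add_left, inner_add_left, h φ hφ, h' φ hφ]

lemma HasWeakCurl.smul {v c : L2 D} (r : ℝ) (h : HasWeakCurl v c) :
    HasWeakCurl (r • v) (r • c) := by
  rw [hasWeakCurl_iff] at *
  intro φ hφ
  rw [inner_smul_left, inner_smul_left, h φ hφ]

lemma HasWeakCurl.sub {v c v' c' : L2 D} (h : HasWeakCurl v c) (h' : HasWeakCurl v' c') :
    HasWeakCurl (v - v') (c - c') := by
  rw [hasWeakCurl_iff] at *
  intro φ hφ
  rw [inner_sub_left, inner_sub_left, h φ hφ, h' φ hφ]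

lemma hasWeakCurl_zero : HasWeakCurl (0 : L2 D) 0 := by
  rw [hasWeakCurl_iff]
  intro φ hφ
  simp

lemma eq_zero_of_hasWeakCurl_zero (hD : IsOpen D) {c : L2 D} (h : HasWeakCurl 0 c) : c = 0 := by
  have h1 := ae_eq_zero_of_forall_test hD c fun φ hφ => by
    have := hasWeakCurl_iff.1 h φ hφ
    rw [inner_zero_left, IsTestField.toL2, inner_toLp] at this
    exact this.symm
  refine Lp.ext ?_
  filter_upwards [h1, ae_restrict_mem hD.measurableSet,
    Lp.coeFn_zero E3 2 (volume.restrict D)] with x hx hxD h0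
  rw [h0, hx hxD]; rfl

lemma HasWeakCurl.unique (hD : IsOpen D) {v c c' : L2 D} (h : HasWeakCurl v c)
    (h' : HasWeakCurl v c') : c = c' := by
  have := h.sub h'
  rw [sub_self] at this
  exact sub_eq_zero.1 (eq_zero_of_hasWeakCurl_zero hD this)

lemma HasWeakCurl.curl_eq (hD : IsOpen D) {v c : L2 D} (h : HasWeakCurl v c) : curl v = c := by
  have hex : ∃ c, HasWeakCurl v c := ⟨c, h⟩
  rw [curl, dif_pos hex]
  exact hex.choose_spec.unique hD h

lemma hasWeakCurl_curl {v : L2 D} (h : v ∈ Hcurl D) : HasWeakCurl v (curl v) := by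
  have hex : ∃ c, HasWeakCurl v c := h
  rw [curl, dif_pos hex]
  exact hex.choose_spec

/-- The restriction of a smooth field has a weak curl. -/
lemma IsTestField.hasWeakCurl {O : Set E3} {φ : E3 → E3} (h : IsTestField O φ) :
    HasWeakCurl (h.toL2 D) (h.curlL2 D) := by
  intro ψ hψ
  have e1 : ∫ x in D, ⟪h.toL2 D x, curlField ψ x⟫ = ∫ x in D, ⟪φ x, curlField ψ x⟫ := by
    refine integral_congr_ae ?_
    filter_upwards [(h.memLp (D := D)).coeFn_toLp] with x hx
    rw [IsTestField.toL2, hx]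
  have e2 : ∫ x in D, ⟪h.curlL2 D x, ψ x⟫ = ∫ x in D, ⟪curlField φ x, ψ x⟫ := by
    refine integral_congr_ae ?_
    filter_upwards [(h.memLp_curl (D := D)).coeFn_toLp] with x hx
    rw [IsTestField.curlL2, hx]
  rw [e1, e2, setIntegral_eq_integral_of_forall_compl_eq_zero,
    setIntegral_eq_integral_of_forall_compl_eq_zero,
    integral_inner_curlField h.contDiff_one hψ.contDiff_one hψ.compact]
  · intro x hx
    rw [image_eq_zero_of_notMem_tsupport (fun k => hx (hψ.support k)), inner_zero_right]
  · intro x hx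
    rw [curlField_eq_zero_of_notMem (fun k => hx (hψ.support k)), inner_zero_right]

/-- The graph of the curl on `H₀(curl)`. -/
noncomputable def graph0 (D : Set E3) : Submodule ℝ (L2 D × L2 D) :=
  (Submodule.span ℝ (testGraph D)).topologicalClosure

lemma isClosed_graph0 : IsClosed (graph0 D : Set (L2 D × L2 D)) :=
  Submodule.isClosed_topologicalClosure _

lemma mem_H0curl_iff {v : L2 D} : v ∈ H0curl D ↔ ∃ c, (v, c) ∈ graph0 D := by
  rw [H0curl, Submodule.mem_map]
  constructor
  · rintro ⟨⟨a, c⟩, h, rfl⟩; exact ⟨c, h⟩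
  · rintro ⟨c, h⟩; exact ⟨(v, c), h, rfl⟩

lemma IsTestField.mem_graph0 {φ : E3 → E3} (h : IsTestField D φ) :
    (h.toL2 D, h.curlL2 D) ∈ graph0 D :=
  Submodule.le_topologicalClosure _ (Submodule.subset_span
    ⟨φ, h, (h.memLp (D := D)).coeFn_toLp, (h.memLp_curl (D := D)).coeFn_toLp⟩)

/-- Green's formula for a field of `H₀(curl)` and a field of `H(curl)`. -/
lemma inner_graph0 {v c w d : L2 D} (hvc : (v, c) ∈ graph0 D) (hw : HasWeakCurl w d) :
    ⟪v, d⟫ = ⟪c, w⟫ := by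
  let L : L2 D × L2 D →L[ℝ] ℝ :=
    (innerSL ℝ d).comp (ContinuousLinearMap.fst ℝ (L2 D) (L2 D))
      - (innerSL ℝ w).comp (ContinuousLinearMap.snd ℝ (L2 D) (L2 D))
  have hL (p : L2 D × L2 D) : L p = ⟪d, p.1⟫ - ⟪w, p.2⟫ := rfl
  have hle : graph0 D ≤ L.ker := by
    refine Submodule.topologicalClosure_minimal _ (Submodule.span_le.2 ?_) L.isClosed_ker
    rintro ⟨a, b⟩ ⟨φ, hφ, h1, h2⟩
    have e1 : a = hφ.toL2 D := Lp.ext (h1.trans (hφ.memLp (D := D)).coeFn_toLp.symm)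
    have e2 : b = hφ.curlL2 D := Lp.ext (h2.trans (hφ.memLp_curl (D := D)).coeFn_toLp.symm)
    rw [SetLike.mem_coe, LinearMap.mem_ker]
    change L (a, b) = 0
    rw [hL, e1, e2, hasWeakCurl_iff.1 hw φ hφ, sub_self]
  have h0 : L (v, c) = 0 := hle hvc
  rw [hL] at h0
  rw [real_inner_comm, sub_eq_zero.1 h0, real_inner_comm]

lemma hasWeakCurl_of_mem_graph0 {v c : L2 D} (h : (v, c) ∈ graph0 D) : HasWeakCurl v c :=
  hasWeakCurl_iff.2 fun _ hφ => inner_graph0 h hφ.hasWeakCurl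

lemma mem_Hcurl_of_mem_H0curl {v : L2 D} (h : v ∈ H0curl D) : v ∈ Hcurl D := by
  obtain ⟨c, hc⟩ := mem_H0curl_iff.1 h
  exact ⟨c, hasWeakCurl_of_mem_graph0 hc⟩

lemma mem_graph0_curl (hD : IsOpen D) {v : L2 D} (h : v ∈ H0curl D) : (v, curl v) ∈ graph0 D := by
  obtain ⟨c, hc⟩ := mem_H0curl_iff.1 h
  rwa [(hasWeakCurl_of_mem_graph0 hc).curl_eq hD]

lemma inner_curl_right (hD : IsOpen D) {v w : L2 D} (hv : v ∈ H0curl D) (hw : w ∈ Hcurl D) :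
    ⟪v, curl w⟫ = ⟪curl v, w⟫ :=
  inner_graph0 (mem_graph0_curl hD hv) (hasWeakCurl_curl hw)

lemma curl_add (hD : IsOpen D) {v w : L2 D} (hv : v ∈ Hcurl D) (hw : w ∈ Hcurl D) :
    curl (v + w) = curl v + curl w :=
  ((hasWeakCurl_curl hv).add (hasWeakCurl_curl hw)).curl_eq hD

lemma curl_sub (hD : IsOpen D) {v w : L2 D} (hv : v ∈ Hcurl D) (hw : w ∈ Hcurl D) :
    curl (v - w) = curl v - curl w :=
  ((hasWeakCurl_curl hv).sub (hasWeakCurl_curl hw)).curl_eq hD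

lemma curl_smul (hD : IsOpen D) (r : ℝ) {v : L2 D} (hv : v ∈ Hcurl D) :
    curl (r • v) = r • curl v :=
  ((hasWeakCurl_curl hv).smul r).curl_eq hD

lemma curl_zero (hD : IsOpen D) : curl (0 : L2 D) = 0 := hasWeakCurl_zero.curl_eq hD

/-! ### The projection on the curl-free fields -/

/-- The curl-free fields of `H₀(curl)` as a linear space. -/
noncomputable def kernel0 (D : Set E3) : Submodule ℝ (L2 D) :=
  (graph0 D).comap (LinearMap.inl ℝ (L2 D) (L2 D))

lemma mem_kernel0_iff (hD : IsOpen D) {v : L2 D} : v ∈ kernel0 D ↔ v ∈ H0curl0 D := by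
  constructor
  · intro h
    have h' : (v, (0 : L2 D)) ∈ graph0 D := h
    exact ⟨mem_H0curl_iff.2 ⟨0, h'⟩, hasWeakCurl_of_mem_graph0 h'⟩
  · rintro ⟨h1, h2⟩
    have := mem_graph0_curl hD h1
    rw [h2.curl_eq hD] at this
    exact this

lemma isClosed_kernel0 : IsClosed (kernel0 D : Set (L2 D)) := by
  have : Continuous fun v : L2 D => (v, (0 : L2 D)) := by fun_prop
  exact isClosed_graph0.preimage this

variable {ε : Coeff}

lemma IsProj0.unique (hD : IsOpen D) (hε : IsMaterial D ε) {v p p' : L2 D} (h : IsProj0 ε v p)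
    (h' : IsProj0 ε v p') : p = p' := by
  have hmem : p - p' ∈ H0curl0 D := (mem_kernel0_iff hD).1
    (Submodule.sub_mem _ ((mem_kernel0_iff hD).2 h.1) ((mem_kernel0_iff hD).2 h'.1))
  have h1 := h.2 _ hmem
  have h2 := h'.2 _ hmem
  rw [← hε.form_apply] at h1 h2
  refine sub_eq_zero.1 (hε.eq_zero_of_wInner_self ?_)
  rw [← hε.form_apply]
  have : p - p' = (v - p') - (v - p) := by abel
  have h3 : hε.form ((v - p') - (v - p)) (p - p') = 0 := by
    rw [LinearMap.map_sub₂, h1, h2, sub_zero]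
  rwa [← this] at h3

lemma isProj0_proj0 (hD : IsOpen D) (hε : IsMaterial D ε) (v : L2 D) :
    IsProj0 ε v (proj0 ε v) := by
  have hex : ∃ p, IsProj0 ε v p := by
    obtain ⟨a, ha, h⟩ := hε.exists_coercive
    obtain ⟨p, hp, hpw⟩ := exists_solution_of_coercive hε.op ha
      (fun u => by rw [← hε.wInner_eq]; exact h u) (kernel0 D) isClosed_kernel0 (hε.op v)
    refine ⟨p, (mem_kernel0_iff hD).1 hp, fun w hw => ?_⟩
    rw [hε.wInner_eq, map_sub, inner_sub_left, hpw w ((mem_kernel0_iff hD).2 hw), sub_self]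
  rw [proj0, dif_pos hex]
  exact hex.choose_spec

lemma proj0_add (hD : IsOpen D) (hε : IsMaterial D ε) (v w : L2 D) :
    proj0 ε (v + w) = proj0 ε v + proj0 ε w := by
  have hv := isProj0_proj0 hD hε v
  have hw := isProj0_proj0 hD hε w
  refine (isProj0_proj0 hD hε (v + w)).unique hD hε ⟨?_, fun u hu => ?_⟩
  · exact (mem_kernel0_iff hD).1
      (Submodule.add_mem _ ((mem_kernel0_iff hD).2 hv.1) ((mem_kernel0_iff hD).2 hw.1))
  · have h1 := hv.2 u hu
    have h2 := hw.2 u hu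
    rw [← hε.form_apply] at h1 h2 ⊢
    rw [show v + w - (proj0 ε v + proj0 ε w) = (v - proj0 ε v) + (w - proj0 ε w) by abel,
      map_add, LinearMap.add_apply, h1, h2, add_zero]

lemma proj0_smul (hD : IsOpen D) (hε : IsMaterial D ε) (r : ℝ) (v : L2 D) :
    proj0 ε (r • v) = r • proj0 ε v := by
  have hv := isProj0_proj0 hD hε v
  refine (isProj0_proj0 hD hε (r • v)).unique hD hε ⟨?_, fun u hu => ?_⟩
  · exact (mem_kernel0_iff hD).1 (Submodule.smul_mem _ r ((mem_kernel0_iff hD).2 hv.1))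
  · have h1 := hv.2 u hu
    rw [← hε.form_apply] at h1 ⊢
    rw [← smul_sub, map_smul, LinearMap.smul_apply, h1, smul_zero]

lemma proj0_eq_self (hD : IsOpen D) (hε : IsMaterial D ε) {v : L2 D} (hv : v ∈ H0curl0 D) :
    proj0 ε v = v := by
  refine (isProj0_proj0 hD hε v).unique hD hε ⟨hv, fun u _ => ?_⟩
  rw [← hε.form_apply, sub_self, map_zero, LinearMap.zero_apply]

end WeakCurl

/-! ### Finite-dimensional problems -/

/-- A bilinear form on a finite-dimensional space that is nondegenerate on the left represents
every linear functional. -/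
lemma exists_representative {W : Type*} [AddCommGroup W] [Module ℝ W] [FiniteDimensional ℝ W]
    (B : LinearMap.BilinForm ℝ W) (hB : ∀ v, (∀ w, B v w = 0) → v = 0) (f : W →ₗ[ℝ] ℝ) :
    ∃ v, ∀ w, B v w = f w := by
  have hinj : Function.Injective B := by
    rw [← LinearMap.ker_eq_bot, LinearMap.ker_eq_bot']
    intro v hv
    exact hB v fun w => by rw [hv]; rfl
  have hsurj := (LinearMap.injective_iff_surjective_of_finrank_eq_finrank
    (Subspace.dual_finrank_eq (K := ℝ) (V := W)).symm (f := B)).1 hinj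
  obtain ⟨v, hv⟩ := hsurj f
  exact ⟨v, fun w => by rw [hv]⟩

namespace Mesh

variable {D : Set E3} (M : Mesh D)

/-! ### The jump lifting and the discrete curl -/

instance finiteDimensional_P (k : ℕ) : FiniteDimensional ℝ (M.P k) := by
  let W := {K // K ∈ M.cells} → Fin 3 → MvPolynomial.restrictTotalDegree (Fin 3) ℝ k
  let f : M.P k →ₗ[ℝ] W :=
    { toFun := fun p K i => ⟨p.1 K i, (MvPolynomial.mem_restrictTotalDegree _ _ _).2 (p.2 K i)⟩
      map_add' := fun _ _ => rfl
      map_smul' := fun _ _ => rfl }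
  refine FiniteDimensional.of_injective f fun p q h => Subtype.ext ?_
  funext K i
  exact congrArg Subtype.val (congrFun (congrFun h K) i)

lemma cross_add (u v w : E3) : cross (u + v) w = cross u w + cross v w := by
  apply ext3 <;> simp only [cross_zero, cross_one, cross_two, PiLp.add_apply] <;> ring

lemma cross_smul (c : ℝ) (u w : E3) : cross (c • u) w = c • cross u w := by
  apply ext3 <;>
    simp only [cross_zero, cross_one, cross_two, PiLp.smul_apply, smul_eq_mul] <;> ring

lemma jump_add (p q : M.Broken) (F : Finset E3) (x : E3) :
    M.jump (p + q) F x = M.jump p F x + M.jump q F x := by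
  simp only [jump, ← Finset.sum_add_distrib, Pi.add_apply, evalField_add, cross_add]

lemma jump_smul (c : ℝ) (p : M.Broken) (F : Finset E3) (x : E3) :
    M.jump (c • p) F x = c • M.jump p F x := by
  simp only [jump, Finset.smul_sum, Pi.smul_apply, evalField_smul, cross_smul]

lemma avg_add (p q : M.Broken) (F : Finset E3) (x : E3) :
    M.avg (p + q) F x = M.avg p F x + M.avg q F x := by
  simp only [avg, ← smul_add, ← Finset.sum_add_distrib, Pi.add_apply, evalField_add]

lemma avg_smul (c : ℝ) (p : M.Broken) (F : Finset E3) (x : E3) :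
    M.avg (c • p) F x = c • M.avg p F x := by
  simp only [avg, smul_comm c, Finset.smul_sum, Pi.smul_apply, evalField_smul]

/-- The sum over the faces of the products of jumps and averages. -/
noncomputable def faceForm : LinearMap.BilinForm ℝ M.Broken :=
  LinearMap.mk₂ ℝ
    (fun p φ => ∑ F ∈ M.faces, faceIntegral F fun x => ⟪M.jump p F x, M.avg φ F x⟫)
    (fun p q φ => by
      rw [← Finset.sum_add_distrib]
      refine Finset.sum_congr rfl fun F _ => ?_
      rw [← faceIntegral_add F ((M.continuous_jump p F).inner (M.continuous_avg φ F))
        ((M.continuous_jump q F).inner (M.continuous_avg φ F))]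
      simp only [jump_add, inner_add_left])
    (fun c p φ => by
      rw [Finset.smul_sum]
      refine Finset.sum_congr rfl fun F _ => ?_
      rw [smul_eq_mul, ← faceIntegral_const_mul]
      simp only [jump_smul, inner_smul_left, conj_trivial])
    (fun p φ ψ => by
      rw [← Finset.sum_add_distrib]
      refine Finset.sum_congr rfl fun F _ => ?_
      rw [← faceIntegral_add F ((M.continuous_jump p F).inner (M.continuous_avg φ F))
        ((M.continuous_jump p F).inner (M.continuous_avg ψ F))]
      simp only [avg_add, inner_add_right])
    (fun c p φ => by
      rw [Finset.smul_sum]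
      refine Finset.sum_congr rfl fun F _ => ?_
      rw [smul_eq_mul, ← faceIntegral_const_mul]
      simp only [avg_smul, inner_smul_right])

lemma isLift_iff {ℓ : ℕ} {p r : M.Broken} : M.IsLift ℓ p r ↔
    r ∈ M.P ℓ ∧ ∀ φ ∈ M.P ℓ, ⟪M.toL2 r, M.toL2 φ⟫ = M.faceForm p φ := Iff.rfl

lemma exists_isLift (hD : IsLipschitzDomain D) (ℓ : ℕ) (p : M.Broken) : ∃ r, M.IsLift ℓ p r := by
  let T : M.P ℓ →ₗ[ℝ] L2 D := M.toL2 ∘ₗ (M.P ℓ).subtype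
  let B : LinearMap.BilinForm ℝ (M.P ℓ) := (innerₗ (L2 D)).compl₁₂ T T
  have hB (v w : M.P ℓ) : B v w = ⟪M.toL2 v, M.toL2 w⟫ := rfl
  obtain ⟨r, hr⟩ := exists_representative B (fun v hv => by
    have h0 := hv v
    rw [hB, inner_self_eq_zero] at h0
    exact Subtype.ext (M.toL2_injective hD (h0.trans (map_zero _).symm)))
    ((M.faceForm p) ∘ₗ (M.P ℓ).subtype)
  exact ⟨r, r.2, fun φ hφ => hr ⟨φ, hφ⟩⟩

lemma isLift_lift (hD : IsLipschitzDomain D) (ℓ : ℕ) (p : M.Broken) :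
    M.IsLift ℓ p (M.lift ℓ p) := by
  have hex := M.exists_isLift hD ℓ p
  rw [lift, dif_pos hex]
  exact hex.choose_spec

lemma IsLift.unique (hD : IsLipschitzDomain D) {ℓ : ℕ} {p r r' : M.Broken}
    (h : M.IsLift ℓ p r) (h' : M.IsLift ℓ p r') : r = r' := by
  have hmem : r - r' ∈ M.P ℓ := Submodule.sub_mem _ h.1 h'.1
  have h0 : ⟪M.toL2 (r - r'), M.toL2 (r - r')⟫ = 0 := by
    have h1 : ⟪M.toL2 r, M.toL2 (r - r')⟫ = ⟪M.toL2 r', M.toL2 (r - r')⟫ :=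
      (h.2 _ hmem).trans (h'.2 _ hmem).symm
    nth_rw 1 [map_sub]
    rw [inner_sub_left, h1, sub_self]
  exact sub_eq_zero.1 (M.toL2_injective hD ((inner_self_eq_zero.1 h0).trans (map_zero _).symm))

lemma lift_add (hD : IsLipschitzDomain D) (ℓ : ℕ) (p q : M.Broken) :
    M.lift ℓ (p + q) = M.lift ℓ p + M.lift ℓ q := by
  refine IsLift.unique M hD (M.isLift_lift hD ℓ (p + q)) (M.isLift_iff.2 ⟨?_, fun φ hφ => ?_⟩)
  · exact Submodule.add_mem _ (M.isLift_lift hD ℓ p).1 (M.isLift_lift hD ℓ q).1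
  · rw [map_add, inner_add_left, (M.isLift_iff.1 (M.isLift_lift hD ℓ p)).2 φ hφ,
      (M.isLift_iff.1 (M.isLift_lift hD ℓ q)).2 φ hφ, map_add, LinearMap.add_apply]

lemma lift_smul (hD : IsLipschitzDomain D) (ℓ : ℕ) (c : ℝ) (p : M.Broken) :
    M.lift ℓ (c • p) = c • M.lift ℓ p := by
  refine IsLift.unique M hD (M.isLift_lift hD ℓ (c • p)) (M.isLift_iff.2 ⟨?_, fun φ hφ => ?_⟩)
  · exact Submodule.smul_mem _ _ (M.isLift_lift hD ℓ p).1
  · rw [map_smul, inner_smul_left, (M.isLift_iff.1 (M.isLift_lift hD ℓ p)).2 φ hφ, map_smul,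
      LinearMap.smul_apply]
    rfl

lemma curlPoly_add (p q : PolyField) : curlPoly (p + q) = curlPoly p + curlPoly q := by
  funext i
  fin_cases i <;> simp [curlPoly] <;> ring

lemma curlPoly_smul (c : ℝ) (p : PolyField) : curlPoly (c • p) = c • curlPoly p := by
  funext i
  fin_cases i <;> simp [curlPoly, smul_sub]

lemma dCurl_add (hD : IsLipschitzDomain D) (ℓ : ℕ) (p q : M.Broken) :
    M.dCurl ℓ (p + q) = M.dCurl ℓ p + M.dCurl ℓ q := by
  have : M.brokenCurl (p + q) = M.brokenCurl p + M.brokenCurl q :=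
    funext fun K => curlPoly_add _ _
  rw [dCurl, dCurl, dCurl, this, M.lift_add hD]
  abel

lemma dCurl_smul (hD : IsLipschitzDomain D) (ℓ : ℕ) (c : ℝ) (p : M.Broken) :
    M.dCurl ℓ (c • p) = c • M.dCurl ℓ p := by
  have : M.brokenCurl (c • p) = c • M.brokenCurl p :=
    funext fun K => curlPoly_smul _ _
  rw [dCurl, dCurl, this, M.lift_smul hD, smul_add]

lemma dCurl_sub (hD : IsLipschitzDomain D) (ℓ : ℕ) (p q : M.Broken) :
    M.dCurl ℓ (p - q) = M.dCurl ℓ p - M.dCurl ℓ q := by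
  rw [sub_eq_add_neg, ← neg_one_smul ℝ q, M.dCurl_add hD, M.dCurl_smul hD, neg_one_smul,
    ← sub_eq_add_neg]

/-- On conforming fields the discrete curl is the curl. -/
lemma toL2_dCurl_of_conforming (hD : IsLipschitzDomain D) (ℓ : ℕ) {q : M.Broken}
    (hq : M.toL2 q ∈ H0curl D) : M.toL2 (M.dCurl ℓ q) = curl (M.toL2 q) := by
  have hw := hasWeakCurl_curl (mem_Hcurl_of_mem_H0curl hq)
  have hjump {F : Finset E3} (hF : F ∈ M.faces) {x : ℝ × ℝ} (hx : x ∈ unitTri) :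
      M.jump q F (facePt F x) = 0 := by
    refine M.jump_eq_zero_of_conforming hD q (c := curl (M.toL2 q)) (fun φ hφ => ?_) hF hx
    have := inner_graph0 (mem_graph0_curl hD.isOpen hq) (hφ.hasWeakCurl (D := D))
    rwa [IsTestField.toL2, IsTestField.curlL2, inner_toLp, inner_toLp] at this
  have h0 : M.lift ℓ q = 0 := by
    refine IsLift.unique M hD (M.isLift_lift hD ℓ q) ⟨Submodule.zero_mem _, fun φ _ => ?_⟩
    rw [map_zero, inner_zero_left, Finset.sum_eq_zero]
    intro F hF
    rw [← faceIntegral_zero F]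
    exact faceIntegral_congr fun x hx => by rw [hjump hF hx, inner_zero_left]
  rw [dCurl, h0, add_zero, M.weakCurl_eq_brokenCurl hD q hw]

/-- The discrete curl is dual to the curl of the conforming fields of degree `ℓ`. -/
lemma inner_dCurl (hD : IsLipschitzDomain D) {ℓ : ℕ} (w : M.Broken) {Φ : M.Broken}
    (hΦ : Φ ∈ M.Pc ℓ) : ⟪M.toL2 Φ, M.toL2 (M.dCurl ℓ w)⟫ = ⟪curl (M.toL2 Φ), M.toL2 w⟫ := by
  have h1 := M.green_conforming hD w Φ (hasWeakCurl_curl hΦ.2)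
  have h2 := (M.isLift_lift hD ℓ w).2 Φ hΦ.1
  rw [real_inner_comm, dCurl, map_add, inner_add_left, h2, h1, real_inner_comm]

lemma dCurlV_eq (hD : IsLipschitzDomain D) (k ℓ : ℕ) (v : M.V k) {d : L2 D × M.Broken}
    (hd : M.IsDecomp k v d) : M.dCurlV k ℓ v = curl d.1 + M.toL2 (M.dCurl ℓ d.2) := by
  have hex : ∃ d, M.IsDecomp k v d := ⟨d, hd⟩
  rw [dCurlV, dif_pos hex]
  obtain ⟨h1, h2, h3⟩ := hex.choose_spec
  set d' := hex.choose
  have hdiff : M.toL2 (d.2 - d'.2) = d'.1 - d.1 := by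
    rw [map_sub, sub_eq_sub_iff_add_eq_add, add_comm, ← hd.2.2, h3]
  have hmem : M.toL2 (d.2 - d'.2) ∈ H0curl D := by
    rw [hdiff]; exact Submodule.sub_mem _ h1 hd.1
  have h4 := M.toL2_dCurl_of_conforming hD ℓ hmem
  rw [hdiff, curl_sub hD.isOpen (mem_Hcurl_of_mem_H0curl h1) (mem_Hcurl_of_mem_H0curl hd.1),
    M.dCurl_sub hD, map_sub, sub_eq_sub_iff_add_eq_add] at h4
  rw [← h4, add_comm]

lemma exists_isDecomp (k : ℕ) (v : M.V k) : ∃ d, M.IsDecomp k v d := by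
  obtain ⟨a, ha, b, hb, hab⟩ := Submodule.mem_sup.1 v.2
  obtain ⟨p, hp, rfl⟩ := Submodule.mem_map.1 hb
  exact ⟨(a, p), ha, hp, hab.symm⟩

/-- The discrete curl on `V_♯` as a linear map. -/
noncomputable def dCurlL (hD : IsLipschitzDomain D) (k ℓ : ℕ) : M.V k →ₗ[ℝ] L2 D where
  toFun := M.dCurlV k ℓ
  map_add' v w := by
    obtain ⟨d, hd⟩ := M.exists_isDecomp k v
    obtain ⟨d', hd'⟩ := M.exists_isDecomp k w
    have hs : M.IsDecomp k (v + w : M.V k) (d + d') := by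
      refine ⟨Submodule.add_mem _ hd.1 hd'.1, Submodule.add_mem _ hd.2.1 hd'.2.1, ?_⟩
      rw [Submodule.coe_add, hd.2.2, hd'.2.2, Prod.fst_add, Prod.snd_add, map_add]
      abel
    rw [M.dCurlV_eq hD k ℓ _ hd, M.dCurlV_eq hD k ℓ _ hd', M.dCurlV_eq hD k ℓ _ hs, Prod.fst_add,
      Prod.snd_add, M.dCurl_add hD, map_add, curl_add hD.isOpen (mem_Hcurl_of_mem_H0curl hd.1)
        (mem_Hcurl_of_mem_H0curl hd'.1)]
    abel
  map_smul' c v := by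
    obtain ⟨d, hd⟩ := M.exists_isDecomp k v
    have hs : M.IsDecomp k (c • v : M.V k) (c • d) := by
      refine ⟨Submodule.smul_mem _ _ hd.1, Submodule.smul_mem _ _ hd.2.1, ?_⟩
      rw [Submodule.coe_smul, hd.2.2, Prod.smul_fst, Prod.smul_snd, map_smul, smul_add]
    rw [M.dCurlV_eq hD k ℓ _ hd, M.dCurlV_eq hD k ℓ _ hs, Prod.smul_fst, Prod.smul_snd,
      M.dCurl_smul hD, map_smul, curl_smul hD.isOpen _ (mem_Hcurl_of_mem_H0curl hd.1), smul_add,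
      RingHom.id_apply]

lemma dCurlV_incl (hD : IsLipschitzDomain D) (k ℓ : ℕ) (p : M.P k) :
    M.dCurlV k ℓ (M.incl k p) = M.toL2 (M.dCurl ℓ p) := by
  rw [M.dCurlV_eq hD k ℓ (M.incl k p) (d := (0, p))
    ⟨Submodule.zero_mem _, p.2, by simp [incl]⟩, curl_zero hD.isOpen, zero_add]

lemma dCurlV_inclH (hD : IsLipschitzDomain D) (k ℓ : ℕ) (v : H0curl D) :
    M.dCurlV k ℓ (M.inclH k v) = curl (v : L2 D) := by
  have h0 : M.dCurl ℓ 0 = 0 := by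
    have := M.dCurl_smul hD ℓ 0 0
    rwa [zero_smul, zero_smul] at this
  rw [M.dCurlV_eq hD k ℓ (M.inclH k v) (d := (v, 0))
    ⟨v.2, Submodule.zero_mem _, by simp [inclH]⟩, h0, map_zero, add_zero]

end Mesh

/-! ### Strong form of the continuous problems -/

section Strong

variable {D : Set E3} {ε ν : Coeff} {ω : ℝ}

/-- A weak solution satisfies the equation in the sense of distributions. -/
lemma hasWeakCurl_mul_curl (hD : IsOpen D) (hε : IsMaterial D ε) (hν : IsMaterial D ν)
    {u f : L2 D} (h : ∀ w ∈ H0curl D, bForm ε ν ω u w = ⟪f, w⟫) :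
    HasWeakCurl (mul ν (curl u)) (f + ω ^ 2 • mul ε u) := by
  rw [hasWeakCurl_iff]
  intro φ hφ
  have h1 := h (hφ.toL2 D) (mem_H0curl_iff.2 ⟨_, hφ.mem_graph0⟩)
  rw [bForm, hφ.hasWeakCurl.curl_eq hD, hε.wInner_eq, hν.wInner_eq, hε.op_apply,
    hν.op_apply] at h1
  rw [inner_add_left, inner_smul_left, conj_trivial]
  linarith

lemma bForm_comm (hε : IsMaterial D ε) (hν : IsMaterial D ν) (v w : L2 D) :
    bForm ε ν ω v w = bForm ε ν ω w v := by
  rw [bForm, bForm, hε.wInner_comm, hν.wInner_comm]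

lemma SolvesAdjoint.hasWeakCurl (hD : IsOpen D) (hε : IsMaterial D ε) (hν : IsMaterial D ν)
    {θ ζ : L2 D} (h : SolvesAdjoint ε ν ω θ ζ) :
    HasWeakCurl (mul ν (curl ζ)) (mul ε θ + ω ^ 2 • mul ε ζ) := by
  refine hasWeakCurl_mul_curl hD hε hν fun w hw => ?_
  rw [bForm_comm hε hν, h.2 w hw, hε.wInner_comm, hε.wInner_eq, hε.op_apply]

lemma SolvesAdjoint.unique (hD : IsOpen D) (hε : IsMaterial D ε) (hν : IsMaterial D ν)
    (hres : NonResonant D ε ν ω) {θ ζ ζ' : L2 D} (h : SolvesAdjoint ε ν ω θ ζ)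
    (h' : SolvesAdjoint ε ν ω θ ζ') : ζ = ζ' := by
  have h1 := (h.hasWeakCurl hD hε hν).sub (h'.hasWeakCurl hD hε hν)
  refine sub_eq_zero.1 (hres _ (Submodule.sub_mem _ h.1 h'.1) ?_)
  rw [curl_sub hD (mem_Hcurl_of_mem_H0curl h.1) (mem_Hcurl_of_mem_H0curl h'.1)]
  simp only [← hε.op_apply, ← hν.op_apply, map_sub] at h1 ⊢
  convert h1 using 1
  module

end Strong

namespace Mesh

variable {D : Set E3} (M : Mesh D) {ν : Coeff}

/-! ### Mesh-dependent norms -/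

lemma nuMin_pos (hD : IsLipschitzDomain D) (hν : IsMaterial D ν) {K : Finset E3}
    (hK : K ∈ M.cells) : 0 < nuMin D ν K := by
  obtain ⟨a, b, ha, hab⟩ := hν.bounds
  have hab' := hab.filter_mono (ae_mono (Measure.restrict_mono
    (inter_subset_left : D ∩ convexHull ℝ (K : Set E3) ⊆ D) (le_refl (volume : Measure E3))))
  refine lt_of_lt_of_le ha (le_csSup ⟨b, fun c hc => ?_⟩ ?_)
  · have hpos : volume (D ∩ convexHull ℝ (K : Set E3)) ≠ 0 := by
      have hsub : interior (convexHull ℝ (K : Set E3)) ⊆ D ∩ convexHull ℝ (K : Set E3) :=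
        fun x hx => ⟨M.interior_cell_subset hD hK hx, interior_subset hx⟩
      exact (lt_of_lt_of_le (isOpen_interior.measure_pos volume
        (interior_cell_nonempty (M.card_eq K hK) (M.indep K hK))) (measure_mono hsub)).ne'
    have : (ae (volume.restrict (D ∩ convexHull ℝ (K : Set E3)))).NeBot := by
      rw [ae_restrict_neBot]; exact hpos
    have hc' : ∀ᵐ x ∂(volume.restrict (D ∩ convexHull ℝ (K : Set E3))), ∀ u : E3,
        c * ‖u‖ ^ 2 ≤ ⟪act (ν x) u, u⟫ := hc
    obtain ⟨x, hx1, hx2⟩ := (hc'.and hab').exists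
    have h1 := hx1 (stdVec 0)
    have h2 := (hx2 (stdVec 0)).2
    simp only [PiLp.norm_single, norm_one] at h1 h2
    linarith
  · filter_upwards [hab'] with x hx u using (hx u).1

lemma diam_pos {K : Finset E3} (hK : K ∈ M.cells) : 0 < diam K := by
  have h2 : 1 < K.card := by rw [M.card_eq K hK]; norm_num
  obtain ⟨x, hx, y, hy, hne⟩ := Finset.one_lt_card.1 h2
  refine lt_of_lt_of_le (dist_pos.2 hne) (Metric.dist_le_diam_of_mem ?_
    (subset_convexHull ℝ _ hx) (subset_convexHull ℝ _ hy))
  exact (K.finite_toSet.isCompact_convexHull ℝ).isBounded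

lemma cellSq_nonneg (K : Finset E3) (v : L2 D) : 0 ≤ cellSq K v :=
  integral_nonneg fun _ => by positivity

lemma cellSq_smul (K : Finset E3) (c : ℝ) (v : L2 D) : cellSq K (c • v) = c ^ 2 * cellSq K v := by
  rw [cellSq, cellSq, ← integral_const_mul]
  refine integral_congr_ae ?_
  have h := (Lp.coeFn_smul c v).filter_mono (ae_mono (Measure.restrict_mono
    (inter_subset_left : D ∩ convexHull ℝ (K : Set E3) ⊆ D) (le_refl (volume : Measure E3))))
  filter_upwards [h] with x hx
  rw [hx, Pi.smul_apply, norm_smul, mul_pow, Real.norm_eq_abs, sq_abs]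

/-- The Cauchy-Schwarz inequality on a cell. -/
lemma abs_setIntegral_inner_le (K : Finset E3) (c u : L2 D) :
    |∫ x in D ∩ convexHull ℝ (K : Set E3), ⟪c x, u x⟫|
      ≤ Real.sqrt (cellSq K c) * Real.sqrt (cellSq K u) := by
  set S := D ∩ convexHull ℝ (K : Set E3) with hS
  have hle : volume.restrict S ≤ volume.restrict D := Measure.restrict_mono inter_subset_left le_rfl
  have hc : MemLp c 2 (volume.restrict S) := (Lp.memLp c).mono_measure hle
  have hu : MemLp u 2 (volume.restrict S) := (Lp.memLp u).mono_measure hle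
  have key (f g : L2 S) : |∫ x in S, ⟪f x, g x⟫| ≤ ‖f‖ * ‖g‖ := by
    rw [← L2.inner_def (𝕜 := ℝ)]; exact abs_real_inner_le_norm f g
  have hn (v : L2 D) (hv : MemLp v 2 (volume.restrict S)) :
      ‖hv.toLp v‖ = Real.sqrt (cellSq K v) := by
    rw [← Real.sqrt_sq (norm_nonneg (hv.toLp v)), ← real_inner_self_eq_norm_sq, L2.inner_def,
      cellSq]
    congr 1
    refine integral_congr_ae ?_
    filter_upwards [hv.coeFn_toLp] with x hx
    rw [hx, real_inner_self_eq_norm_sq]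
  rw [← hn c hc, ← hn u hu]
  refine le_trans (le_of_eq ?_) (key (hc.toLp c) (hu.toLp u))
  congr 1
  refine integral_congr_ae ?_
  filter_upwards [hc.coeFn_toLp, hu.coeFn_toLp] with x h1 h2
  rw [h1, h2]

/-- The Cauchy-Schwarz inequality with cellwise weights. -/
lemma abs_inner_le_weighted (hD : IsLipschitzDomain D) {α β : Finset E3 → ℝ}
    (hα : ∀ K ∈ M.cells, 0 ≤ α K) (hβ : ∀ K ∈ M.cells, 0 ≤ β K)
    (hαβ : ∀ K ∈ M.cells, α K * β K = 1) (c u : L2 D) :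
    |⟪c, u⟫| ≤ Real.sqrt (∑ K ∈ M.cells, α K * cellSq K c)
      * Real.sqrt (∑ K ∈ M.cells, β K * cellSq K u) := by
  rw [L2.inner_def, M.integral_eq_sum_inter hD (L2.integrable_inner c u),
    ← Finset.sum_coe_sort M.cells, ← Finset.sum_coe_sort M.cells]
  refine (Finset.abs_sum_le_sum_abs _ _).trans ?_
  have h := Real.sum_sqrt_mul_sqrt_le (Finset.univ : Finset {K // K ∈ M.cells})
    (f := fun K => α K.1 * cellSq K.1 c) (g := fun K => β K.1 * cellSq K.1 u)
    (fun K => ?_) (fun K => ?_)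
  · refine (Finset.sum_le_sum fun K _ => ?_).trans h
    refine (abs_setIntegral_inner_le K.1 c u).trans (le_of_eq ?_)
    rw [← Real.sqrt_mul (cellSq_nonneg _ _),
      ← Real.sqrt_mul (mul_nonneg (hα _ K.2) (cellSq_nonneg _ _))]
    congr 1
    have := hαβ _ K.2
    linear_combination (-(cellSq K.1 c * cellSq K.1 u)) * this
  all_goals exact mul_nonneg (by first | exact hα _ K.2 | exact hβ _ K.2) (cellSq_nonneg _ _)

lemma norm_sq_eq_sum_cellSq (hD : IsLipschitzDomain D) (v : L2 D) :
    ‖v‖ ^ 2 = ∑ K ∈ M.cells, cellSq K v := by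
  rw [← real_inner_self_eq_norm_sq, L2.inner_def,
    M.integral_eq_sum_inter hD (L2.integrable_inner v v), ← Finset.sum_coe_sort M.cells]
  refine Finset.sum_congr rfl fun K _ => ?_
  simp_rw [real_inner_self_eq_norm_sq]
  rfl

lemma normE_nonneg (ℓ : ℕ) (p : M.Broken) : 0 ≤ M.normE ν ℓ p := Real.sqrt_nonneg _

lemma normH_nonneg (v : L2 D) : 0 ≤ M.normH ν v := Real.sqrt_nonneg _

/-- The duality between the mesh-dependent norms. -/
lemma abs_pairing_le (hD : IsLipschitzDomain D) (hν : IsMaterial D ν) (ℓ : ℕ) (ψ : L2 D)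
    (p : M.Broken) :
    |⟪ψ, M.toL2 (M.dCurl ℓ p)⟫ - ⟪curl ψ, M.toL2 p⟫| ≤ M.normH ν ψ * M.normE ν ℓ p := by
  have h1 := hν.abs_inner_le ψ (M.toL2 (M.dCurl ℓ p))
  have hpos (K : Finset E3) (hK : K ∈ M.cells) := M.nuMin_pos hD hν hK
  have hdp (K : Finset E3) (hK : K ∈ M.cells) := M.diam_pos hK
  have h2 := M.abs_inner_le_weighted hD (α := fun K => (nuMin D ν K)⁻¹ * diam K ^ 2)
    (β := fun K => nuMin D ν K * (diam K ^ 2)⁻¹)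
    (fun K hK => by have := hpos K hK; positivity)
    (fun K hK => by have := hpos K hK; positivity)
    (fun K hK => by have := hpos K hK; have := hdp K hK; field_simp) (curl ψ) (M.toL2 p)
  have hSα : 0 ≤ ∑ K ∈ M.cells, (nuMin D ν K)⁻¹ * diam K ^ 2 * cellSq K (curl ψ) :=
    Finset.sum_nonneg fun K hK => by
      have := hpos K hK; have := cellSq_nonneg K (curl ψ); positivity
  have hSβ : 0 ≤ ∑ K ∈ M.cells, nuMin D ν K * (diam K ^ 2)⁻¹ * cellSq K (M.toL2 p) :=
    Finset.sum_nonneg fun K hK => by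
      have := hpos K hK; have := cellSq_nonneg K (M.toL2 p); positivity
  rw [normH, normE, ← Real.sqrt_mul (add_nonneg (sq_nonneg _) hSα)]
  refine (abs_sub _ _).trans ((add_le_add h1 h2).trans (Real.le_sqrt_of_sq_le ?_))
  set A := wNorm (fun x => (ν x)⁻¹) ψ
  set B := wNorm ν (M.toL2 (M.dCurl ℓ p))
  set X := ∑ K ∈ M.cells, (nuMin D ν K)⁻¹ * diam K ^ 2 * cellSq K (curl ψ)
  set Y := ∑ K ∈ M.cells, nuMin D ν K * (diam K ^ 2)⁻¹ * cellSq K (M.toL2 p)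
  have hX := Real.sq_sqrt hSα
  have hY := Real.sq_sqrt hSβ
  generalize Real.sqrt X = A' at *
  generalize Real.sqrt Y = B' at *
  rw [← hX, ← hY]
  -- the Cauchy-Schwarz inequality in the plane
  nlinarith [sq_nonneg (A * B' - A' * B)]

lemma nc_nonneg (k ℓ : ℕ) (p : M.Broken) : 0 ≤ M.nc ν k ℓ p :=
  Real.iInf_nonneg fun _ => M.normE_nonneg _ _

lemma distH_le (ℓ : ℕ) (v : L2 D) (Φ : M.Pc ℓ) : M.distH ν ℓ v ≤ M.normH ν (v - M.toL2 Φ.1) :=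
  ciInf_le ⟨0, by rintro _ ⟨q, rfl⟩; exact M.normH_nonneg _⟩ Φ

instance nonempty_Pc0 (k : ℕ) : Nonempty (M.Pc0 k) :=
  ⟨⟨0, Submodule.zero_mem _, by rw [map_zero]; exact Submodule.zero_mem _⟩⟩

/-- The conformity defect of a broken polynomial. Conforming fields of both kinds can be
subtracted, so that it is controlled by the distances to these fields. -/
lemma abs_defect_le (hD : IsLipschitzDomain D) (hν : IsMaterial D ν) (k ℓ : ℕ) {ψ : L2 D}
    (hψ : ψ ∈ Hcurl D) (w : M.Broken) :
    |⟪ψ, M.toL2 (M.dCurl ℓ w)⟫ - ⟪curl ψ, M.toL2 w⟫| ≤ M.distH ν ℓ ψ * M.nc ν k ℓ w := by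
  have key (Φ : M.Pc ℓ) (q : M.Pc0 k) :
      |⟪ψ, M.toL2 (M.dCurl ℓ w)⟫ - ⟪curl ψ, M.toL2 w⟫|
        ≤ M.normH ν (ψ - M.toL2 Φ.1) * M.normE ν ℓ (w - q.1) := by
    have hΦ : M.toL2 Φ.1 ∈ Hcurl D := Φ.2.2
    have h1 := M.abs_pairing_le hD hν ℓ (ψ - M.toL2 Φ.1) (w - q.1)
    have hcu : curl (ψ - M.toL2 Φ.1) = curl ψ - curl (M.toL2 Φ.1) := curl_sub hD.isOpen hψ hΦ
    have e1 := M.inner_dCurl hD w Φ.2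
    have e2 := M.inner_dCurl hD q.1 Φ.2
    have e3 := inner_curl_right hD.isOpen q.2.2 hψ
    rw [← M.toL2_dCurl_of_conforming hD ℓ q.2.2] at e3
    have e4 : ⟪ψ, M.toL2 (M.dCurl ℓ q.1)⟫ = ⟪curl ψ, M.toL2 q.1⟫ := by
      rw [real_inner_comm, ← e3, real_inner_comm]
    rw [hcu, M.dCurl_sub hD, map_sub, map_sub] at h1
    refine le_trans (le_of_eq ?_) h1
    congr 1
    simp only [inner_sub_left, inner_sub_right, e1, e2, e4]
    ring
  have hne1 : Nonempty (M.Pc ℓ) :=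
    ⟨⟨0, Submodule.zero_mem _, by rw [map_zero]; exact ⟨0, hasWeakCurl_zero⟩⟩⟩
  rw [distH, Real.iInf_mul_of_nonneg (M.nc_nonneg k ℓ w)]
  refine le_ciInf fun Φ => ?_
  rw [nc, Real.mul_iInf_of_nonneg (M.normH_nonneg _)]
  exact le_ciInf fun q => key Φ q

/-! ### The nonconformity measure -/

lemma nc_le (k ℓ : ℕ) (p : M.Broken) (q : M.Pc0 k) : M.nc ν k ℓ p ≤ M.normE ν ℓ (p - q.1) :=
  ciInf_le ⟨0, by rintro _ ⟨q, rfl⟩; exact M.normE_nonneg _ _⟩ q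

lemma nc_sub_conforming_le (k ℓ : ℕ) (p : M.Broken) {q : M.Broken} (hq : q ∈ M.Pc0 k) :
    M.nc ν k ℓ (p - q) ≤ M.nc ν k ℓ p := by
  refine le_ciInf fun q' => ?_
  have hmem : q'.1 - q ∈ M.Pc0 k := by
    refine ⟨Submodule.sub_mem _ q'.2.1 hq.1, ?_⟩
    rw [map_sub]
    exact Submodule.sub_mem _ q'.2.2 hq.2
  have h := M.nc_le (ν := ν) k ℓ (p - q) ⟨_, hmem⟩
  rwa [sub_sub_sub_cancel_right] at h

lemma normE_smul (hD : IsLipschitzDomain D) (hν : IsMaterial D ν) (ℓ : ℕ) {c : ℝ} (hc : 0 ≤ c)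
    (p : M.Broken) : M.normE ν ℓ (c • p) = c * M.normE ν ℓ p := by
  rw [normE, normE]
  conv_rhs => rw [← Real.sqrt_sq hc, ← Real.sqrt_mul (sq_nonneg c)]
  congr 1
  rw [mul_add, Finset.mul_sum, M.dCurl_smul hD, map_smul, map_smul, hν.wNorm_sq, hν.wNorm_sq,
    ← hν.form_apply, ← hν.form_apply, map_smul, map_smul, LinearMap.smul_apply]
  congr 1
  · refine Finset.sum_congr rfl fun K _ => ?_
    rw [cellSq_smul]; ring
  · simp only [smul_eq_mul]; ring

lemma nc_smul_le (hD : IsLipschitzDomain D) (hν : IsMaterial D ν) (k ℓ : ℕ) {c : ℝ} (hc : 0 ≤ c)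
    (p : M.Broken) : M.nc ν k ℓ (c • p) ≤ c * M.nc ν k ℓ p := by
  conv_rhs => rw [nc, Real.mul_iInf_of_nonneg hc]
  refine le_ciInf fun q => ?_
  have hmem : c • q.1 ∈ M.Pc0 k := by
    refine ⟨Submodule.smul_mem _ _ q.2.1, ?_⟩
    rw [map_smul]
    exact Submodule.smul_mem _ _ q.2.2
  have h := M.nc_le (ν := ν) k ℓ (c • p) ⟨_, hmem⟩
  rwa [← smul_sub, M.normE_smul hD hν ℓ hc] at h

lemma nc_smul (hD : IsLipschitzDomain D) (hν : IsMaterial D ν) (k ℓ : ℕ) {c : ℝ} (hc : 0 < c)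
    (p : M.Broken) : M.nc ν k ℓ (c • p) = c * M.nc ν k ℓ p := by
  refine le_antisymm (M.nc_smul_le hD hν k ℓ hc.le p) ?_
  have h := M.nc_smul_le hD hν k ℓ (inv_nonneg.2 hc.le) (c • p)
  rw [smul_smul, inv_mul_cancel₀ hc.ne', one_smul] at h
  calc c * M.nc ν k ℓ p ≤ c * (c⁻¹ * M.nc ν k ℓ (c • p)) := by gcongr
    _ = M.nc ν k ℓ (c • p) := by rw [← mul_assoc, mul_inv_cancel₀ hc.ne', one_mul]

/-- The norm `normE` controls the Lebesgue norm. -/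
lemma exists_norm_le_normE (hD : IsLipschitzDomain D) (hν : IsMaterial D ν) (ℓ : ℕ) :
    ∃ a : ℝ, 0 < a ∧ ∀ p : M.Broken, a * ‖M.toL2 p‖ ^ 2 ≤ M.normE ν ℓ p ^ 2 := by
  have hpos (K : Finset E3) (hK : K ∈ M.cells) : 0 < nuMin D ν K * (diam K ^ 2)⁻¹ := by
    have := M.nuMin_pos hD hν hK
    have := M.diam_pos hK
    positivity
  obtain ⟨a, ha, hle⟩ : ∃ a : ℝ, 0 < a ∧ ∀ K ∈ M.cells, a ≤ nuMin D ν K * (diam K ^ 2)⁻¹ := by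
    rcases M.cells.eq_empty_or_nonempty with h | h
    · exact ⟨1, one_pos, fun K hK => by rw [h] at hK; simp at hK⟩
    · obtain ⟨K, hK, hmin⟩ := M.cells.exists_min_image
        (fun K => nuMin D ν K * (diam K ^ 2)⁻¹) h
      exact ⟨_, hpos K hK, hmin⟩
  refine ⟨a, ha, fun p => ?_⟩
  have h1 : a * ‖M.toL2 p‖ ^ 2
      ≤ ∑ K ∈ M.cells, nuMin D ν K * (diam K ^ 2)⁻¹ * cellSq K (M.toL2 p) := by
    rw [M.norm_sq_eq_sum_cellSq hD, Finset.mul_sum]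
    exact Finset.sum_le_sum fun K hK =>
      mul_le_mul_of_nonneg_right (hle K hK) (cellSq_nonneg _ _)
  rw [normE, Real.sq_sqrt]
  · linarith [sq_nonneg (wNorm ν (M.toL2 (M.dCurl ℓ p)))]
  · exact add_nonneg (le_trans (by positivity) h1) (sq_nonneg _)

/-- The nonconformity measure vanishes on conforming fields only. The conforming fields form a
finite-dimensional space, which is closed. -/
lemma mem_H0curl_of_nc_eq_zero (hD : IsLipschitzDomain D) (hν : IsMaterial D ν) (k ℓ : ℕ)
    {p : M.Broken} (h : M.nc ν k ℓ p = 0) : M.toL2 p ∈ H0curl D := by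
  obtain ⟨a, ha, hle⟩ := M.exists_norm_le_normE hD hν ℓ
  let S : Submodule ℝ (L2 D) := (M.P k).map M.toL2 ⊓ H0curl D
  have : FiniteDimensional ℝ ((M.P k).map M.toL2) := inferInstance
  have hfin : FiniteDimensional ℝ S :=
    Submodule.finiteDimensional_of_le (inf_le_left : S ≤ (M.P k).map M.toL2)
  have hcl : IsClosed (S : Set (L2 D)) := S.closed_of_finiteDimensional
  have hmem : M.toL2 p ∈ closure (S : Set (L2 D)) := by
    rw [Metric.mem_closure_iff]
    intro δ hδ
    have hlt : M.nc ν k ℓ p < Real.sqrt a * δ := by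
      rw [h]; exact mul_pos (Real.sqrt_pos.2 ha) hδ
    obtain ⟨q, hq⟩ := exists_lt_of_ciInf_lt hlt
    refine ⟨M.toL2 q.1, ⟨Submodule.mem_map_of_mem q.2.1, q.2.2⟩, ?_⟩
    rw [dist_eq_norm, ← map_sub]
    have h1 := hle (p - q.1)
    have h2 : M.normE ν ℓ (p - q.1) ^ 2 < (Real.sqrt a * δ) ^ 2 :=
      pow_lt_pow_left₀ hq (M.normE_nonneg _ _) (by norm_num)
    rw [mul_pow, Real.sq_sqrt ha.le] at h2
    have h3 : ‖M.toL2 (p - q.1)‖ ^ 2 < δ ^ 2 := lt_of_mul_lt_mul_left (h1.trans_lt h2) ha.le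
    exact lt_of_pow_lt_pow_left₀ 2 hδ.le h3
  rw [hcl.closure_eq] at hmem
  exact hmem.2

end Mesh

/-! ### Weighted products and the projection on the curl-free fields -/

section Weighted

variable {D : Set E3} {A ε : Coeff}

lemma IsMaterial.wInner_smul_left (hA : IsMaterial D A) (c : ℝ) (u v : L2 D) :
    wInner A (c • u) v = c * wInner A u v := by
  rw [← hA.form_apply, ← hA.form_apply, map_smul]; rfl

lemma IsMaterial.wInner_smul_right (hA : IsMaterial D A) (c : ℝ) (u v : L2 D) :
    wInner A u (c • v) = c * wInner A u v := by
  rw [← hA.form_apply, ← hA.form_apply, map_smul]; rfl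

lemma IsMaterial.wInner_add_left (hA : IsMaterial D A) (u v w : L2 D) :
    wInner A (u + v) w = wInner A u w + wInner A v w := by
  simp only [← hA.form_apply, map_add, LinearMap.add_apply]

lemma IsMaterial.wInner_add_right (hA : IsMaterial D A) (u v w : L2 D) :
    wInner A u (v + w) = wInner A u v + wInner A u w := by
  simp only [← hA.form_apply, map_add]

lemma IsMaterial.wInner_sub_left (hA : IsMaterial D A) (u v w : L2 D) :
    wInner A (u - v) w = wInner A u w - wInner A v w := by
  simp only [← hA.form_apply, map_sub, LinearMap.sub_apply]

lemma IsMaterial.wInner_sub_right (hA : IsMaterial D A) (u v w : L2 D) :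
    wInner A u (v - w) = wInner A u v - wInner A u w := by
  simp only [← hA.form_apply, map_sub]

lemma IsMaterial.wNorm_smul (hA : IsMaterial D A) {c : ℝ} (hc : 0 ≤ c) (u : L2 D) :
    wNorm A (c • u) = c * wNorm A u := by
  rw [wNorm, wNorm, hA.wInner_smul_left, hA.wInner_smul_right, ← mul_assoc,
    Real.sqrt_mul (mul_self_nonneg c), Real.sqrt_mul_self hc]

lemma IsMaterial.wNorm_zero (hA : IsMaterial D A) : wNorm A (0 : L2 D) = 0 := by
  have := hA.wNorm_smul le_rfl (0 : L2 D)
  rwa [zero_smul, zero_mul] at this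

lemma isPerp0_sub_proj0 (hD : IsOpen D) (hε : IsMaterial D ε) (v : L2 D) :
    IsPerp0 ε (v - proj0 ε v) := (isProj0_proj0 hD hε v).2

lemma wInner_proj0_left (hD : IsOpen D) (hε : IsMaterial D ε) (v : L2 D) {w : L2 D}
    (hw : w ∈ H0curl0 D) : wInner ε (proj0 ε v) w = wInner ε v w := by
  have := isPerp0_sub_proj0 hD hε v w hw
  rw [hε.wInner_sub_left] at this
  linarith

lemma wInner_sub_proj0_right (hD : IsOpen D) (hε : IsMaterial D ε) {θ : L2 D}
    (hθ : IsPerp0 ε θ) (v : L2 D) : wInner ε θ (v - proj0 ε v) = wInner ε θ v := by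
  rw [hε.wInner_sub_right, hθ _ (isProj0_proj0 hD hε v).1, sub_zero]

/-- The theorem of Pythagoras for the projection on the curl-free fields. -/
lemma wNorm_sq_eq_proj0_add (hD : IsOpen D) (hε : IsMaterial D ε) (v : L2 D) :
    wNorm ε v ^ 2 = wNorm ε (proj0 ε v) ^ 2 + wNorm ε (v - proj0 ε v) ^ 2 := by
  have h1 := wInner_sub_proj0_right hD hε (isPerp0_sub_proj0 hD hε v) v
  have h2 := wInner_proj0_left hD hε v (isProj0_proj0 hD hε v).1
  rw [hε.wNorm_sq, hε.wNorm_sq, hε.wNorm_sq, h1, h2, hε.wInner_sub_left,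
    hε.wInner_comm v (proj0 ε v)]
  ring

lemma wNorm_proj0_le (hD : IsOpen D) (hε : IsMaterial D ε) (v : L2 D) :
    wNorm ε (proj0 ε v) ≤ wNorm ε v := by
  refine le_of_sq_le_sq ?_ (wNorm_nonneg v)
  rw [wNorm_sq_eq_proj0_add hD hε v]
  linarith [sq_nonneg (wNorm ε (v - proj0 ε v))]

end Weighted

namespace Mesh

variable {D : Set E3} {ε ν : Coeff} {ω : ℝ}
variable (M : Mesh D) {k ℓ : ℕ} {s : LinearMap.BilinForm ℝ (M.V k)}

/-! ### The augmented forms -/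

/-- The bilinear form `c (v, w)_ε + (C_h v, C_h w)_ν + s(v, w)` on `V_♯`; both `b_♯♯` and `b_♯♯⁺`
are of this type, with `c = ∓ω²`. -/
noncomputable def formSS (hD : IsLipschitzDomain D) (hε : IsMaterial D ε) (hν : IsMaterial D ν)
    (k ℓ : ℕ) (s : LinearMap.BilinForm ℝ (M.V k)) (c : ℝ) : LinearMap.BilinForm ℝ (M.V k) :=
  c • hε.form.compl₁₂ (M.V k).subtype (M.V k).subtype
    + hν.form.compl₁₂ (M.dCurlL hD k ℓ) (M.dCurlL hD k ℓ) + s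

lemma bss_eq (hD : IsLipschitzDomain D) (hε : IsMaterial D ε) (hν : IsMaterial D ν)
    (v w : M.V k) :
    M.bss ε ν ω k ℓ s v w = M.formSS hD hε hν k ℓ s (-ω ^ 2) v w := rfl

lemma bssPlus_eq (hD : IsLipschitzDomain D) (hε : IsMaterial D ε) (hν : IsMaterial D ν)
    (v w : M.V k) :
    M.bssPlus ε ν ω k ℓ s v w = M.formSS hD hε hν k ℓ s (ω ^ 2) v w := rfl

lemma normSS_nonneg (v : M.V k) : 0 ≤ M.normSS ε ν ω k ℓ s v := Real.sqrt_nonneg _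

lemma normSS_sq_eq_add (hs : M.IsStabilization k s) (v : M.V k) :
    M.normSS ε ν ω k ℓ s v ^ 2
      = ω ^ 2 * wNorm ε v.1 ^ 2 + wNorm ν (M.dCurlV k ℓ v) ^ 2 + s v v :=
  Real.sq_sqrt (by have := hs.nonneg v; positivity)

lemma normSS_sq (hε : IsMaterial D ε) (hν : IsMaterial D ν)
    (hs : M.IsStabilization k s) (v : M.V k) :
    M.normSS ε ν ω k ℓ s v ^ 2 = M.bssPlus ε ν ω k ℓ s v v := by
  rw [M.normSS_sq_eq_add hs, hε.wNorm_sq, hν.wNorm_sq, bssPlus]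

lemma bssPlus_comm (hε : IsMaterial D ε) (hν : IsMaterial D ν)
    (hs : M.IsStabilization k s) (v w : M.V k) :
    M.bssPlus ε ν ω k ℓ s v w = M.bssPlus ε ν ω k ℓ s w v := by
  rw [bssPlus, bssPlus, hε.wInner_comm, hν.wInner_comm, hs.symm]

lemma incl_add (p q : M.P k) : M.incl k (p + q) = M.incl k p + M.incl k q :=
  Subtype.ext (map_add M.toL2 p.1 q.1)

lemma incl_sub (p q : M.P k) : M.incl k (p - q) = M.incl k p - M.incl k q :=
  Subtype.ext (map_sub M.toL2 p.1 q.1)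

/-- The inclusion of the discrete space in `V_♯`, as a linear map. -/
noncomputable def inclL (k : ℕ) : M.P k →ₗ[ℝ] M.V k where
  toFun := M.incl k
  map_add' := M.incl_add
  map_smul' c p := Subtype.ext (map_smul M.toL2 c p.1)

/-- A discrete field whose augmented norm vanishes is zero. -/
lemma eq_zero_of_normSS_eq_zero (hD : IsLipschitzDomain D) (hε : IsMaterial D ε)
    (hs : M.IsStabilization k s) (hω : 0 < ω) {p : M.P k}
    (h : M.normSS ε ν ω k ℓ s (M.incl k p) = 0) : p = 0 := by
  have h1 := M.normSS_sq_eq_add (ε := ε) (ν := ν) (ω := ω) (ℓ := ℓ) hs (M.incl k p)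
  rw [h] at h1
  have h2 : ω ^ 2 * wNorm ε (M.incl k p).1 ^ 2 = 0 := by
    have := hs.nonneg (M.incl k p)
    have := sq_nonneg (wNorm ν (M.dCurlV k ℓ (M.incl k p)))
    have : 0 ≤ ω ^ 2 * wNorm ε (M.incl k p).1 ^ 2 := by positivity
    linarith
  have h3 : wInner ε (M.toL2 p) (M.toL2 p) = 0 := by
    rw [← hε.wNorm_sq]
    exact (mul_eq_zero.1 h2).resolve_left (by positivity)
  have h4 := hε.eq_zero_of_wInner_self h3
  refine Subtype.ext (M.toL2_injective hD ?_)
  rw [h4]; exact (map_zero _).symm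

lemma isBest_best (hD : IsLipschitzDomain D) (hε : IsMaterial D ε) (hν : IsMaterial D ν)
    (hs : M.IsStabilization k s) (hω : 0 < ω) (v : M.V k) :
    M.IsBest ε ν ω k ℓ s v (M.best ε ν ω k ℓ s v) := by
  have hex : ∃ B, M.IsBest ε ν ω k ℓ s v B := by
    let Q := M.formSS hD hε hν k ℓ s (ω ^ 2)
    obtain ⟨B, hB⟩ := exists_representative (Q.compl₁₂ (M.inclL k) (M.inclL k))
      (fun p hp => by
        refine M.eq_zero_of_normSS_eq_zero (ε := ε) (ν := ν) (ℓ := ℓ) hD hε hs hω ?_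
        have := M.normSS_sq (ω := ω) (ℓ := ℓ) hε hν hs (M.incl k p)
        rw [M.bssPlus_eq hD hε hν] at this
        rw [← sq_eq_zero_iff, this]
        exact hp p)
      ((Q v).comp (M.inclL k))
    refine ⟨B, fun w => ?_⟩
    rw [M.bssPlus_eq hD hε hν, map_sub, LinearMap.sub_apply, sub_eq_zero]
    exact (hB w).symm
  rw [best, dif_pos hex]
  exact hex.choose_spec

/-! ### Consistency -/

lemma nc_conforming (hD : IsLipschitzDomain D) (hν : IsMaterial D ν) (ℓ : ℕ) {q : M.Broken}
    (hq : q ∈ M.Pc0 k) : M.nc ν k ℓ q = 0 := by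
  refine le_antisymm ?_ (M.nc_nonneg k ℓ q)
  refine (M.nc_le k ℓ q ⟨q, hq⟩).trans (le_of_eq ?_)
  have := M.normE_smul hD hν ℓ le_rfl (0 : M.Broken)
  rwa [zero_smul, zero_mul, ← sub_self q] at this

/-- Tested with a discrete field, the error only sees the conformity defect of this field. -/
lemma bss_error (hD : IsLipschitzDomain D) (hε : IsMaterial D ε) (hν : IsMaterial D ν)
    (hs : M.IsStabilization k s) {J : L2 D} {E : H0curl D} {Eh : M.P k}
    (hE : SolvesWeak ε ν ω J E) (hEh : M.SolvesDiscrete ε ν ω k ℓ s J Eh) (w : M.P k) :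
    M.bss ε ν ω k ℓ s (M.inclH k E - M.incl k Eh) (M.incl k w)
      = ⟪mul ν (curl (E : L2 D)), M.toL2 (M.dCurl ℓ w)⟫
        - ⟪curl (mul ν (curl (E : L2 D))), M.toL2 w⟫ := by
  have h1 := (hasWeakCurl_mul_curl hD.isOpen hε hν hE.2).curl_eq hD.isOpen
  have h2 := hEh w
  rw [M.bss_eq hD hε hν] at h2 ⊢
  rw [map_sub, LinearMap.sub_apply, h2, ← M.bss_eq hD hε hν, bss, M.dCurlV_inclH hD,
    M.dCurlV_incl hD, hs.ker_left, h1, inner_add_left, hν.wInner_eq, hν.op_apply,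
    real_inner_smul_left, hε.wInner_eq, hε.op_apply]
  simp only [inclH, incl]
  ring

/-- The Galerkin orthogonality for conforming fields. -/
lemma bss_error_conforming (hD : IsLipschitzDomain D) (hε : IsMaterial D ε) (hν : IsMaterial D ν)
    (hs : M.IsStabilization k s) {J : L2 D} {E : H0curl D} {Eh : M.P k}
    (hE : SolvesWeak ε ν ω J E) (hEh : M.SolvesDiscrete ε ν ω k ℓ s J Eh) {q : M.P k}
    (hq : M.toL2 q ∈ H0curl D) :
    M.bss ε ν ω k ℓ s (M.inclH k E - M.incl k Eh) (M.incl k q) = 0 := by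
  have h := M.abs_defect_le hD hν k ℓ ⟨_, hasWeakCurl_mul_curl hD.isOpen hε hν hE.2⟩ q.1
  rw [M.nc_conforming hD hν ℓ ⟨q.2, hq⟩, mul_zero, ← M.bss_error hD hε hν hs hE hEh] at h
  exact abs_nonpos_iff.1 h

/-- The error, tested with the data of an adjoint problem. -/
lemma wInner_error_eq (hD : IsLipschitzDomain D) (hε : IsMaterial D ε) (hν : IsMaterial D ν)
    (hs : M.IsStabilization k s) {θ : L2 D} {ζ : H0curl D} (hζ : SolvesAdjoint ε ν ω θ ζ)
    (E : H0curl D) (p : M.P k) :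
    wInner ε (M.inclH k E - M.incl k p).1 θ
      = M.bss ε ν ω k ℓ s (M.inclH k E - M.incl k p) (M.inclH k ζ)
        + (⟪mul ν (curl (ζ : L2 D)), M.toL2 (M.dCurl ℓ p)⟫
          - ⟪curl (mul ν (curl (ζ : L2 D))), M.toL2 p⟫) := by
  have h1 := (hζ.hasWeakCurl hD.isOpen hε hν).curl_eq hD.isOpen
  have h2 := hζ.2 E E.2
  have h3 : wInner ε (M.inclH k E - M.incl k p).1 θ = wInner ε E θ - wInner ε (M.toL2 p) θ :=
    hε.wInner_sub_left _ _ _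
  rw [h3, ← h2, M.bss_eq hD hε hν, map_sub, LinearMap.sub_apply, ← M.bss_eq hD hε hν,
    ← M.bss_eq hD hε hν, bss, bss, M.dCurlV_inclH hD, M.dCurlV_inclH hD, M.dCurlV_incl hD,
    hs.ker_right, hs.ker_right, h1, inner_add_left, real_inner_smul_left, ← hε.op_apply,
    ← hε.op_apply, ← hν.op_apply, ← hε.wInner_eq, ← hε.wInner_eq, ← hν.wInner_eq, bForm,
    hε.wInner_comm θ, hε.wInner_comm ζ, hν.wInner_comm (curl ζ)]
  simp only [inclH, incl]
  ring

/-- The Cauchy-Schwarz inequality for `b_♯♯` and a conforming field. -/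
lemma abs_bss_inclH_le (hD : IsLipschitzDomain D) (hε : IsMaterial D ε) (hν : IsMaterial D ν)
    (hs : M.IsStabilization k s) (v : M.V k) (z : H0curl D) :
    |M.bss ε ν ω k ℓ s v (M.inclH k z)|
      ≤ Real.sqrt (ω ^ 2 * wNorm ε v.1 ^ 2 + wNorm ν (M.dCurlV k ℓ v) ^ 2)
        * energyNorm ε ν ω (z : L2 D) := by
  rw [bss, hs.ker_right, add_zero, M.dCurlV_inclH hD, energyNorm,
    ← Real.sqrt_mul (by positivity)]
  refine Real.le_sqrt_of_sq_le ?_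
  have h1 := hε.abs_wInner_le v.1 z
  have h2 := hν.abs_wInner_le (M.dCurlV k ℓ v) (curl z)
  have h3 : |-ω ^ 2 * wInner ε v.1 (M.inclH k z).1 + wInner ν (M.dCurlV k ℓ v) (curl z)|
      ≤ ω ^ 2 * (wNorm ε v.1 * wNorm ε (z : L2 D))
        + wNorm ν (M.dCurlV k ℓ v) * wNorm ν (curl (z : L2 D)) := by
    refine (abs_add_le _ _).trans (add_le_add ?_ h2)
    rw [abs_mul, abs_neg, abs_of_nonneg (sq_nonneg ω)]
    exact mul_le_mul_of_nonneg_left h1 (sq_nonneg ω)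
  refine (pow_le_pow_left₀ (abs_nonneg _) h3 2).trans ?_
  nlinarith [sq_nonneg (ω * (wNorm ε v.1 * wNorm ν (curl (z : L2 D))
    - wNorm ν (M.dCurlV k ℓ v) * wNorm ε (z : L2 D)))]

/-! ### The approximation factors and the divergence conformity factor -/

lemma lt_ofReal_toReal_add {a b : ℝ≥0∞} (ha : a ≠ ⊤) (hb : b ≤ a) {δ : ℝ} (hδ : 0 < δ) :
    b < ENNReal.ofReal (a.toReal + δ) := by
  rw [ENNReal.ofReal_add ENNReal.toReal_nonneg hδ.le, ENNReal.ofReal_toReal ha]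
  exact hb.trans_lt (ENNReal.lt_add_right ha (by simpa using hδ))

/-- If the primal factor is finite, almost optimal approximations of adjoint solutions exist. -/
lemma exists_approx_of_gammaP (hP : M.gammaP ε ν ω k ≠ ⊤) {θ : L2 D} (hθ : IsPerp0 ε θ)
    (h1 : wNorm ε θ = 1) {δ : ℝ} (hδ : 0 < δ) :
    ∃ ζ, SolvesAdjoint ε ν ω θ ζ ∧ ∃ v ∈ M.Pc0 k,
      ω * energyNorm ε ν ω (ζ - M.toL2 v) < (M.gammaP ε ν ω k).toReal + δ := by
  have h := le_iSup_of_le (f := fun θ : L2 D => ⨆ (_ : IsPerp0 ε θ) (_ : wNorm ε θ = 1),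
    ⨅ (ζ : L2 D) (_ : SolvesAdjoint ε ν ω θ ζ), ⨅ v ∈ M.Pc0 k,
      ENNReal.ofReal (ω * energyNorm ε ν ω (ζ - M.toL2 v))) θ
    (le_iSup_of_le hθ (le_iSup_of_le h1 le_rfl))
  have h2 := lt_ofReal_toReal_add hP h hδ
  simp only [iInf_lt_iff] at h2
  obtain ⟨ζ, hζ, v, hv, hlt⟩ := h2
  exact ⟨ζ, hζ, v, hv, (ENNReal.ofReal_lt_ofReal_iff (by positivity)).1 hlt⟩

/-- If the dual factor is finite, almost optimal approximations of the curl of adjoint solutions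
exist. -/
lemma exists_approx_of_gammaD (hQ : M.gammaD ε ν ω ℓ ≠ ⊤) {θ : L2 D} (hθ : IsPerp0 ε θ)
    (h1 : wNorm ε θ = 1) {δ : ℝ} (hδ : 0 < δ) :
    ∃ ζ, SolvesAdjoint ε ν ω θ ζ ∧ ∃ Φ ∈ M.Pc ℓ,
      ω * M.normH ν (mul ν (curl ζ) - M.toL2 Φ) < (M.gammaD ε ν ω ℓ).toReal + δ := by
  have h := le_iSup_of_le (f := fun θ : L2 D => ⨆ (_ : IsPerp0 ε θ) (_ : wNorm ε θ = 1),
    ⨅ (ζ : L2 D) (_ : SolvesAdjoint ε ν ω θ ζ), ⨅ Φ ∈ M.Pc ℓ,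
      ENNReal.ofReal (ω * M.normH ν (mul ν (curl ζ) - M.toL2 Φ))) θ
    (le_iSup_of_le hθ (le_iSup_of_le h1 le_rfl))
  have h2 := lt_ofReal_toReal_add hQ h hδ
  simp only [iInf_lt_iff] at h2
  obtain ⟨ζ, hζ, v, hv, hlt⟩ := h2
  exact ⟨ζ, hζ, v, hv, (ENNReal.ofReal_lt_ofReal_iff (by positivity)).1 hlt⟩

/-- The bound that defines the divergence conformity factor, without normalization. -/
lemma wNorm_proj0_le_of_gammaDiv (hD : IsLipschitzDomain D) (hε : IsMaterial D ε)
    (hν : IsMaterial D ν) (hω : 0 < ω) (hdiv : M.gammaDiv ε ν ω k ℓ ≠ ⊤) {p : M.Broken}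
    (hp : p ∈ M.X ε k) :
    ω * wNorm ε (proj0 ε (M.toL2 p)) ≤ (M.gammaDiv ε ν ω k ℓ).toReal
      * Real.sqrt (wNorm ν (M.toL2 (M.dCurl ℓ p)) ^ 2 + M.nc ν k ℓ p ^ 2) := by
  set N := Real.sqrt (wNorm ν (M.toL2 (M.dCurl ℓ p)) ^ 2 + M.nc ν k ℓ p ^ 2)
  have hN2 : N ^ 2 = wNorm ν (M.toL2 (M.dCurl ℓ p)) ^ 2 + M.nc ν k ℓ p ^ 2 :=
    Real.sq_sqrt (by positivity)
  have hN0 : 0 ≤ N := Real.sqrt_nonneg _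
  rcases hN0.eq_or_lt with h0 | h0
  · -- a conforming curl-free field that is orthogonal to all such fields is zero
    rw [← h0] at hN2
    have hc : wNorm ν (M.toL2 (M.dCurl ℓ p)) ^ 2 = 0 := by
      linarith [sq_nonneg (wNorm ν (M.toL2 (M.dCurl ℓ p))), sq_nonneg (M.nc ν k ℓ p)]
    have hn : M.nc ν k ℓ p = 0 := by
      rw [← sq_eq_zero_iff]
      linarith [sq_nonneg (wNorm ν (M.toL2 (M.dCurl ℓ p))), sq_nonneg (M.nc ν k ℓ p)]
    have h1 := M.mem_H0curl_of_nc_eq_zero hD hν k ℓ hn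
    rw [hν.wNorm_sq] at hc
    have h2 := hν.eq_zero_of_wInner_self hc
    rw [M.toL2_dCurl_of_conforming hD ℓ h1] at h2
    have h3 : M.toL2 p ∈ H0curl0 D :=
      ⟨h1, h2 ▸ hasWeakCurl_curl (mem_Hcurl_of_mem_H0curl h1)⟩
    have h4 := hε.eq_zero_of_wInner_self (hp.2 p hp.1 h3)
    rw [proj0_eq_self hD.isOpen hε h3, h4, hε.wNorm_zero, ← h0, mul_zero, mul_zero]
  · have hNi : 0 ≤ N⁻¹ := inv_nonneg.2 h0.le
    have hmem : N⁻¹ • p ∈ M.X ε k := by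
      refine ⟨Submodule.smul_mem _ _ hp.1, fun q hq hq0 => ?_⟩
      rw [map_smul, hε.wInner_smul_left, hp.2 q hq hq0, mul_zero]
    have hone : wNorm ν (M.toL2 (M.dCurl ℓ (N⁻¹ • p))) ^ 2 + M.nc ν k ℓ (N⁻¹ • p) ^ 2 = 1 := by
      rw [M.dCurl_smul hD, map_smul, hν.wNorm_smul hNi, M.nc_smul hD hν k ℓ (inv_pos.2 h0),
        mul_pow, mul_pow, ← mul_add, ← hN2, ← mul_pow, inv_mul_cancel₀ h0.ne', one_pow]
    have h := le_iSup_of_le (f := fun p : M.Broken => ⨆ (_ : p ∈ M.X ε k)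
      (_ : wNorm ν (M.toL2 (M.dCurl ℓ p)) ^ 2 + M.nc ν k ℓ p ^ 2 = 1),
        ENNReal.ofReal (ω * wNorm ε (proj0 ε (M.toL2 p)))) (N⁻¹ • p)
      (le_iSup_of_le hmem (le_iSup_of_le hone le_rfl))
    have h5 : ω * wNorm ε (proj0 ε (M.toL2 (N⁻¹ • p))) ≤ (M.gammaDiv ε ν ω k ℓ).toReal :=
      (ENNReal.ofReal_le_iff_le_toReal hdiv).1 h
    rw [map_smul, proj0_smul hD.isOpen hε, hε.wNorm_smul hNi] at h5
    calc ω * wNorm ε (proj0 ε (M.toL2 p))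
        = ω * (N⁻¹ * wNorm ε (proj0 ε (M.toL2 p))) * N := by
          have := h0.ne'
          field_simp
      _ ≤ _ := mul_le_mul_of_nonneg_right h5 h0.le

/-! ### The error estimate -/

/-- The Aubin-Nitsche argument: the part of the error that is orthogonal to the curl-free fields
is controlled by the approximation factors. -/
lemma wNorm_error_perp_le (hD : IsLipschitzDomain D) (hε : IsMaterial D ε) (hν : IsMaterial D ν)
    (hω : 0 < ω) (hres : NonResonant D ε ν ω) (hs : M.IsStabilization k s) (hρ : 0 < ρ)
    (hctrl : ∀ v : M.P k, ρ * M.nc ν k ℓ v ≤ Real.sqrt (s (M.incl k v) (M.incl k v)))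
    (hP : M.gammaP ε ν ω k ≠ ⊤) (hQ : M.gammaD ε ν ω ℓ ≠ ⊤)
    {J : L2 D} {E : H0curl D} {Eh : M.P k}
    (hE : SolvesWeak ε ν ω J E) (hEh : M.SolvesDiscrete ε ν ω k ℓ s J Eh) {e : M.V k}
    (he : e = M.inclH k E - M.incl k Eh) :
    ω * wNorm ε (e.1 - proj0 ε e.1)
      ≤ (M.gammaP ε ν ω k).toReal
          * Real.sqrt (ω ^ 2 * wNorm ε e.1 ^ 2 + wNorm ν (M.dCurlV k ℓ e) ^ 2)
        + ρ⁻¹ * (M.gammaD ε ν ω ℓ).toReal * Real.sqrt (s e e) := by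
  set a := Real.sqrt (ω ^ 2 * wNorm ε e.1 ^ 2 + wNorm ν (M.dCurlV k ℓ e) ^ 2)
  have ha : 0 ≤ a := Real.sqrt_nonneg _
  have hsn : 0 ≤ Real.sqrt (s e e) := Real.sqrt_nonneg _
  set t := wNorm ε (e.1 - proj0 ε e.1) with ht
  have ht0 : 0 ≤ t := wNorm_nonneg _
  rcases ht0.eq_or_lt with h0 | h0
  · rw [← h0, mul_zero]; positivity
  set θ := t⁻¹ • (e.1 - proj0 ε e.1) with hθdef
  have hθ : IsPerp0 ε θ := fun w hw => by
    rw [hθdef, hε.wInner_smul_left, isPerp0_sub_proj0 hD.isOpen hε e.1 w hw, mul_zero]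
  have hθ1 : wNorm ε θ = 1 := by
    rw [hθdef, hε.wNorm_smul (inv_nonneg.2 h0.le), ← ht, inv_mul_cancel₀ h0.ne']
  have hpair : wInner ε e.1 θ = t := by
    have h1 := wInner_sub_proj0_right hD.isOpen hε (isPerp0_sub_proj0 hD.isOpen hε e.1) e.1
    rw [← hε.wNorm_sq, ← ht] at h1
    rw [hθdef, hε.wInner_smul_right, hε.wInner_comm, ← h1]
    field_simp
  have hse : s e e = s (M.incl k Eh) (M.incl k Eh) := by
    rw [he, map_sub, hs.ker_right, map_sub, LinearMap.sub_apply, hs.ker_left]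
    ring
  have hnc : M.nc ν k ℓ Eh ≤ ρ⁻¹ * Real.sqrt (s e e) := by
    rw [hse, inv_mul_eq_div, le_div_iff₀ hρ, mul_comm]; exact hctrl Eh
  have key (δ : ℝ) (hδ : 0 < δ) : ω * t ≤ a * ((M.gammaP ε ν ω k).toReal + δ)
      + (ρ⁻¹ * Real.sqrt (s e e)) * ((M.gammaD ε ν ω ℓ).toReal + δ) := by
    obtain ⟨ζ, hζ, v, hv, hlt⟩ := M.exists_approx_of_gammaP hP hθ hθ1 hδ
    obtain ⟨ζ', hζ', Φ, hΦ, hlt'⟩ := M.exists_approx_of_gammaD hQ hθ hθ1 hδ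
    -- both approximations concern the same field, the only adjoint solution
    obtain rfl := hζ.unique hD.isOpen hε hν hres hζ'
    let ζ0 : H0curl D := ⟨ζ, hζ.1⟩
    let v0 : H0curl D := ⟨M.toL2 v, hv.2⟩
    have h1 := M.wInner_error_eq (ℓ := ℓ) (ζ := ζ0) hD hε hν hs hζ E Eh
    rw [← he, hpair] at h1
    -- by Galerkin orthogonality, `v` can be subtracted from the adjoint solution
    have h2 : M.bss ε ν ω k ℓ s e (M.inclH k ζ0) = M.bss ε ν ω k ℓ s e (M.inclH k (ζ0 - v0)) := by
      have h3 : M.bss ε ν ω k ℓ s e (M.inclH k v0) = 0 := by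
        rw [he]
        exact M.bss_error_conforming (q := ⟨v, hv.1⟩) hD hε hν hs hE hEh hv.2
      have h4 : M.inclH k (ζ0 - v0) = M.inclH k ζ0 - M.inclH k v0 := rfl
      rw [h4, M.bss_eq hD hε hν, M.bss_eq hD hε hν, map_sub, ← M.bss_eq hD hε hν,
        ← M.bss_eq hD hε hν, h3, sub_zero]
    have h5 := M.abs_bss_inclH_le (ω := ω) (ℓ := ℓ) hD hε hν hs e (ζ0 - v0)
    have h6 := M.abs_defect_le hD hν k ℓ ⟨_, hζ.hasWeakCurl hD.isOpen hε hν⟩ Eh.1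
    have h7 := M.distH_le (ν := ν) ℓ (mul ν (curl ζ)) ⟨Φ, hΦ⟩
    rw [h2] at h1
    have h8 : t ≤ a * energyNorm ε ν ω (ζ - M.toL2 v)
        + M.normH ν (mul ν (curl ζ) - M.toL2 Φ) * (ρ⁻¹ * Real.sqrt (s e e)) := by
      rw [h1]
      refine add_le_add ((le_abs_self _).trans h5) ((le_abs_self _).trans (h6.trans ?_))
      exact mul_le_mul h7 hnc (M.nc_nonneg k ℓ Eh) (M.normH_nonneg _)
    calc ω * t ≤ ω * (a * energyNorm ε ν ω (ζ - M.toL2 v)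
          + M.normH ν (mul ν (curl ζ) - M.toL2 Φ) * (ρ⁻¹ * Real.sqrt (s e e))) := by gcongr
      _ = a * (ω * energyNorm ε ν ω (ζ - M.toL2 v))
          + (ρ⁻¹ * Real.sqrt (s e e)) * (ω * M.normH ν (mul ν (curl ζ) - M.toL2 Φ)) := by ring
      _ ≤ _ := by gcongr
  refine le_of_forall_pos_le_add fun δ hδ => ?_
  have hpos : 0 < a + ρ⁻¹ * Real.sqrt (s e e) + 1 := by positivity
  have h := key (δ / (a + ρ⁻¹ * Real.sqrt (s e e) + 1)) (by positivity)
  have h2 : (a + ρ⁻¹ * Real.sqrt (s e e)) * (δ / (a + ρ⁻¹ * Real.sqrt (s e e) + 1)) ≤ δ := by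
    rw [mul_div_assoc', div_le_iff₀ hpos]
    nlinarith
  nlinarith

/-- The discrete orthogonal splitting: a discrete field is the sum of a conforming curl-free
discrete field and a field that is orthogonal to all such fields. -/
lemma exists_splitting (hD : IsLipschitzDomain D) (hε : IsMaterial D ε) (w : M.P k) :
    ∃ w0 : M.P k, M.toL2 w0 ∈ H0curl0 D ∧ (w - w0).1 ∈ M.X ε k := by
  let W : Submodule ℝ (M.P k) := (kernel0 D).comap (M.toL2 ∘ₗ (M.P k).subtype)
  let T : M.P k →ₗ[ℝ] L2 D := M.toL2 ∘ₗ (M.P k).subtype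
  let B : LinearMap.BilinForm ℝ W := hε.form.compl₁₂ (T ∘ₗ W.subtype) (T ∘ₗ W.subtype)
  have hB (a b : W) : B a b = wInner ε (M.toL2 a.1.1) (M.toL2 b.1.1) := rfl
  let f : W →ₗ[ℝ] ℝ := (hε.form (M.toL2 w.1)).comp (T ∘ₗ W.subtype)
  have hf (b : W) : f b = wInner ε (M.toL2 w.1) (M.toL2 b.1.1) := rfl
  have hnd (v : W) (hv : ∀ b, B v b = 0) : v = 0 := by
    have h := hv v
    rw [hB] at h
    have h0 : M.toL2 v.1.1 = M.toL2 0 := (hε.eq_zero_of_wInner_self h).trans (map_zero _).symm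
    exact Subtype.ext (Subtype.ext (M.toL2_injective hD h0))
  obtain ⟨w0, hw0⟩ := exists_representative (W := W) B hnd f
  refine ⟨w0.1, (mem_kernel0_iff hD.isOpen).1 w0.2, (w - w0.1).2, fun q hq hq0 => ?_⟩
  have h := hw0 ⟨⟨q, hq⟩, (mem_kernel0_iff hD.isOpen).2 hq0⟩
  rw [hB, hf] at h
  have h2 : M.toL2 (w - w0.1).1 = M.toL2 w.1 - M.toL2 w0.1.1 := map_sub M.toL2 w.1 w0.1.1
  rw [h2, hε.wInner_sub_left, h, sub_self]

/-- The error is the sum of the best-approximation error and a discrete field, orthogonal to each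
other. -/
lemma normSS_sq_error (hD : IsLipschitzDomain D) (hε : IsMaterial D ε) (hν : IsMaterial D ν)
    (hs : M.IsStabilization k s) {η : M.V k} {w : M.P k}
    (horth : M.bssPlus ε ν ω k ℓ s η (M.incl k w) = 0) :
    M.normSS ε ν ω k ℓ s (η + M.incl k w) ^ 2
      = M.normSS ε ν ω k ℓ s η ^ 2 + M.normSS ε ν ω k ℓ s (M.incl k w) ^ 2 := by
  have h2 := M.bssPlus_comm (ω := ω) (ℓ := ℓ) hε hν hs (M.incl k w) η
  rw [horth] at h2
  rw [M.normSS_sq hε hν hs, M.normSS_sq hε hν hs, M.normSS_sq hε hν hs]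
  rw [M.bssPlus_eq hD hε hν] at horth h2 ⊢
  rw [M.bssPlus_eq hD hε hν, M.bssPlus_eq hD hε hν, map_add, map_add, LinearMap.add_apply,
    LinearMap.add_apply, horth, h2]
  ring

/-- The product of the error with its discrete part. The discrete part is split into a conforming
curl-free field, to which the error is orthogonal, and a field that the divergence conformity
factor controls. -/
lemma discrete_error_pairing_le (hD : IsLipschitzDomain D) (hε : IsMaterial D ε)
    (hν : IsMaterial D ν) (hω : 0 < ω) (hs : M.IsStabilization k s) (hρ : 0 < ρ)
    (hctrl : ∀ v : M.P k, ρ * M.nc ν k ℓ v ≤ Real.sqrt (s (M.incl k v) (M.incl k v)))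
    (hdiv : M.gammaDiv ε ν ω k ℓ ≠ ⊤) {e η : M.V k} {w : M.P k} (he : e = η + M.incl k w)
    (hgal : ∀ q : M.P k, M.toL2 q ∈ H0curl D → M.bss ε ν ω k ℓ s e (M.incl k q) = 0) :
    4 * (ω ^ 2 * wInner ε e.1 (M.toL2 w)) ≤ 4 * (ω * wNorm ε (e.1 - proj0 ε e.1)) ^ 2
      + M.normSS ε ν ω k ℓ s (M.incl k w) ^ 2
      + 4 * (M.gammaDiv ε ν ω k ℓ).toReal * M.normSS ε ν ω k ℓ s η ^ 2
      + max 1 (ρ⁻¹ ^ 2) * ((M.gammaDiv ε ν ω k ℓ).toReal + 3 * (M.gammaDiv ε ν ω k ℓ).toReal ^ 2)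
        * M.normSS ε ν ω k ℓ s (M.incl k w) ^ 2 := by
  have hDo := hD.isOpen
  obtain ⟨w0, hw0, hx⟩ := M.exists_splitting hD hε w
  have hwx : M.toL2 w = M.toL2 w0 + M.toL2 (w - w0).1 := by
    rw [← map_add]; congr 1; exact (add_sub_cancel w0.1 w.1).symm
  have hcw0 : M.toL2 (M.dCurl ℓ w0) = 0 := by
    rw [M.toL2_dCurl_of_conforming hD ℓ hw0.1]; exact hw0.2.curl_eq hDo
  set u := M.toL2 w.1 with hu
  set u0 := M.toL2 w0.1
  set x := M.toL2 (w - w0).1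
  set θ := e.1 - proj0 ε e.1
  have hθ : IsPerp0 ε θ := isPerp0_sub_proj0 hDo hε e.1
  set W := M.normSS ε ν ω k ℓ s (M.incl k w) with hW
  set H := M.normSS ε ν ω k ℓ s η with hH
  set g := (M.gammaDiv ε ν ω k ℓ).toReal
  have hg : 0 ≤ g := ENNReal.toReal_nonneg
  have hW0 : 0 ≤ W := M.normSS_nonneg _
  have hH0 : 0 ≤ H := M.normSS_nonneg _
  have hW2 := M.normSS_sq_eq_add (ε := ε) (ν := ν) (ω := ω) (ℓ := ℓ) hs (M.incl k w)
  have hH2 := M.normSS_sq_eq_add (ε := ε) (ν := ν) (ω := ω) (ℓ := ℓ) hs η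
  rw [← hW, M.dCurlV_incl hD] at hW2
  rw [← hH] at hH2
  have hW2' : W ^ 2 = ω ^ 2 * wNorm ε u ^ 2 + wNorm ν (M.toL2 (M.dCurl ℓ w)) ^ 2
    + s (M.incl k w) (M.incl k w) := hW2
  have hsw := hs.nonneg (M.incl k w)
  have hsη := hs.nonneg η
  -- the error is orthogonal to `w0`
  have hew0 : wInner ε e.1 u0 = 0 := by
    have h1 := hgal w0 hw0.1
    have h2 : M.incl k w0 = M.inclH k ⟨u0, hw0.1⟩ := rfl
    have h3 : (M.incl k w0).1 = u0 := rfl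
    rw [bss, M.dCurlV_incl hD, hcw0, h3, h2, hs.ker_right] at h1
    have h4 : wInner ν (M.dCurlV k ℓ e) 0 = 0 := by rw [← hν.form_apply, map_zero]
    rw [h4, add_zero, add_zero] at h1
    exact (mul_eq_zero.1 h1).resolve_left (by have := hω.ne'; simpa using this)
  have hxu0 : wInner ε x u0 = 0 := hx.2 w0 w0.2 hw0
  have hpu : proj0 ε u = u0 + proj0 ε x := by
    rw [hwx, proj0_add hDo hε, proj0_eq_self hDo hε hw0]
  have hu0px : wInner ε u0 (proj0 ε x) = 0 := by
    rw [hε.wInner_comm, wInner_proj0_left hDo hε x hw0, hxu0]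
  -- `w0` is orthogonal to `θ`, to `e` and to the projection of `x`
  have hpair : wInner ε e.1 u = wInner ε θ (u - proj0 ε u)
      + (wInner ε (proj0 ε η.1) (proj0 ε x) + wNorm ε (proj0 ε x) ^ 2) := by
    have h1 : wInner ε e.1 u = wInner ε e.1 x := by rw [hwx, hε.wInner_add_right, hew0, zero_add]
    have h2 : wInner ε e.1 x = wInner ε θ x + wInner ε (proj0 ε e.1) x := by
      rw [← hε.wInner_add_left, sub_add_cancel]
    have h3 : wInner ε θ x = wInner ε θ (u - proj0 ε u) := by
      rw [wInner_sub_proj0_right hDo hε hθ, hwx, hε.wInner_add_right, hθ _ hw0, zero_add]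
    have h4 : wInner ε (proj0 ε e.1) x = wInner ε (proj0 ε e.1) (proj0 ε x) := by
      rw [hε.wInner_comm, ← wInner_proj0_left hDo hε x (isProj0_proj0 hDo hε e.1).1,
        hε.wInner_comm]
    have h5 : proj0 ε e.1 = proj0 ε η.1 + (u0 + proj0 ε x) := by
      rw [← hpu, he, ← proj0_add hDo hε]; rfl
    rw [h1, h2, h3, h4, h5, hε.wInner_add_left, hε.wInner_add_left, hu0px, zero_add,
      ← hε.wNorm_sq]
  have hpyth : wNorm ε u ^ 2
      = wNorm ε u0 ^ 2 + wNorm ε (proj0 ε x) ^ 2 + wNorm ε (u - proj0 ε u) ^ 2 := by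
    rw [wNorm_sq_eq_proj0_add hDo hε u]
    congr 1
    rw [hpu, hε.wNorm_sq, hε.wNorm_sq, hε.wNorm_sq, hε.wInner_add_left, hε.wInner_add_right,
      hε.wInner_add_right, hu0px, hε.wInner_comm (proj0 ε x) u0, hu0px]
    ring
  -- `x` has the same discrete curl as `w` and is not less conforming
  set m := Real.sqrt (max 1 (ρ⁻¹ ^ 2)) with hm
  have hm0 : 0 ≤ m := Real.sqrt_nonneg _
  have hm2 : m ^ 2 = max 1 (ρ⁻¹ ^ 2) := Real.sq_sqrt (le_max_of_le_left zero_le_one)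
  have hdx : ω * wNorm ε (proj0 ε x) ≤ g * (m * W) := by
    refine (M.wNorm_proj0_le_of_gammaDiv hD hε hν hω hdiv hx).trans ?_
    refine mul_le_mul_of_nonneg_left ?_ hg
    refine Real.sqrt_le_iff.2 ⟨by positivity, ?_⟩
    have h1 : M.toL2 (M.dCurl ℓ (w - w0).1) = M.toL2 (M.dCurl ℓ w) := by
      have : M.dCurl ℓ (w - w0).1 = M.dCurl ℓ w - M.dCurl ℓ w0 := M.dCurl_sub hD ℓ _ _
      rw [this, map_sub, hcw0, sub_zero]
    have h2 : M.nc ν k ℓ (w - w0).1 ≤ M.nc ν k ℓ w :=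
      M.nc_sub_conforming_le k ℓ w.1 ⟨w0.2, hw0.1⟩
    have h3 : M.nc ν k ℓ w ^ 2 ≤ ρ⁻¹ ^ 2 * s (M.incl k w) (M.incl k w) := by
      have h := pow_le_pow_left₀ (mul_nonneg hρ.le (M.nc_nonneg k ℓ w.1)) (hctrl w) 2
      rw [Real.sq_sqrt hsw, mul_pow] at h
      rw [inv_pow, inv_mul_eq_div, le_div_iff₀ (by positivity), mul_comm]
      exact h
    have h4 := pow_le_pow_left₀ (M.nc_nonneg k ℓ _) h2 2
    have h5 : ρ⁻¹ ^ 2 ≤ m ^ 2 := hm2 ▸ le_max_right _ _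
    have h6 : 1 ≤ m ^ 2 := hm2 ▸ le_max_left _ _
    rw [h1, mul_pow, hW2']
    have h7 := mul_le_mul_of_nonneg_right h5 hsw
    have h8 := mul_le_mul_of_nonneg_right h6 (sq_nonneg (wNorm ν (M.toL2 (M.dCurl ℓ w))))
    have h9 : 0 ≤ m ^ 2 * (ω ^ 2 * wNorm ε u ^ 2) := by positivity
    linarith
  have hdη : ω * wNorm ε (proj0 ε η.1) ≤ H := by
    refine (mul_le_mul_of_nonneg_left (wNorm_proj0_le hDo hε η.1) hω.le).trans ?_
    refine le_of_sq_le_sq ?_ hH0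
    rw [hH2, mul_pow]
    linarith [sq_nonneg (wNorm ν (M.dCurlV k ℓ η))]
  have hc1 := (le_abs_self _).trans (hε.abs_wInner_le θ (u - proj0 ε u))
  have hc2 := (le_abs_self _).trans (hε.abs_wInner_le (proj0 ε η.1) (proj0 ε x))
  have hx0 : 0 ≤ ω * wNorm ε (proj0 ε x) := mul_nonneg hω.le (wNorm_nonneg _)
  have hη0 : 0 ≤ ω * wNorm ε (proj0 ε η.1) := mul_nonneg hω.le (wNorm_nonneg _)
  rw [← hm2, hpair]
  set X := ω * wNorm ε (proj0 ε x) with hX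
  set Y := ω * wNorm ε (proj0 ε η.1) with hY
  set T := ω * wNorm ε θ with hT
  set Z := ω * wNorm ε (u - proj0 ε u) with hZ
  have e1 : ω ^ 2 * wInner ε θ (u - proj0 ε u) ≤ T * Z := by
    have := mul_le_mul_of_nonneg_left hc1 (sq_nonneg ω)
    rw [hT, hZ]; linarith
  have e2 : ω ^ 2 * wInner ε (proj0 ε η.1) (proj0 ε x) ≤ Y * X := by
    have := mul_le_mul_of_nonneg_left hc2 (sq_nonneg ω)
    rw [hX, hY]; linarith
  have e3 : ω ^ 2 * wNorm ε (proj0 ε x) ^ 2 = X ^ 2 := by rw [hX]; ring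
  have e4 : X ^ 2 + Z ^ 2 ≤ W ^ 2 := by
    have h1 : ω ^ 2 * wNorm ε u ^ 2 = ω ^ 2 * wNorm ε u0 ^ 2 + X ^ 2 + Z ^ 2 := by
      rw [hpyth, hX, hZ]; ring
    have h2 : 0 ≤ ω ^ 2 * wNorm ε u0 ^ 2 := by positivity
    rw [hW2', h1]
    linarith [sq_nonneg (wNorm ν (M.toL2 (M.dCurl ℓ w)))]
  have e5 : Y * X ≤ H * (g * (m * W)) := mul_le_mul hdη hdx hx0 hH0
  have e6 : X ^ 2 ≤ (g * (m * W)) ^ 2 := pow_le_pow_left₀ hx0 hdx 2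
  -- the square of `2 H - m W` makes the mixed term absorbable with the constants `4` and `m²`
  have e7 : 4 * (H * (g * (m * W))) ≤ 4 * g * H ^ 2 + g * (m ^ 2 * W ^ 2) := by
    linarith only [mul_nonneg hg (sq_nonneg (2 * H - m * W))]
  -- only one copy of `Z²` is affordable, because `X² + Z² ≤ |||w|||²`
  have e8 : 4 * (T * Z) ≤ 4 * T ^ 2 + Z ^ 2 := by
    linarith only [sq_nonneg (2 * T - Z)]
  have e9 : m ^ 2 * (g + 3 * g ^ 2) * W ^ 2 = g * (m ^ 2 * W ^ 2) + 3 * (g * (m * W)) ^ 2 := by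
    ring
  rw [mul_add, mul_add, mul_add, e3, e9]
  linarith only [e1, e2, e4, e5, e6, e7, e8]

/-- The error estimate, if the factors are finite. The estimate for `|||w|||²` is added to the
identity `|||e|||² = |||η|||² + |||w|||²`, and `|||w||| ≤ |||e|||` is used on the right. -/
lemma error_estimate (hD : IsLipschitzDomain D) (hε : IsMaterial D ε) (hν : IsMaterial D ν)
    (hω : 0 < ω) (hres : NonResonant D ε ν ω) (hs : M.IsStabilization k s) (hρ : 0 < ρ)
    (hctrl : ∀ v : M.P k, ρ * M.nc ν k ℓ v ≤ Real.sqrt (s (M.incl k v) (M.incl k v)))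
    (hP : M.gammaP ε ν ω k ≠ ⊤) (hQ : M.gammaD ε ν ω ℓ ≠ ⊤) (hdiv : M.gammaDiv ε ν ω k ℓ ≠ ⊤)
    {J : L2 D} {E : H0curl D} {Eh : M.P k}
    (hE : SolvesWeak ε ν ω J E) (hEh : M.SolvesDiscrete ε ν ω k ℓ s J Eh) {e η : M.V k}
    (he : e = M.inclH k E - M.incl k Eh)
    (hη : η = M.inclH k E - M.incl k (M.best ε ν ω k ℓ s (M.inclH k E))) :
    (1 - (8 * max ((M.gammaP ε ν ω k).toReal ^ 2) (ρ⁻¹ ^ 2 * (M.gammaD ε ν ω ℓ).toReal ^ 2)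
        + max 1 (ρ⁻¹ ^ 2) * ((M.gammaDiv ε ν ω k ℓ).toReal
          + 3 * (M.gammaDiv ε ν ω k ℓ).toReal ^ 2))) * M.normSS ε ν ω k ℓ s e ^ 2
      ≤ (1 + 4 * (M.gammaDiv ε ν ω k ℓ).toReal) * M.normSS ε ν ω k ℓ s η ^ 2
        + 2 * ρ⁻¹ * M.normSS ε ν ω k ℓ s e * M.distH ν ℓ (mul ν (curl (E : L2 D))) := by
  set w : M.P k := M.best ε ν ω k ℓ s (M.inclH k E) - Eh with hw
  have hew : e = η + M.incl k w := by rw [he, hη, hw, M.incl_sub]; abel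
  have hbest : M.bssPlus ε ν ω k ℓ s η (M.incl k w) = 0 := by
    rw [hη]; exact M.isBest_best hD hε hν hs hω (M.inclH k E) w
  have hsq := M.normSS_sq_error hD hε hν hs hbest
  rw [← hew] at hsq
  have hpair := M.discrete_error_pairing_le hD hε hν hω hs hρ hctrl hdiv hew
    (fun q hq => by rw [he]; exact M.bss_error_conforming hD hε hν hs hE hEh hq)
  have hperp := M.wNorm_error_perp_le hD hε hν hω hres hs hρ hctrl hP hQ hE hEh he
  have hdef := M.abs_defect_le hD hν k ℓ
    ⟨_, hasWeakCurl_mul_curl hD.isOpen hε hν hE.2⟩ w.1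
  rw [← M.bss_error hD hε hν hs hE hEh w, ← he] at hdef
  -- the forms `b_♯♯` and `b_♯♯⁺` differ by the zero-order term
  have hplus : M.bss ε ν ω k ℓ s e (M.incl k w)
      = M.normSS ε ν ω k ℓ s (M.incl k w) ^ 2 - 2 * (ω ^ 2 * wInner ε e.1 (M.toL2 w)) := by
    have h1 : M.bssPlus ε ν ω k ℓ s e (M.incl k w)
        = M.normSS ε ν ω k ℓ s (M.incl k w) ^ 2 := by
      rw [M.normSS_sq hε hν hs, hew, M.bssPlus_eq hD hε hν, map_add, LinearMap.add_apply,
        ← M.bssPlus_eq hD hε hν, hbest, zero_add, ← M.bssPlus_eq hD hε hν]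
    rw [← h1, bss, bssPlus]
    simp only [incl]
    ring
  have hse := hs.nonneg e
  have hsw := hs.nonneg (M.incl k w)
  have heN := M.normSS_sq_eq_add (ε := ε) (ν := ν) (ω := ω) (ℓ := ℓ) hs e
  have hwN := M.normSS_sq_eq_add (ε := ε) (ν := ν) (ω := ω) (ℓ := ℓ) hs (M.incl k w)
  set N := M.normSS ε ν ω k ℓ s e with hN
  set W := M.normSS ε ν ω k ℓ s (M.incl k w) with hW
  set H := M.normSS ε ν ω k ℓ s η with hH
  have hN0 : 0 ≤ N := M.normSS_nonneg _
  have hW0 : 0 ≤ W := M.normSS_nonneg _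
  have hWN : W ≤ N := le_of_sq_le_sq (by rw [hsq]; linarith [sq_nonneg H]) hN0
  set δ := M.distH ν ℓ (mul ν (curl (E : L2 D)))
  have hδ : 0 ≤ δ := Real.iInf_nonneg fun _ => M.normH_nonneg _
  have hncW : M.nc ν k ℓ w.1 ≤ ρ⁻¹ * N := by
    refine le_trans ?_ (mul_le_mul_of_nonneg_left hWN (inv_nonneg.2 hρ.le))
    rw [inv_mul_eq_div, le_div_iff₀ hρ, mul_comm]
    refine (hctrl w).trans (Real.sqrt_le_iff.2 ⟨hW0, ?_⟩)
    rw [hwN]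
    have : 0 ≤ ω ^ 2 * wNorm ε (M.incl k w).1 ^ 2 := by positivity
    linarith [sq_nonneg (wNorm ν (M.dCurlV k ℓ (M.incl k w)))]
  have hb : M.bss ε ν ω k ℓ s e (M.incl k w) ≤ δ * (ρ⁻¹ * N) :=
    (le_abs_self _).trans (hdef.trans (mul_le_mul_of_nonneg_left hncW hδ))
  set gp := (M.gammaP ε ν ω k).toReal
  set gd := (M.gammaD ε ν ω ℓ).toReal
  set G := max (gp ^ 2) (ρ⁻¹ ^ 2 * gd ^ 2) with hG
  have hG0 : 0 ≤ G := le_max_of_le_left (sq_nonneg gp)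
  -- the factor `2` comes from `(x + y)² ≤ 2 (x² + y²)`
  have hT : (ω * wNorm ε (e.1 - proj0 ε e.1)) ^ 2 ≤ 2 * G * N ^ 2 := by
    have h1 := pow_le_pow_left₀ (mul_nonneg hω.le (wNorm_nonneg _)) hperp 2
    have ha2 := Real.sq_sqrt (show 0 ≤ ω ^ 2 * wNorm ε e.1 ^ 2
      + wNorm ν (M.dCurlV k ℓ e) ^ 2 by positivity)
    have hs2 := Real.sq_sqrt hse
    refine h1.trans ?_
    rw [heN]
    generalize Real.sqrt (ω ^ 2 * wNorm ε e.1 ^ 2 + wNorm ν (M.dCurlV k ℓ e) ^ 2) = a at *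
    generalize Real.sqrt (s e e) = b at *
    rw [← ha2, ← hs2]
    have h2 : gp ^ 2 ≤ G := le_max_left _ _
    have h3 : ρ⁻¹ ^ 2 * gd ^ 2 ≤ G := le_max_right _ _
    have h4 := mul_le_mul_of_nonneg_right h2 (sq_nonneg a)
    have h5 := mul_le_mul_of_nonneg_right h3 (sq_nonneg b)
    linarith only [h4, h5, sq_nonneg (gp * a - ρ⁻¹ * gd * b)]
  set c := max 1 (ρ⁻¹ ^ 2) * ((M.gammaDiv ε ν ω k ℓ).toReal
    + 3 * (M.gammaDiv ε ν ω k ℓ).toReal ^ 2) with hc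
  have hc0 : 0 ≤ c := mul_nonneg (le_max_of_le_left zero_le_one)
    (by have : 0 ≤ (M.gammaDiv ε ν ω k ℓ).toReal := ENNReal.toReal_nonneg
        positivity)
  have hcW : c * W ^ 2 ≤ c * N ^ 2 :=
    mul_le_mul_of_nonneg_left (pow_le_pow_left₀ hW0 hWN 2) hc0
  linarith

/-- If the constant of the error estimate is finite, so are the three factors. -/
lemma factors_ne_top (hρ : 0 < ρ) (h : M.cGamma ε ν ω k ℓ ρ ≠ ⊤) :
    M.gammaP ε ν ω k ≠ ⊤ ∧ M.gammaD ε ν ω ℓ ≠ ⊤ ∧ M.gammaDiv ε ν ω k ℓ ≠ ⊤ := by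
  have hr : ENNReal.ofReal (ρ⁻¹ ^ 2) ≠ 0 := by
    rw [Ne, ENNReal.ofReal_eq_zero, not_le]; positivity
  refine ⟨fun h0 => h ?_, fun h0 => h ?_, fun h0 => h ?_⟩
  · simp [cGamma, h0, ENNReal.mul_top]
  · rw [cGamma, h0, ENNReal.top_pow two_ne_zero, ENNReal.mul_top hr]
    simp [ENNReal.mul_top]
  · simp [cGamma, h0, ENNReal.mul_top]

lemma toReal_cGamma (hρ : 0 < ρ) (h : M.cGamma ε ν ω k ℓ ρ ≠ ⊤) :
    (M.cGamma ε ν ω k ℓ ρ).toReal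
      = 8 * max ((M.gammaP ε ν ω k).toReal ^ 2) (ρ⁻¹ ^ 2 * (M.gammaD ε ν ω ℓ).toReal ^ 2)
        + max 1 (ρ⁻¹ ^ 2) * ((M.gammaDiv ε ν ω k ℓ).toReal
          + 3 * (M.gammaDiv ε ν ω k ℓ).toReal ^ 2) := by
  obtain ⟨hP, hQ, hdiv⟩ := M.factors_ne_top hρ h
  have hr : 0 ≤ ρ⁻¹ ^ 2 := by positivity
  have h1 : M.gammaP ε ν ω k ^ 2 ≠ ⊤ := ENNReal.pow_ne_top hP
  have h2 : ENNReal.ofReal (ρ⁻¹ ^ 2) * M.gammaD ε ν ω ℓ ^ 2 ≠ ⊤ :=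
    ENNReal.mul_ne_top ENNReal.ofReal_ne_top (ENNReal.pow_ne_top hQ)
  have h3 : 3 * M.gammaDiv ε ν ω k ℓ ^ 2 ≠ ⊤ :=
    ENNReal.mul_ne_top (by simp) (ENNReal.pow_ne_top hdiv)
  rw [cGamma, ENNReal.toReal_add, ENNReal.toReal_mul, ENNReal.toReal_mul, ENNReal.toReal_max h1 h2,
    ENNReal.toReal_max ENNReal.one_ne_top ENNReal.ofReal_ne_top, ENNReal.toReal_add hdiv h3,
    ENNReal.toReal_mul, ENNReal.toReal_mul, ENNReal.toReal_pow, ENNReal.toReal_pow,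
    ENNReal.toReal_pow, ENNReal.toReal_ofReal hr]
  · simp
  · exact ENNReal.mul_ne_top (by simp) (max_lt h1.lt_top h2.lt_top).ne
  · exact ENNReal.mul_ne_top (max_lt ENNReal.one_lt_top ENNReal.ofReal_lt_top).ne
      (ENNReal.add_ne_top.2 ⟨hdiv, h3⟩)

/-- The error estimate with the constant as an extended real number. If the constant is infinite,
the left-hand side is `-∞`, or the error is zero. -/
lemma error_estimate_ereal (hD : IsLipschitzDomain D) (hε : IsMaterial D ε) (hν : IsMaterial D ν)
    (hω : 0 < ω) (hres : NonResonant D ε ν ω) (hs : M.IsStabilization k s) (hρ : 0 < ρ)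
    (hctrl : ∀ v : M.P k, ρ * M.nc ν k ℓ v ≤ Real.sqrt (s (M.incl k v) (M.incl k v)))
    {J : L2 D} {E : H0curl D} {Eh : M.P k}
    (hE : SolvesWeak ε ν ω J E) (hEh : M.SolvesDiscrete ε ν ω k ℓ s J Eh) {e η : M.V k}
    (he : e = M.inclH k E - M.incl k Eh)
    (hη : η = M.inclH k E - M.incl k (M.best ε ν ω k ℓ s (M.inclH k E))) :
    (1 - (M.cGamma ε ν ω k ℓ ρ : EReal)) * ((M.normSS ε ν ω k ℓ s e ^ 2 : ℝ) : EReal)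
      ≤ (1 + 4 * (M.gammaDiv ε ν ω k ℓ : EReal)) * ((M.normSS ε ν ω k ℓ s η ^ 2 : ℝ) : EReal)
        + ((2 * ρ⁻¹ * M.normSS ε ν ω k ℓ s e
            * M.distH ν ℓ (mul ν (curl (E : L2 D))) : ℝ) : EReal) := by
  by_cases htop : M.cGamma ε ν ω k ℓ ρ = ⊤
  · rw [htop, EReal.coe_ennreal_top]
    rw [EReal.sub_top]
    rcases (M.normSS_nonneg e : 0 ≤ M.normSS ε ν ω k ℓ s e).eq_or_lt with h0 | h0
    · -- here the left-hand side is `-∞ * 0 = 0`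
      rw [← h0]
      have h2 : (0 : EReal) ≤ ((M.normSS ε ν ω k ℓ s η ^ 2 : ℝ) : EReal) :=
        EReal.coe_nonneg.2 (sq_nonneg _)
      have h3 : (0 : EReal) ≤ 1 + 4 * (M.gammaDiv ε ν ω k ℓ : EReal) := by positivity
      have h4 := mul_nonneg h3 h2
      simpa using h4
    · rw [EReal.bot_mul_coe_of_pos (by positivity)]
      exact bot_le
  · obtain ⟨hP, hQ, hdiv⟩ := M.factors_ne_top hρ htop
    have h := M.error_estimate hD hε hν hω hres hs hρ hctrl hP hQ hdiv hE hEh he hη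
    rw [← M.toReal_cGamma hρ htop] at h
    rw [← EReal.coe_ennreal_toReal htop, ← EReal.coe_ennreal_toReal hdiv]
    have h4 : (4 : EReal) = ((4 : ℝ) : EReal) := rfl
    rw [h4]
    exact_mod_cast h

/-! ### Well-posedness of the discrete problem -/

lemma distH_zero (hD : IsLipschitzDomain D) (ν : Coeff) (ℓ : ℕ) :
    M.distH ν ℓ 0 = 0 := by
  refine le_antisymm ?_ (Real.iInf_nonneg fun _ => M.normH_nonneg _)
  have h := M.distH_le (ν := ν) ℓ 0
    ⟨0, Submodule.zero_mem _, by rw [map_zero]; exact ⟨0, hasWeakCurl_zero⟩⟩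
  refine h.trans (le_of_eq ?_)
  have h1 : wNorm (fun x => (ν x)⁻¹) (0 : L2 D) = 0 := by
    rw [wNorm, wInner, integral_eq_zero_of_ae, Real.sqrt_zero]
    filter_upwards [Lp.coeFn_zero E3 2 (volume.restrict D)] with x hx
    rw [hx]
    simp
  have h2 (K : Finset E3) : cellSq K (0 : L2 D) = 0 := by
    have := cellSq_smul K 0 (0 : L2 D)
    simpa using this
  rw [map_zero, sub_zero, normH, curl_zero hD.isOpen, h1]
  simp [h2]

/-- If the constant of the error estimate is less than one, the discrete problem without source
has only the zero solution. -/
lemma eq_zero_of_solvesDiscrete_zero (hD : IsLipschitzDomain D) (hε : IsMaterial D ε)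
    (hν : IsMaterial D ν)
    (hω : 0 < ω) (hres : NonResonant D ε ν ω) (hs : M.IsStabilization k s) (hρ : 0 < ρ)
    (hctrl : ∀ v : M.P k, ρ * M.nc ν k ℓ v ≤ Real.sqrt (s (M.incl k v) (M.incl k v)))
    (hc : M.cGamma ε ν ω k ℓ ρ < 1) {p : M.P k} (hp : M.SolvesDiscrete ε ν ω k ℓ s 0 p) :
    p = 0 := by
  have htop : M.cGamma ε ν ω k ℓ ρ ≠ ⊤ := (hc.trans ENNReal.one_lt_top).ne
  obtain ⟨hP, hQ, hdiv⟩ := M.factors_ne_top hρ htop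
  have hDo := hD.isOpen
  have hE : SolvesWeak ε ν ω (0 : L2 D) ((0 : H0curl D) : L2 D) := by
    refine ⟨Submodule.zero_mem _, fun w _ => ?_⟩
    rw [bForm, Submodule.coe_zero, curl_zero hDo, ← hε.form_apply, ← hν.form_apply, map_zero,
      map_zero, LinearMap.zero_apply, LinearMap.zero_apply, inner_zero_left]
    ring
  have h := M.error_estimate hD hε hν hω hres hs hρ hctrl hP hQ hdiv hE hp rfl rfl
  rw [← M.toReal_cGamma hρ htop] at h
  have h0 : M.inclH k (0 : H0curl D) = 0 := rfl
  have hbest : M.best ε ν ω k ℓ s (0 : M.V k) = 0 := by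
    refine M.eq_zero_of_normSS_eq_zero (ε := ε) (ν := ν) (ℓ := ℓ) hD hε hs hω ?_
    have h1 := M.isBest_best (ν := ν) (ℓ := ℓ) hD hε hν hs hω 0 (M.best ε ν ω k ℓ s (0 : M.V k))
    rw [zero_sub, M.bssPlus_eq hD hε hν, map_neg, LinearMap.neg_apply, neg_eq_zero,
      ← M.bssPlus_eq hD hε hν, ← M.normSS_sq hε hν hs] at h1
    exact sq_eq_zero_iff.1 h1
  have hmul : mul ν (0 : L2 D) = 0 := by rw [← hν.op_apply, map_zero]
  have hi0 : M.incl k 0 = 0 := map_zero (M.inclL k)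
  have hz : M.normSS ε ν ω k ℓ s 0 ^ 2 = 0 := by
    rw [M.normSS_sq hε hν hs, M.bssPlus_eq hD hε hν, map_zero]
  have hneg : M.normSS ε ν ω k ℓ s (-M.incl k p) ^ 2 = M.normSS ε ν ω k ℓ s (M.incl k p) ^ 2 := by
    rw [M.normSS_sq hε hν hs, M.normSS_sq hε hν hs, M.bssPlus_eq hD hε hν, map_neg,
      map_neg, LinearMap.neg_apply, neg_neg, M.bssPlus_eq hD hε hν]
  rw [h0, zero_sub, hbest, hi0, sub_zero, hz, Submodule.coe_zero, curl_zero hDo, hmul,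
    M.distH_zero hD ν ℓ, mul_zero, mul_zero, add_zero, hneg] at h
  have hc' : (M.cGamma ε ν ω k ℓ ρ).toReal < 1 := by
    have := (ENNReal.toReal_lt_toReal htop ENNReal.one_ne_top).2 hc
    rwa [ENNReal.toReal_one] at this
  refine M.eq_zero_of_normSS_eq_zero (ε := ε) (ν := ν) (ω := ω) (ℓ := ℓ) hD hε hs hω ?_
  rw [← sq_eq_zero_iff]
  exact le_antisymm (nonpos_of_mul_nonpos_right h (sub_pos.2 hc')) (sq_nonneg _)

/-- A discrete problem without nonzero homogeneous solutions is well-posed. The coordinates of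
the solution in a basis are products of the source with fixed discrete fields. -/
lemma discreteWellPosed_of_unique (hD : IsLipschitzDomain D) (hε : IsMaterial D ε)
    (hν : IsMaterial D ν) (hs : M.IsStabilization k s)
    (h0 : ∀ p : M.P k, M.SolvesDiscrete ε ν ω k ℓ s 0 p → p = 0) :
    M.DiscreteWellPosed ε ν ω k ℓ s := by
  let B : LinearMap.BilinForm ℝ (M.P k) :=
    (M.formSS hD hε hν k ℓ s (-ω ^ 2)).compl₁₂ (M.inclL k) (M.inclL k)
  have hB (p w : M.P k) : B p w = M.bss ε ν ω k ℓ s (M.incl k p) (M.incl k w) := rfl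
  have hcomm (p w : M.P k) : B p w = B w p := by
    rw [hB, hB, bss, bss, hε.wInner_comm, hν.wInner_comm, hs.symm]
  have hnd (p : M.P k) (hp : ∀ w, B p w = 0) : p = 0 :=
    h0 p fun w => by rw [← hB, hp w, inner_zero_left]
  refine ⟨fun J => ?_, ?_⟩
  · let f : M.P k →ₗ[ℝ] ℝ := (innerₗ (L2 D) J).comp (M.toL2 ∘ₗ (M.P k).subtype)
    have hf (w : M.P k) : f w = ⟪J, M.toL2 w⟫ := rfl
    obtain ⟨p, hp⟩ := exists_representative B hnd f
    refine ⟨p, fun w => by rw [← hB, hp w, hf], fun q hq => ?_⟩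
    refine sub_eq_zero.1 (hnd (q - p) fun w => ?_)
    rw [map_sub, LinearMap.sub_apply, hp w, hB, hq w, hf, sub_self]
  · let b := Module.finBasis ℝ (M.P k)
    have hex (i) : ∃ w, ∀ p, B w p = b.coord i p := exists_representative B hnd (b.coord i)
    choose w hw using hex
    let Q (i j) : ℝ := M.bssPlus ε ν ω k ℓ s (M.incl k (b i)) (M.incl k (b j))
    refine ⟨Real.sqrt (∑ i, ∑ j, ‖M.toL2 (w i)‖ * ‖M.toL2 (w j)‖ * |Q i j|), fun J p hp => ?_⟩
    have hcoord (i) : |b.repr p i| ≤ ‖J‖ * ‖M.toL2 (w i)‖ := by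
      rw [← b.coord_apply, ← hw i p, hcomm, hB, hp (w i)]
      exact abs_real_inner_le_norm _ _
    have hexp : M.normSS ε ν ω k ℓ s (M.incl k p) ^ 2
        = ∑ i, ∑ j, b.repr p i * b.repr p j * Q i j := by
      let T : LinearMap.BilinForm ℝ (M.P k) :=
        (M.formSS hD hε hν k ℓ s (ω ^ 2)).compl₁₂ (M.inclL k) (M.inclL k)
      have hT (p q : M.P k) : T p q = M.bssPlus ε ν ω k ℓ s (M.incl k p) (M.incl k q) := rfl
      rw [M.normSS_sq hε hν hs, ← hT]
      conv_lhs => rw [← b.sum_repr p]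
      simp only [map_sum, map_smul, LinearMap.sum_apply, LinearMap.smul_apply, smul_eq_mul,
        Finset.mul_sum, hT]
      rw [Finset.sum_comm]
      refine Finset.sum_congr rfl fun i _ => Finset.sum_congr rfl fun j _ => ?_
      ring
    refine le_of_sq_le_sq ?_ (by positivity)
    rw [mul_pow, Real.sq_sqrt (Finset.sum_nonneg fun i _ => Finset.sum_nonneg fun j _ => by
      positivity), hexp, Finset.sum_mul]
    refine Finset.sum_le_sum fun i _ => ?_
    rw [Finset.sum_mul]
    refine Finset.sum_le_sum fun j _ => (le_abs_self _).trans ?_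
    rw [abs_mul, abs_mul]
    calc |b.repr p i| * |b.repr p j| * |Q i j|
        ≤ (‖J‖ * ‖M.toL2 (w i)‖) * (‖J‖ * ‖M.toL2 (w j)‖) * |Q i j| := by
          gcongr
          · exact hcoord i
          · exact hcoord j
      _ = _ := by ring

end Mesh

end Maxwell

theorem theorem5p4 (D : Set Maxwell.E3) (hD : Maxwell.IsLipschitzDomain D)
    (M : Maxwell.Mesh D)
    (ε ν : Maxwell.Coeff) (hε : Maxwell.IsMaterial D ε) (hν : Maxwell.IsMaterial D ν)
    (ω : ℝ) (hω : 0 < ω) (hres : Maxwell.NonResonant D ε ν ω)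
    (k ℓ : ℕ) (hk : 1 ≤ k) (hℓ : k - 1 ≤ ℓ)
    (s : LinearMap.BilinForm ℝ (M.V k)) (hs : M.IsStabilization k s)
    (ρ : ℝ) (hρ : 0 < ρ)
    (hctrl : ∀ v : M.P k, ρ * M.nc ν k ℓ v ≤ Real.sqrt (s (M.incl k v) (M.incl k v))) :
    (∀ (J : Maxwell.L2 D) (E : Maxwell.H0curl D) (Eh : M.P k),
      Maxwell.SolvesWeak ε ν ω J E → M.SolvesDiscrete ε ν ω k ℓ s J Eh →
      ∀ e η : M.V k, e = M.inclH k E - M.incl k Eh →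
        η = M.inclH k E - M.incl k (M.best ε ν ω k ℓ s (M.inclH k E)) →
        (1 - (M.cGamma ε ν ω k ℓ ρ : EReal)) * ((M.normSS ε ν ω k ℓ s e ^ 2 : ℝ) : EReal)
          ≤ (1 + 4 * (M.gammaDiv ε ν ω k ℓ : EReal))
              * ((M.normSS ε ν ω k ℓ s η ^ 2 : ℝ) : EReal)
            + ((2 * ρ⁻¹ * M.normSS ε ν ω k ℓ s e
                * M.distH ν ℓ (Maxwell.mul ν (Maxwell.curl (E : Maxwell.L2 D))) : ℝ) : EReal)) ∧
    (M.cGamma ε ν ω k ℓ ρ < 1 → M.DiscreteWellPosed ε ν ω k ℓ s) := by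
  refine ⟨fun J E Eh hE hEh e η he hη =>
    M.error_estimate_ereal hD hε hν hω hres hs hρ hctrl hE hEh he hη, fun hc => ?_⟩
  exact M.discreteWellPosed_of_unique hD hε hν hs fun p hp =>
    M.eq_zero_of_solvesDiscrete_zero hD hε hν hω hres hs hρ hctrl hc hp
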